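/- **Setting.** Let $G$ be a complex linear Lie group, i.e. a closed subgroup of the unit group of a finite-dimensional associative unital complex algebra (for instance $gl(N,\mathbb C)$) whose Lie algebra $\mathcal G$ is a complex subspace, and let $\mathcal G$ be reductive (for instance semisimple). Let $\tau,\sigma$ be commuting continuous involutions of $G$ whose differentials on $\mathcal G$ are conjugate linear and complex linear, respectively. Let $U$ be the fixed group of $\tau$, let $U_0$ be the subgroup of $U$ fixed by $\sigma$, let $\mathcal U$ be the fixed point set of $d\tau$ in $\mathcal G$, and let $\mathcal U=\mathcal U_0+\mathcal U_1$ be its decomposition into the eigenspaces of $d\sigma$ for $+1$ and $-1$. Assume that $U/U_0$ is a Riemannian symmetric space: there is given on $\mathcal U$ a non-degenerate, ad-invariant symmetric bilinear form $(\ ,\ )$ with $\mathcal U_0\perp\mathcal U_1$ that is positive definite on $\mathcal U_1$; $U_0$ acts on $\mathcal U_1$ by conjugation through isometries, and the image of this representation is compact. Let $\mathcal A$ be a maximal abelian linear subspace of $\mathcal U_1$ and $a_1,\dots,a_n$ an orthonormal basis of $\mathcal A$. A point $p\in\mathcal U_1$ is regular if $\{\xi\in\mathcal U_1 : [\xi,p]=0\}$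 is a maximal abelian subspace of $\mathcal U_1$ containing $p$; let $\mathcal U_1^0$ be the set of regular points. For an open set $O\subseteq\mathbb R^n$ containing $0$, a solution on $O$ of the $U/U_0$-system is a smooth map $v:O\to\mathcal U_1\cap\mathcal A^\perp$ with $$[a_i,v_{x_j}]-[a_j,v_{x_i}]=[[a_i,v],[a_j,v]],\qquad i\ne j .$$ A frame of $v$ is a family of maps $E(\cdot,\lambda):O\to G$, $\lambda\in\mathbb C$, with $$E^{-1}dE=\sum_{i=1}^n(a_i\lambda+[a_i,v])\,dx_i,\qquad E(0,\lambda)=e .$$ Put $Y(x)=\dfrac{\partial E}{\partial\lambda}(x,0)\,E(x,0)^{-1}$. **Theorem.** 1. Let $v$ be a solution on $\mathbb R^n$. Then $v$ has a frame, and for every frame $E$ of $v$ the map $\lambda\mapsto E(x,\lambda)$ is complex differentiable at $\lambda=0$ for all $x$, $Y$ is a smooth immersion of $\mathbb R^n$ into the Euclidean space $\mathcal U_1$, its induced metric is flat, and its tangent space is a maximal abelian subspace of $\mathcal U_1$ at every point. 2. Conversely, locally all such flat submanifolds in $\mathcal U_1^0$ are of this form, up to a translation and conjugation by an element of $U_0$.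 That is, let $W\subseteq\mathbb R^m$ be open and $X:W\to\mathcal U_1$ a smooth immersion with flat induced metric, all of whose tangent spaces are maximal abelian subspaces of $\mathcal U_1$, and with $X(W)\subseteq\mathcal U_1^0$. Then for every $w_0\in W$ there are an open ball $O$ (for the maximum norm) around $0$ in $\mathbb R^n$, a solution $v$ on $O$ with a frame $E$ that is complex differentiable in $\lambda$ at $\lambda=0$, a diffeomorphism $\varphi$ from $O$ onto an open subset of $W$ with $\varphi(0)=w_0$, and an element $k\in U_0$ such that $$X(\varphi(x))=X(w_0)+k\,Y(x)\,k^{-1}\qquad\text{for all }x\in O .$$ -/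

import Mathlib

open scoped ContDiff

noncomputable section

namespace CurvedFlats

variable {𝔸 : Type*} [NormedRing 𝔸] [NormedAlgebra ℂ 𝔸]

attribute [local instance] LieRing.ofAssociativeRing

/-- A complex linear Lie group `G` with two commuting involutions `τ` (with conjugate linear
differential) and `σ` (with complex linear differential).  `G` is a closed subgroup of the unit
group of a complex algebra `𝔸` (for instance `𝔸 = gl(N, ℂ)`) whose Lie algebra is a complex
reductive Lie algebra. -/
structure SymmetricPair (𝔸 : Type*) [NormedRing 𝔸] [NormedAlgebra ℂ 𝔸] where
  /-- The complex Lie group. -/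
  G : Subgroup 𝔸ˣ
  isClosed_G : IsClosed (G : Set 𝔸ˣ)
  /-- The Lie algebra of `G`. -/
  𝔤 : LieSubalgebra ℂ 𝔸
  mem_𝔤 : ∀ X : 𝔸, X ∈ 𝔤 ↔ ∀ t : ℝ, ∃ g ∈ G, (g : 𝔸) = NormedSpace.exp (t • X)
  /-- The Lie algebra is reductive: its radical is its center.
  Semisimple Lie algebras are those with radical zero. -/
  reductive : LieAlgebra.HasCentralRadical ℂ 𝔤
  τ : G →* G
  continuous_τ : Continuous τ
  τ_τ : ∀ g, τ (τ g) = g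
  σ : G →* G
  continuous_σ : Continuous σ
  σ_σ : ∀ g, σ (σ g) = g
  σ_τ : ∀ g, σ (τ g) = τ (σ g)
  /-- The differential of `τ` at the identity. -/
  dτ : 𝔤 →ₛₗ[starRingEnd ℂ] 𝔤
  dτ_lie : ∀ X Y, dτ ⁅X, Y⁆ = ⁅dτ X, dτ Y⁆
  τ_exp : ∀ (X : 𝔤) (g : G), ((g : 𝔸ˣ) : 𝔸) = NormedSpace.exp (X : 𝔸) →
    ((τ g : 𝔸ˣ) : 𝔸) = NormedSpace.exp (dτ X : 𝔸)
  /-- The differential of `σ` at the identity. -/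
  dσ : 𝔤 →ₗ⁅ℂ⁆ 𝔤
  σ_exp : ∀ (X : 𝔤) (g : G), ((g : 𝔸ˣ) : 𝔸) = NormedSpace.exp (X : 𝔸) →
    ((σ g : 𝔸ˣ) : 𝔸) = NormedSpace.exp (dσ X : 𝔸)

namespace SymmetricPair

variable (P : SymmetricPair 𝔸)

/-- The subgroup `U₀` of the elements of `G` fixed by `τ` (that is, in `U`) and by `σ`. -/
def U₀ : Subgroup 𝔸ˣ where
  carrier := {k | ∃ h : k ∈ P.G, P.τ ⟨k, h⟩ = ⟨k, h⟩ ∧ P.σ ⟨k, h⟩ = ⟨k, h⟩}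
  one_mem' := ⟨P.G.one_mem, map_one P.τ, map_one P.σ⟩
  mul_mem' := by
    rintro x y ⟨hx, h1, h2⟩ ⟨hy, h3, h4⟩
    have e : (⟨x * y, P.G.mul_mem hx hy⟩ : P.G) = ⟨x, hx⟩ * ⟨y, hy⟩ := rfl
    exact ⟨P.G.mul_mem hx hy, by rw [e, map_mul, h1, h3], by rw [e, map_mul, h2, h4]⟩
  inv_mem' := by
    rintro x ⟨hx, h1, h2⟩
    have e : (⟨x⁻¹, P.G.inv_mem hx⟩ : P.G) = ⟨x, hx⟩⁻¹ := rfl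
    exact ⟨P.G.inv_mem hx, by rw [e, map_inv, h1], by rw [e, map_inv, h2]⟩

/-- The real form `𝔲` of `𝔤` fixed by `dτ`; it is the Lie algebra of the fixed group `U` of `τ`. -/
def 𝔲 : Submodule ℝ 𝔸 where
  carrier := {X | ∃ h : X ∈ P.𝔤, P.dτ ⟨X, h⟩ = ⟨X, h⟩}
  zero_mem' := ⟨P.𝔤.zero_mem, map_zero P.dτ⟩
  add_mem' := by
    rintro x y ⟨hx, h1⟩ ⟨hy, h2⟩
    have e : (⟨x + y, P.𝔤.add_mem hx hy⟩ : P.𝔤) = ⟨x, hx⟩ + ⟨y, hy⟩ := rfl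
    exact ⟨P.𝔤.add_mem hx hy, by rw [e, map_add, h1, h2]⟩
  smul_mem' := by
    rintro c x ⟨hx, h1⟩
    have hc : c • x ∈ P.𝔤 := by
      simpa using P.𝔤.smul_mem (c : ℂ) hx
    have e : (⟨c • x, hc⟩ : P.𝔤) = (c : ℂ) • ⟨x, hx⟩ := Subtype.ext (by simp)
    exact ⟨hc, by rw [e, LinearMap.map_smulₛₗ, h1]; simp⟩

/-- The eigenspace `{X ∈ 𝔲 | dσ X = ε X}`, for `ε = ± 1`. -/
def eigenspace (ε : ℤ) : Submodule ℝ 𝔸 where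
  carrier := {X | X ∈ P.𝔲 ∧ ∃ h : X ∈ P.𝔤, P.dσ ⟨X, h⟩ = ε • ⟨X, h⟩}
  zero_mem' := ⟨P.𝔲.zero_mem, P.𝔤.zero_mem, (map_zero P.dσ).trans (smul_zero ε).symm⟩
  add_mem' := by
    rintro x y ⟨hx', hx, h1⟩ ⟨hy', hy, h2⟩
    have e : (⟨x + y, P.𝔤.add_mem hx hy⟩ : P.𝔤) = ⟨x, hx⟩ + ⟨y, hy⟩ := rfl
    exact ⟨P.𝔲.add_mem hx' hy', P.𝔤.add_mem hx hy, by rw [e, map_add, h1, h2, smul_add]⟩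
  smul_mem' := by
    rintro c x ⟨hx', hx, h1⟩
    have hc : c • x ∈ P.𝔤 := by
      simpa using P.𝔤.smul_mem (c : ℂ) hx
    have e : (⟨c • x, hc⟩ : P.𝔤) = (c : ℂ) • ⟨x, hx⟩ := Subtype.ext (by simp)
    exact ⟨P.𝔲.smul_mem c hx', hc, by rw [e, map_smul, h1, smul_comm]⟩

/-- The Lie algebra `𝔲₀` of `U₀`: the `+1` eigenspace of `dσ` on `𝔲`. -/
def 𝔲₀ : Submodule ℝ 𝔸 := P.eigenspace 1

/-- The `-1` eigenspace `𝔲₁` of `dσ` on `𝔲`. -/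
def 𝔲₁ : Submodule ℝ 𝔸 := P.eigenspace (-1)

end SymmetricPair

/-- A Riemannian symmetric space `U/U₀`: a pair of involutions as above together with a
non-degenerate ad-invariant form on `𝔲` that induces the Riemannian metric of `U/U₀`. -/
structure SymmetricSpace (𝔸 : Type*) [NormedRing 𝔸] [NormedAlgebra ℂ 𝔸] extends
    SymmetricPair 𝔸 where
  /-- The non-degenerate, ad-invariant, `σ`-invariant symmetric bilinear form on `𝔲`.  Only its
  restriction to `𝔲` matters; elsewhere its values are irrelevant. -/
  B : 𝔸 →ₗ[ℝ] 𝔸 →ₗ[ℝ] ℝ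
  B_symm : ∀ X ∈ toSymmetricPair.𝔲, ∀ Y ∈ toSymmetricPair.𝔲, B X Y = B Y X
  B_ad : ∀ X ∈ toSymmetricPair.𝔲, ∀ Y ∈ toSymmetricPair.𝔲, ∀ Z ∈ toSymmetricPair.𝔲,
    B ⁅X, Y⁆ Z = B X ⁅Y, Z⁆
  B_nondegenerate : ∀ X ∈ toSymmetricPair.𝔲, (∀ Y ∈ toSymmetricPair.𝔲, B X Y = 0) → X = 0
  /-- Invariance under `σ`, i.e. `𝔲 = 𝔲₀ + 𝔲₁` is an orthogonal decomposition. -/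
  B_orthogonal : ∀ X ∈ toSymmetricPair.𝔲₀, ∀ Y ∈ toSymmetricPair.𝔲₁, B X Y = 0
  /-- On `𝔲₁`, the tangent space of `U/U₀` at the base point, the form is positive definite. -/
  B_pos : ∀ X ∈ toSymmetricPair.𝔲₁, X ≠ 0 → 0 < B X X
  /-- The isotropy group `U₀` acts on `𝔲₁` by isometries, and the image of this isotropy
  representation is compact. -/
  B_Ad : ∀ k ∈ toSymmetricPair.U₀, ∀ X ∈ toSymmetricPair.𝔲₁, ∀ Y ∈ toSymmetricPair.𝔲₁,
    B ((k : 𝔸) * X * (↑k⁻¹ : 𝔸)) ((k : 𝔸) * Y * (↑k⁻¹ : 𝔸)) = B X Y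
  isCompact_isotropy : IsCompact {f : toSymmetricPair.𝔲₁ → 𝔸 | ∃ k ∈ toSymmetricPair.U₀,
    ∀ X : toSymmetricPair.𝔲₁, f X = (k : 𝔸) * (X : 𝔸) * (↑k⁻¹ : 𝔸)}

/-- The partial derivative `∂f/∂xᵢ`. -/
def pd {m : ℕ} {F : Type*} [NormedAddCommGroup F] [NormedSpace ℝ F]
    (f : (Fin m → ℝ) → F) (i : Fin m) (x : Fin m → ℝ) : F :=
  fderiv ℝ f x (Pi.single i 1)

/-! ### Immersed submanifolds `X : W → 𝔲₁`, with `W` open in `ℝᵐ` -/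

section Submanifold

variable {m : ℕ}

/-- The first fundamental form `gᵢⱼ = B(∂ᵢX, ∂ⱼX)`. -/
def firstForm (B : 𝔸 →ₗ[ℝ] 𝔸 →ₗ[ℝ] ℝ) (X : (Fin m → ℝ) → 𝔸) (w : Fin m → ℝ) :
    Matrix (Fin m) (Fin m) ℝ :=
  Matrix.of fun i j => B (pd X i w) (pd X j w)

/-- The Christoffel symbols `Γˡᵢⱼ = ½ ∑ₖ gˡᵏ (∂ᵢ gⱼₖ + ∂ⱼ gᵢₖ - ∂ₖ gᵢⱼ)` of a metric. -/
def christoffel (g : (Fin m → ℝ) → Matrix (Fin m) (Fin m) ℝ) (l i j : Fin m)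
    (w : Fin m → ℝ) : ℝ :=
  (1 / 2 : ℝ) * ∑ k, (g w)⁻¹ l k *
    (pd (fun y => g y j k) i w + pd (fun y => g y i k) j w - pd (fun y => g y i j) k w)

/-- The Riemann curvature tensor of a metric,
`Rˡₖᵢⱼ = ∂ᵢ Γˡⱼₖ - ∂ⱼ Γˡᵢₖ + ∑ₚ (Γˡᵢₚ Γᵖⱼₖ - Γˡⱼₚ Γᵖᵢₖ)`. -/
def riemann (g : (Fin m → ℝ) → Matrix (Fin m) (Fin m) ℝ) (l k i j : Fin m)
    (w : Fin m → ℝ) : ℝ :=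
  pd (christoffel g l j k) i w - pd (christoffel g l i k) j w +
    ∑ p, (christoffel g l i p w * christoffel g p j k w -
      christoffel g l j p w * christoffel g p i k w)

/-- The tangent space of `X` at the point with parameter `w`. -/
def tangentSpace (X : (Fin m → ℝ) → 𝔸) (w : Fin m → ℝ) : Submodule ℝ 𝔸 :=
  LinearMap.range (fderiv ℝ X w : (Fin m → ℝ) →ₗ[ℝ] 𝔸)

end Submanifold

namespace SymmetricSpace

variable (S : SymmetricSpace 𝔸)

/-- Abelian linear subspaces of `𝔲₁`. -/
def IsAbelianIn (𝒜 : Submodule ℝ 𝔸) : Prop :=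
  𝒜 ≤ S.𝔲₁ ∧ ∀ x ∈ 𝒜, ∀ y ∈ 𝒜, ⁅x, y⁆ = 0

/-- Maximal abelian linear subspaces of `𝔲₁`. -/
def IsMaxAbelian (𝒜 : Submodule ℝ 𝔸) : Prop :=
  S.IsAbelianIn 𝒜 ∧ ∀ 𝒜' : Submodule ℝ 𝔸, S.IsAbelianIn 𝒜' → 𝒜 ≤ 𝒜' → 𝒜' = 𝒜

/-- `p` is a regular point of `𝔲₁`: it lies in a maximal abelian subspace `𝒜` of `𝔲₁` such that
`{ξ ∈ 𝔲₁ | [ξ, p] = 0} = 𝒜`. -/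
def IsRegular (p : 𝔸) : Prop :=
  ∃ 𝒜 : Submodule ℝ 𝔸, S.IsMaxAbelian 𝒜 ∧ p ∈ 𝒜 ∧ ∀ ξ : 𝔸, ξ ∈ 𝒜 ↔ ξ ∈ S.𝔲₁ ∧ ⁅ξ, p⁆ = 0

/-- `a₁, …, aₙ` is an orthonormal basis of `𝒜`. -/
def IsOrthonormalBasis {n : ℕ} (𝒜 : Submodule ℝ 𝔸) (a : Fin n → 𝔸) : Prop :=
  (∀ i j, S.B (a i) (a j) = if i = j then 1 else 0) ∧ Submodule.span ℝ (Set.range a) = 𝒜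

/-- `v` is a smooth solution on the open set `O ⊆ ℝⁿ` of the `U/U₀`-system
`[aᵢ, ∂ⱼv] - [aⱼ, ∂ᵢv] = [[aᵢ, v], [aⱼ, v]]`, with values in `𝔲₁ ∩ 𝒜^⊥`. -/
structure IsSolution {n : ℕ} (𝒜 : Submodule ℝ 𝔸) (a : Fin n → 𝔸)
    (O : Set (Fin n → ℝ)) (v : (Fin n → ℝ) → 𝔸) : Prop where
  contDiffOn : ContDiffOn ℝ ∞ v O
  mem : ∀ x ∈ O, v x ∈ S.𝔲₁
  orthogonal : ∀ x ∈ O, ∀ b ∈ 𝒜, S.B b (v x) = 0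
  eqn : ∀ x ∈ O, ∀ i j, i ≠ j →
    ⁅a i, pd v j x⁆ - ⁅a j, pd v i x⁆ = ⁅⁅a i, v x⁆, ⁅a j, v x⁆⁆

/-- `E(x, λ)` is the frame over `O` of the Lax `n`-tuple `θ_λ = ∑ᵢ (aᵢ λ + [aᵢ, v]) dxᵢ`: for
every `λ ∈ ℂ` the map `E(·, λ)` takes values in `G`, satisfies `E⁻¹ dE = θ_λ`, i.e.
`dE = E θ_λ`, and `E(0, λ)` is the identity. -/
structure IsFrame {n : ℕ} (a : Fin n → 𝔸) (O : Set (Fin n → ℝ))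
    (v : (Fin n → ℝ) → 𝔸) (E : (Fin n → ℝ) → ℂ → 𝔸ˣ) : Prop where
  mem : ∀ x ∈ O, ∀ lam : ℂ, E x lam ∈ S.G
  init : ∀ lam : ℂ, E 0 lam = 1
  differentiableAt : ∀ x ∈ O, ∀ lam : ℂ, DifferentiableAt ℝ (fun y => (E y lam : 𝔸)) x
  eqn : ∀ x ∈ O, ∀ (lam : ℂ) (i : Fin n),
    pd (fun y => (E y lam : 𝔸)) i x = (E x lam : 𝔸) * (lam • a i + ⁅a i, v x⁆)

/-- `X : W → 𝔲₁` is a smooth immersion. -/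
structure IsImmersion {m : ℕ} (W : Set (Fin m → ℝ)) (X : (Fin m → ℝ) → 𝔸) : Prop where
  contDiffOn : ContDiffOn ℝ ∞ X W
  mem : ∀ w ∈ W, X w ∈ S.𝔲₁
  injective : ∀ w ∈ W, Function.Injective (fderiv ℝ X w)

/-- The induced metric of `X` is flat: its curvature tensor vanishes. -/
def IsFlat {m : ℕ} (W : Set (Fin m → ℝ)) (X : (Fin m → ℝ) → 𝔸) : Prop :=
  ∀ w ∈ W, ∀ l k i j, riemann (firstForm S.B X) l k i j w = 0

/-- The tangent space of `X` is a maximal abelian subspace of `𝔲₁` at every point. -/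
def HasMaxAbelianTangent {m : ℕ} (W : Set (Fin m → ℝ)) (X : (Fin m → ℝ) → 𝔸) : Prop :=
  ∀ w ∈ W, S.IsMaxAbelian (tangentSpace X w)

end SymmetricSpace

/-- `Y(x) = (∂E/∂λ)(x, 0) E(x, 0)⁻¹`. -/
def symMap {n : ℕ} (E : (Fin n → ℝ) → ℂ → 𝔸ˣ) (x : Fin n → ℝ) : 𝔸 :=
  deriv (fun lam : ℂ => (E x lam : 𝔸)) 0 * (↑(E x 0)⁻¹ : 𝔸)

end CurvedFlats

end

/-!
Bracket relations in `𝔲 = 𝔲₀ + 𝔲₁` and the adjoint action of `U₀` on `𝔲₁` carry both directions.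

**From solutions to flats.** The system says that the form `θ_λ = λ α + [α, v]`, with
`α = ∑ aᵢ dxᵢ`, satisfies the zero curvature equation for every `λ` (`IsSolution.flat`), so
`dE = E θ_λ` can be solved (`exists_flat_frame`), with values in `G` since `θ_λ` takes values in its
Lie algebra (`frame_mem`). At `λ = 0` the form is `𝔲₀`-valued and `E₀ = E(·, 0)` is `U₀`-valued.
First order perturbation along rays (`hasDerivAt_of_linear_ode_smul`) shows that `Y` is a primitive
of the closed form `E₀ α E₀⁻¹` (`IsFrame.symMap`). Hence the tangent space of `Y` is a `U₀`-conjugate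
of `𝒜`, and as `U₀` acts by isometries, the metric of `Y` has the constant coefficients
`B(aᵢ, aⱼ)` (`IsFrame.curvedFlat`).

**Structure of `𝔲₁`.** For `p ∈ 𝔲₁` the operators `ad(p)²` and `ad(p)` have the same kernel on `𝔲₁`
(`lie_eq_zero_of_lie_lie_eq_zero`). If `[p, [p, x]] = 0`, then `[p, x]` is nilpotent by Jacobson's
lemma. It acts by skew operators on the Euclidean space `𝔲₁`, so it centralizes `𝔲₁`; it is then
orthogonal to `𝔤` for the Killing form, hence central, and a central element of `[𝔲₁, 𝔲₁]` vanishes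
in a reductive algebra with an invariant non-degenerate form. As `ad(p)²` is symmetric, `𝔲₁` is the
sum of its kernel and its image. It follows that a maximal abelian subspace is the centralizer in
`𝔲₁` of one of its elements (`exists_centralizer₁_eq`), and minimizing `B(·, a)` on the compact
`U₀`-orbits shows that all maximal abelian subspaces are conjugate (`exists_conj_maxAbelian`).

**From flats to solutions.** Let `X` have maximal abelian tangent spaces and let `p = ∂_c X` be a
tangent field whose centralizer is the tangent space. Splitting `𝔲₁` by `ad(p)²` gives a potential
`V` with values in `𝔲₁` for which `∂_c p - [[p, V], p]` is tangent (`exists_isPotential`).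
Differentiating the relations `[t, p] = 0` shows that the connection `∂_ξ - ad [∂_ξ X, V]` preserves
all tangent fields (`IsPotential.conn_tangent_mem`). Its curvature therefore preserves the tangent
space; it is also orthogonal to the centralizer of the tangent space in `𝔲₀`, and an element of `𝔲₀`
with both properties vanishes (`eq_zero_of_lie_mem`, `IsPotential.curvature_eq_zero`). A parallel
gauge with values in `U₀`, composed with a conjugation, turns `dX` into a closed form with values in
`𝒜` (`exists_gauge_maxAbelian`), whose primitive provides the coordinates in which it is `α`
(`exists_coordinates`). In these coordinates the part of the gauged potential that is orthogonal to
`𝒜` is the solution `v`; the inverse of the gauge is, up to a constant factor, the frame at `λ = 0`,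
and `X` and the conjugate of `Y` have the same differential (`exists_local_form`).
-/

open scoped ContDiff

noncomputable section

namespace CurvedFlats

open Set Filter Topology MeasureTheory SymmetricPair

/-! ### Linear differential equations in Banach algebras -/

section LinearODE

variable {A : Type*} [NormedRing A] [NormedAlgebra ℝ A]

/-- The iterated integrals `P₀ = 1`, `Pₖ₊₁(t) = ∫₀ᵗ Pₖ θ`, whose sum solves `P' = P θ`. -/
def dysonTerm (θ : ℝ → A) : ℕ → ℝ → A
  | 0 => fun _ => 1
  | k + 1 => fun t => ∫ s in (0 : ℝ)..t, dysonTerm θ k s * θ s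

lemma continuous_dysonTerm [CompleteSpace A] {θ : ℝ → A} (hθ : Continuous θ) (k : ℕ) :
    Continuous (dysonTerm θ k) := by
  induction k with
  | zero => exact continuous_const
  | succ k ih =>
    exact intervalIntegral.continuous_primitive (μ := volume)
      (fun a b => (ih.mul hθ).intervalIntegrable a b) 0

lemma hasDerivAt_dysonTerm_succ [CompleteSpace A] {θ : ℝ → A} (hθ : Continuous θ) (k : ℕ)
    (t : ℝ) : HasDerivAt (dysonTerm θ (k + 1)) (dysonTerm θ k t * θ t) t :=
  ((continuous_dysonTerm hθ k).mul hθ).integral_hasStrictDerivAt 0 t |>.hasDerivAt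

lemma norm_dysonTerm_le {θ : ℝ → A} {C T : ℝ}
    (hC : ∀ t ∈ Icc (-T) T, ‖θ t‖ ≤ C) (k : ℕ) :
    ∀ t ∈ Icc (-T) T, ‖dysonTerm θ k t‖ ≤ ‖(1 : A)‖ * (C ^ k * |t| ^ k / k.factorial) := by
  induction k with
  | zero => intro t _; simp [dysonTerm]
  | succ k ih =>
    intro t ht
    have hT : 0 ≤ T := by linarith [ht.1, ht.2]
    have hC0 : 0 ≤ C := (norm_nonneg _).trans (hC t ht)
    have hsub : ∀ s ∈ uIoc 0 t, s ∈ Icc (-T) T := by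
      intro s hs
      have := uIoc_subset_uIcc hs
      exact (uIcc_subset_Icc (by constructor <;> linarith) ht) this
    change ‖∫ s in (0 : ℝ)..t, dysonTerm θ k s * θ s‖ ≤ _
    have h1 : ∀ s ∈ uIoc 0 t, ‖dysonTerm θ k s * θ s‖ ≤
        (‖(1 : A)‖ * (C ^ (k + 1) / k.factorial)) * |s - 0| ^ k := by
      intro s hs
      refine (norm_mul_le _ _).trans ?_
      calc ‖dysonTerm θ k s‖ * ‖θ s‖ ≤ (‖(1 : A)‖ * (C ^ k * |s| ^ k / k.factorial)) * C := by
            gcongr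
            · exact ih s (hsub s hs)
            · exact hC s (hsub s hs)
        _ = _ := by rw [sub_zero]; ring
    calc ‖∫ s in (0 : ℝ)..t, dysonTerm θ k s * θ s‖
        ≤ ∫ s in uIoc 0 t, (‖(1 : A)‖ * (C ^ (k + 1) / k.factorial)) * |s - 0| ^ k := by
          rw [intervalIntegral.norm_intervalIntegral_eq]
          refine norm_integral_le_of_norm_le ?_ ?_
          · exact (Continuous.integrableOn_uIoc (by fun_prop))
          · exact (ae_restrict_mem measurableSet_uIoc).mono h1
      _ = _ := by
          rw [integral_const_mul, integral_pow_abs_sub_uIoc]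
          rw [Nat.factorial_succ]
          push_cast
          have : (k.factorial : ℝ) ≠ 0 := by positivity
          have h2 : (k : ℝ) + 1 ≠ 0 := by positivity
          rw [sub_zero]
          field_simp

/-- A linear ordinary differential equation with continuous coefficient has a global solution. -/
lemma exists_linear_ode [CompleteSpace A] {θ : ℝ → A} (hθ : Continuous θ) :
    ∃ P : ℝ → A, P 0 = 1 ∧ ∀ t, HasDerivAt P (P t * θ t) t := by
  refine ⟨fun t => ∑' k, dysonTerm θ k t, ?_, fun t => ?_⟩
  · change ∑' k, dysonTerm θ k 0 = 1
    rw [tsum_eq_single 0]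
    · rfl
    · rintro (_ | k) hk
      · exact absurd rfl hk
      · change ∫ s in (0 : ℝ)..0, dysonTerm θ k s * θ s = 0
        simp
  · set T : ℝ := |t| + 1 with hT
    have hT0 : 0 < T := by positivity
    obtain ⟨C, hC⟩ := isCompact_Icc.exists_bound_of_continuousOn (s := Icc (-T) T) hθ.continuousOn
    have hC0 : 0 ≤ C := (norm_nonneg _).trans (hC 0 (by constructor <;> linarith))
    have hsum : Summable fun k : ℕ => ‖(1 : A)‖ * ((C * T) ^ k / k.factorial) :=
      (Real.summable_pow_div_factorial (C * T)).mul_left _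
    have hb : ∀ k, ∀ s ∈ Icc (-T) T,
        ‖dysonTerm θ k s‖ ≤ ‖(1 : A)‖ * ((C * T) ^ k / k.factorial) := by
      intro k s hs
      refine (norm_dysonTerm_le hC k s hs).trans ?_
      rw [mul_pow]
      gcongr
      exact abs_le.2 hs
    have hsummable : ∀ s ∈ Icc (-T) T, Summable fun k => dysonTerm θ k s := fun s hs =>
      Summable.of_norm_bounded hsum (fun k => hb k s hs)
    have ht : t ∈ Ioo (-T) T := ⟨by linarith [neg_abs_le t], by linarith [le_abs_self t]⟩
    have key := hasDerivAt_tsum_of_isPreconnected (t := Ioo (-T) T) (y := t) (y₀ := 0)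
      (u := fun k => (‖(1 : A)‖ * ((C * T) ^ k / k.factorial)) * C)
      (g := fun k => dysonTerm θ (k + 1)) (g' := fun k s => dysonTerm θ k s * θ s)
      (hsum.mul_right C) isOpen_Ioo isPreconnected_Ioo
      (fun k s _ => hasDerivAt_dysonTerm_succ hθ k s)
      (fun k s hs => (norm_mul_le _ _).trans (by
        gcongr
        · exact hb k s (Ioo_subset_Icc_self hs)
        · exact hC s (Ioo_subset_Icc_self hs)))
      (by constructor <;> linarith)
      ((summable_nat_add_iff 1).2 (hsummable 0 (by constructor <;> linarith))) ht
    have hd : ∑' k, dysonTerm θ k t * θ t = (∑' k, dysonTerm θ k t) * θ t :=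
      (hsummable t (Ioo_subset_Icc_self ht)).tsum_mul_right _
    rw [hd] at key
    have h2 := key.const_add (1 : A)
    refine h2.congr_of_eventuallyEq ?_
    filter_upwards [isOpen_Ioo.mem_nhds ht] with s hs
    rw [(hsummable s (Ioo_subset_Icc_self hs)).tsum_eq_zero_add]
    rfl

/-- Two solutions of `P' = P θ` with the same initial value agree. -/
lemma linear_ode_unique {θ : ℝ → A} (hθ : ContinuousOn θ (Icc 0 1)) {P Q : ℝ → A}
    (hP : ∀ t ∈ Icc (0 : ℝ) 1, HasDerivAt P (P t * θ t) t)
    (hQ : ∀ t ∈ Icc (0 : ℝ) 1, HasDerivAt Q (Q t * θ t) t) (h0 : P 0 = Q 0) :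
    ∀ t ∈ Icc (0 : ℝ) 1, P t = Q t := by
  obtain ⟨C, hC⟩ := isCompact_Icc.exists_bound_of_continuousOn hθ
  have hd : ∀ t ∈ Icc (0 : ℝ) 1, HasDerivAt (fun s => P s - Q s) ((P t - Q t) * θ t) t := by
    intro t ht
    rw [sub_mul]
    exact (hP t ht).sub (hQ t ht)
  have := eq_zero_of_abs_deriv_le_mul_abs_self_of_eq_zero_right (a := 0) (b := 1) (K := C)
    (f := fun s => P s - Q s) (f' := fun t => (P t - Q t) * θ t)
    (fun t ht => (hd t ht).continuousAt.continuousWithinAt)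
    (fun t ht => (hd t (Ico_subset_Icc_self ht)).hasDerivWithinAt) (by simp [h0])
    (fun t ht => by
      rw [mul_comm C]
      exact (norm_mul_le _ _).trans (by gcongr; exact hC t (Ico_subset_Icc_self ht)))
  intro t ht
  exact sub_eq_zero.1 (this t ht)

/-- The value at time `1` of the solution of `P' = P θ`, `P(0) = 1` is invertible: its inverse is
obtained by running the equation backwards. -/
lemma isUnit_of_linear_ode [CompleteSpace A] {θ : ℝ → A} (hθ : Continuous θ) {P : ℝ → A}
    (h0 : P 0 = 1) (hP : ∀ t, HasDerivAt P (P t * θ t) t) : IsUnit (P 1) := by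
  have key : ∀ {θ ψ : ℝ → A}, Continuous θ → Continuous ψ → (∀ s, ψ s = -θ (1 - s)) →
      ∀ {P Q : ℝ → A}, P 0 = 1 → Q 0 = 1 → (∀ t, HasDerivAt P (P t * θ t) t) →
      (∀ t, HasDerivAt Q (Q t * ψ t) t) → P 1 * Q 1 = 1 := by
    intro θ ψ hθ hψ hrel P Q hP0 hQ0 hP hQ
    have h1 : ∀ t, HasDerivAt (fun s => P (1 - s)) (P (1 - t) * ψ t) t := by
      intro t
      have := (hP (1 - t)).scomp t ((hasDerivAt_id t).const_sub 1)
      refine this.congr_deriv ?_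
      rw [hrel]; simp
    have h2 : ∀ t, HasDerivAt (fun s => P 1 * Q s) ((P 1 * Q t) * ψ t) t := by
      intro t
      rw [mul_assoc]
      exact (hQ t).const_mul (P 1)
    have := linear_ode_unique hψ.continuousOn (fun t _ => h1 t) (fun t _ => h2 t)
      (by simp [hQ0]) 1 (by simp)
    simpa [hP0] using this.symm
  have hψ : Continuous fun s => -θ (1 - s) := by fun_prop
  obtain ⟨Q, hQ0, hQ⟩ := exists_linear_ode hψ
  exact ⟨⟨P 1, Q 1, key hθ hψ (fun _ => rfl) h0 hQ0 hP hQ,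
    key hψ hθ (fun s => by simp) hQ0 h0 hQ hP⟩, rfl⟩

/-- A solution of `P' = P θ` with `θ` in a subspace whose exponentials lie in a closed subgroup
`H` stays in `H`: the distance to `H` satisfies a Grönwall inequality. -/
lemma mem_of_linear_ode [CompleteSpace A] (H : Subgroup Aˣ) (hH : IsClosed (H : Set Aˣ))
    {θ : ℝ → A} (hθ : ContinuousOn θ (Icc 0 1))
    (hexp : ∀ t ∈ Icc (0 : ℝ) 1, ∀ s : ℝ, ∃ g ∈ H, (g : A) = NormedSpace.exp (s • θ t))
    {P : ℝ → A} (h0 : P 0 = 1) (hP : ∀ t ∈ Icc (0 : ℝ) 1, HasDerivAt P (P t * θ t) t)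
    {g : Aˣ} (hg : (g : A) = P 1) : g ∈ H := by
  set S : Set A := (fun u : Aˣ => (u : A)) '' (H : Set Aˣ) with hS
  have hSne : S.Nonempty := ⟨1, 1, H.one_mem, rfl⟩
  obtain ⟨C, hC⟩ := isCompact_Icc.exists_bound_of_continuousOn hθ
  have hcont : ContinuousOn (fun t => Metric.infDist (P t) S) (Icc 0 1) :=
    (Metric.continuous_infDist_pt S).comp_continuousOn
      (fun t ht => (hP t ht).continuousAt.continuousWithinAt)
  have hexpd : ∀ X : A, HasDerivAt (fun s : ℝ => NormedSpace.exp (s • X)) X 0 := by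
    intro X
    simpa using hasDerivAt_exp_smul_const (𝕂 := ℝ) X (0 : ℝ)
  have hbd := le_gronwallBound_of_liminf_deriv_right_le (a := 0) (b := 1) (δ := 0) (K := C)
    (ε := 0) (f := fun t => Metric.infDist (P t) S)
    (f' := fun t => C * Metric.infDist (P t) S) hcont ?_ ?_ (fun t _ => by simp)
  · have h1 := hbd 1 (by simp)
    rw [gronwallBound_ε0_δ0] at h1
    have h2 : P 1 ∈ closure S := by
      rw [Metric.mem_closure_iff_infDist_zero hSne]
      exact le_antisymm h1 Metric.infDist_nonneg
    rw [← hg] at h2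
    have h3 : g ∈ closure (H : Set Aˣ) := by
      have := Units.isOpenEmbedding_val (R := A)
      rw [this.isEmbedding.closure_eq_preimage_closure_image]
      exact h2
    rwa [hH.closure_eq] at h3
  · intro t ht r hr
    have ht' := Ico_subset_Icc_self ht
    apply Eventually.frequently
    set X := θ t with hX
    set d := Metric.infDist (P t) S with hd
    have hd0 : 0 ≤ d := Metric.infDist_nonneg
    -- the error made in replacing `P` by the one-parameter subgroup through `P t`
    set ρ : ℝ → A := fun z => P z - P t * NormedSpace.exp ((z - t) • X) with hρ
    have hρd : HasDerivAt ρ 0 t := by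
      have h1 : HasDerivAt (fun z : ℝ => NormedSpace.exp ((z - t) • X)) X t := by
        have h2 := hexpd X
        rw [show (0 : ℝ) = t - t by simp] at h2
        exact HasDerivAt.comp_sub_const t t h2
      exact ((hP t ht').fun_sub (h1.const_mul (P t))).congr_deriv (by simp [hX])
    have hρt : ρ t = 0 := by simp [hρ]
    set ξ : ℝ → A := fun z => NormedSpace.exp ((z - t) • X) - 1 with hξ
    have hξd : HasDerivAt ξ X t := by
      have h2 := hexpd X
      rw [show (0 : ℝ) = t - t by simp] at h2
      exact (HasDerivAt.comp_sub_const t t h2).sub_const 1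
    have hξt : ξ t = 0 := by simp [hξ]
    have hineq : ∀ z, t < z → Metric.infDist (P z) S ≤ d + d * ‖ξ z‖ + ‖ρ z‖ := by
      intro z hz
      obtain ⟨e, heH, he⟩ := hexp t ht' (z - t)
      refine le_of_forall_pos_le_add fun ε hε => ?_
      have hpos : 0 < 1 + ‖ξ z‖ := by positivity
      obtain ⟨y, ⟨u, huH, rfl⟩, hy⟩ := (Metric.infDist_lt_iff hSne).1
        (show Metric.infDist (P t) S < d + ε / (1 + ‖ξ z‖) by
          have : 0 < ε / (1 + ‖ξ z‖) := by positivity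
          linarith)
      have hmem : (u : A) * NormedSpace.exp ((z - t) • X) ∈ S :=
        ⟨u * e, H.mul_mem huH heH, by simp [he, hX]⟩
      have h1 := Metric.infDist_le_dist_of_mem (x := P z) hmem
      have h2 : P z - (u : A) * NormedSpace.exp ((z - t) • X) =
          ρ z + ((P t - u) + (P t - u) * ξ z) := by
        simp only [hρ, hξ]; noncomm_ring
      rw [dist_eq_norm, h2] at h1
      rw [dist_eq_norm] at hy
      have h3 : ‖(P t - u) + (P t - u) * ξ z‖ ≤ ‖P t - u‖ * (1 + ‖ξ z‖) := by
        refine (norm_add_le _ _).trans ?_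
        have := norm_mul_le (P t - u) (ξ z)
        linarith
      have h4 : ‖P t - u‖ * (1 + ‖ξ z‖) ≤ d + d * ‖ξ z‖ + ε := by
        calc ‖P t - u‖ * (1 + ‖ξ z‖) ≤ (d + ε / (1 + ‖ξ z‖)) * (1 + ‖ξ z‖) := by gcongr
          _ = _ := by field_simp
      have h5 := norm_add_le (ρ z) ((P t - u) + (P t - u) * ξ z)
      linarith
    have hlim : Tendsto (fun z => d * ‖(z - t)⁻¹ • ξ z‖ + ‖(z - t)⁻¹ • ρ z‖) (𝓝[>] t)
        (𝓝 (d * ‖X‖ + ‖(0 : A)‖)) := by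
      have l1 := (hasDerivAt_iff_tendsto_slope.1 hξd).mono_left
        (nhdsWithin_mono t (fun z (hz : t < z) => hz.ne'))
      have l2 := (hasDerivAt_iff_tendsto_slope.1 hρd).mono_left
        (nhdsWithin_mono t (fun z (hz : t < z) => hz.ne'))
      have e1 : slope ξ t = fun z => (z - t)⁻¹ • ξ z := by
        ext z; simp [slope, hξt]
      have e2 : slope ρ t = fun z => (z - t)⁻¹ • ρ z := by
        ext z; simp [slope, hρt]
      rw [e1] at l1
      rw [e2] at l2
      exact (l1.norm.const_mul d).add l2.norm
    have hlt : d * ‖X‖ + ‖(0 : A)‖ < r := by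
      have : d * ‖X‖ ≤ C * d := by rw [mul_comm]; gcongr; exact hC t ht'
      rw [norm_zero]
      exact lt_of_le_of_lt (by linarith) hr
    filter_upwards [hlim.eventually_lt_const hlt, self_mem_nhdsWithin] with z hz hzt
    have hzt' : t < z := hzt
    have hpos : 0 < (z - t)⁻¹ := inv_pos.2 (by linarith)
    refine lt_of_le_of_lt ?_ hz
    rw [norm_smul, norm_smul, Real.norm_of_nonneg hpos.le]
    calc (z - t)⁻¹ * (Metric.infDist (P z) S - d) ≤ (z - t)⁻¹ * (d * ‖ξ z‖ + ‖ρ z‖) := by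
          gcongr
          linarith [hineq z hzt']
      _ = _ := by ring
  · rw [h0]
    exact (Metric.infDist_zero_of_mem (show (1 : A) ∈ S from ⟨1, H.one_mem, rfl⟩)).le

end LinearODE

/-! ### Flat connections on star-shaped sets -/

section FlatFrame

variable {E F A : Type*} [NormedAddCommGroup E] [NormedSpace ℝ E] [NormedAddCommGroup F]
  [NormedSpace ℝ F] [NormedRing A] [NormedAlgebra ℝ A]

lemma hasDerivAt_comp_ray {g : E → F} {g' : E →L[ℝ] F} {x : E} {t : ℝ}
    (hg : HasFDerivAt g g' (t • x)) : HasDerivAt (fun s : ℝ => g (s • x)) (g' x) t := by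
  have h1 : HasDerivAt (fun s : ℝ => s • x) x t := by
    simpa using (hasDerivAt_id t).smul_const x
  exact hg.comp_hasDerivAt t h1

/-- A function on a star-shaped set that vanishes at the center and whose derivative is bounded by
a multiple of the function itself vanishes identically. -/
lemma eq_zero_of_norm_fderiv_le {O : Set E} (hs : StarConvex ℝ 0 O) {g : E → F}
    {g' : E → E →L[ℝ] F} {c : E → ℝ} (hc : ContinuousOn c O)
    (hg : ∀ x ∈ O, HasFDerivAt g (g' x) x)
    (hb : ∀ x ∈ O, ∀ h, ‖g' x h‖ ≤ c x * ‖g x‖ * ‖h‖) (h0 : g 0 = 0) : ∀ x ∈ O, g x = 0 := by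
  intro x hx
  have hmem : ∀ t ∈ Icc (0 : ℝ) 1, t • x ∈ O := fun t ht => hs.smul_mem hx ht.1 ht.2
  have hcc : ContinuousOn (fun t : ℝ => c (t • x)) (Icc 0 1) :=
    hc.comp (by fun_prop) hmem
  obtain ⟨C, hC⟩ := isCompact_Icc.exists_bound_of_continuousOn hcc
  have hd : ∀ t ∈ Icc (0 : ℝ) 1, HasDerivAt (fun s : ℝ => g (s • x)) (g' (t • x) x) t :=
    fun t ht => hasDerivAt_comp_ray (hg _ (hmem t ht))
  have := eq_zero_of_abs_deriv_le_mul_abs_self_of_eq_zero_right (a := 0) (b := 1) (K := C * ‖x‖)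
    (f := fun s : ℝ => g (s • x)) (f' := fun t => g' (t • x) x)
    (fun t ht => (hd t ht).continuousAt.continuousWithinAt)
    (fun t ht => (hd t (Ico_subset_Icc_self ht)).hasDerivWithinAt) (by simp [h0])
    (fun t ht => by
      have ht' := Ico_subset_Icc_self ht
      refine (hb _ (hmem t ht') x).trans ?_
      have := (le_abs_self _).trans (hC t ht')
      calc c (t • x) * ‖g (t • x)‖ * ‖x‖ ≤ C * ‖g (t • x)‖ * ‖x‖ := by gcongr
        _ = _ := by ring)
  simpa using this 1 (by simp)

/-- The coefficient `θ_{tx}(x)` of the equation along the ray through `x` is differentiable in `x`,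
uniformly in `t`. -/
lemma eventually_ray_coeff_sub_le {O : Set E} (hO : IsOpen O) (hs : StarConvex ℝ 0 O)
    {θ : E → E →L[ℝ] A} (hθ : ContDiffOn ℝ 1 θ O) {x : E} (hx : x ∈ O) {η : ℝ} (hη : 0 < η) :
    ∀ᶠ y in 𝓝 x, ∀ t ∈ Icc (0 : ℝ) 1, ‖θ (t • y) y - θ (t • x) x -
      (θ (t • x) (y - x) + t • fderiv ℝ θ (t • x) (y - x) x)‖ ≤ η * ‖y - x‖ := by
  have hmem : ∀ t ∈ Icc (0 : ℝ) 1, t • x ∈ O := fun t ht => hs.smul_mem hx ht.1 ht.2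
  have hdθ : ContinuousOn (fderiv ℝ θ) O := hθ.continuousOn_fderiv_of_isOpen hO le_rfl
  set f' : ℝ → E → E →L[ℝ] A := fun t y => θ (t • y) + t • (fderiv ℝ θ (t • y)).flip y with hf'
  have hcont : ∀ t ∈ Icc (0 : ℝ) 1, ContinuousAt (fun z : E × ℝ => f' z.2 z.1) (x, t) := by
    intro t ht
    have hO' : O ∈ 𝓝 (t • x) := hO.mem_nhds (hmem t ht)
    have c0 : ContinuousAt (fun z : E × ℝ => z.2 • z.1) (x, t) := by fun_prop
    have c1 : ContinuousAt (fun z : E × ℝ => θ (z.2 • z.1)) (x, t) :=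
      ContinuousAt.comp (f := fun z : E × ℝ => z.2 • z.1) (hθ.continuousOn.continuousAt hO') c0
    have c2 : ContinuousAt (fun z : E × ℝ => fderiv ℝ θ (z.2 • z.1)) (x, t) :=
      ContinuousAt.comp (f := fun z : E × ℝ => z.2 • z.1) (hdθ.continuousAt hO') c0
    have c3 : ContinuousAt (fun z : E × ℝ => (fderiv ℝ θ (z.2 • z.1)).flip) (x, t) :=
      (ContinuousLinearMap.flipₗᵢ ℝ E E A).continuous.continuousAt.comp c2
    exact c1.add (continuousAt_snd.smul (c3.clm_apply continuousAt_fst))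
  have hev : ∀ᶠ y in 𝓝 x, ∀ t ∈ Icc (0 : ℝ) 1, t • y ∈ O ∧ ‖f' t y - f' t x‖ < η := by
    apply isCompact_Icc.eventually_forall_of_forall_eventually
    intro t ht
    have c0 : ContinuousAt (fun z : E × ℝ => z.2 • z.1) (x, t) := by fun_prop
    refine (c0.eventually (hO.mem_nhds (hmem t ht))).and ?_
    have c1 := hcont t ht
    have c2 : ContinuousAt (fun z : E × ℝ => f' z.2 x) (x, t) := by
      have : ContinuousAt (fun z : E × ℝ => ((x, z.2) : E × ℝ)) (x, t) := by fun_prop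
      exact ContinuousAt.comp (f := fun z : E × ℝ => ((x, z.2) : E × ℝ)) (hcont t ht) this
    have c3 : Tendsto (fun z : E × ℝ => ‖f' z.2 z.1 - f' z.2 x‖) (𝓝 (x, t)) (𝓝 0) := by
      have := (c1.tendsto.sub c2.tendsto).norm
      simpa using this
    exact c3.eventually_lt_const hη
  obtain ⟨ε, hε, hball⟩ := Metric.eventually_nhds_iff_ball.1 hev
  filter_upwards [Metric.ball_mem_nhds x hε] with y hy t ht
  have hder : ∀ z ∈ Metric.ball x ε,
      HasFDerivWithinAt (fun y => θ (t • y) y) (f' t z) (Metric.ball x ε) z := by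
    intro z hz
    have hzO := (hball z hz t ht).1
    have h1 : HasFDerivAt θ (fderiv ℝ θ (t • z)) (t • z) :=
      ((hθ.differentiableOn one_ne_zero).differentiableAt (hO.mem_nhds hzO)).hasFDerivAt
    have h2 : HasFDerivAt (fun y : E => t • y) (t • ContinuousLinearMap.id ℝ E) z :=
      (hasFDerivAt_id z).const_smul t
    have h3 := (h1.comp z h2).clm_apply (hasFDerivAt_id z)
    refine (h3.congr_fderiv ?_).hasFDerivWithinAt
    ext h
    simp [hf']
  have := (convex_ball x ε).norm_image_sub_le_of_norm_hasFDerivWithin_le' (φ := f' t x) (C := η)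
    hder (fun z hz => (hball z hz t ht).2.le) (Metric.mem_ball_self hε) hy
  simpa [hf'] using this

/-- **Frobenius theorem for flat linear connections.** If `θ` is a flat connection form on an open
star-shaped set, i.e. `∂ᵤ θ(w) - ∂_w θ(u) = [θ(w), θ(u)]`, then `dP = P θ` has an invertible
solution with `P(0) = 1`. The solution is obtained by integrating along rays; flatness makes
`P_{tx} (1 + t θ_{tx}(h))` a solution along the ray through `x + h` up to an error `o(h)`. -/
theorem exists_flat_frame [CompleteSpace A] {O : Set E} (hO : IsOpen O) (hs : StarConvex ℝ 0 O)
    {θ : E → E →L[ℝ] A} (hθ : ContDiffOn ℝ 1 θ O)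
    (hflat : ∀ x ∈ O, ∀ u w, fderiv ℝ θ x u w - fderiv ℝ θ x w u =
      θ x w * θ x u - θ x u * θ x w) :
    ∃ P : E → Aˣ, P 0 = 1 ∧ ∀ x ∈ O, HasFDerivAt (fun y => (P y : A))
      ((ContinuousLinearMap.mul ℝ A (P x)).comp (θ x)) x := by
  classical
  have hmem : ∀ x ∈ O, ∀ t ∈ Icc (0 : ℝ) 1, t • x ∈ O := fun x hx t ht => hs.smul_mem hx ht.1 ht.2
  -- solutions along rays; the coefficient is frozen outside `[0, 1]`
  have hray : ∀ x : E, ∃ p : ℝ → A, x ∈ O → p 0 = 1 ∧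
      (∀ t ∈ Icc (0 : ℝ) 1, HasDerivAt p (p t * θ (t • x) x) t) ∧ IsUnit (p 1) := by
    intro x
    by_cases hx : x ∈ O
    · have hcl : Continuous fun t : ℝ => θ ((projIcc (0 : ℝ) 1 zero_le_one t : ℝ) • x) x := by
        have h1 : ContinuousOn (fun t : ℝ => θ (t • x) x) (Icc 0 1) :=
          (hθ.continuousOn.comp (by fun_prop) (hmem x hx)).clm_apply continuousOn_const
        exact (continuousOn_iff_continuous_domRestrict.1 h1).comp continuous_projIcc
      obtain ⟨p, hp0, hp⟩ := exists_linear_ode hcl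
      refine ⟨p, fun _ => ⟨hp0, fun t ht => ?_, isUnit_of_linear_ode hcl hp0 hp⟩⟩
      have := hp t
      rwa [projIcc_of_mem zero_le_one ht] at this
    · exact ⟨fun _ => 1, fun h => absurd h hx⟩
  choose p hp using hray
  have hex : ∀ x : E, ∃ u : Aˣ, (x ∈ O → (u : A) = p x 1) ∧ (x ∉ O → u = 1) := by
    intro x
    by_cases hx : x ∈ O
    · obtain ⟨u, hu⟩ := (hp x hx).2.2
      exact ⟨u, fun _ => hu, fun h => absurd hx h⟩
    · exact ⟨1, fun h => absurd h hx, fun _ => rfl⟩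
  choose P hP hP' using hex
  refine ⟨P, ?_, fun x hx => ?_⟩
  · by_cases h0 : (0 : E) ∈ O
    · apply Units.ext
      rw [hP 0 h0, Units.val_one]
      have h1 : ∀ t ∈ Icc (0 : ℝ) 1, HasDerivAt (p 0) (p 0 t * (fun _ => (0 : A)) t) t := by
        intro t ht; simpa using (hp 0 h0).2.1 t ht
      have h2 : ∀ t ∈ Icc (0 : ℝ) 1, HasDerivAt (fun _ : ℝ => (1 : A))
          ((1 : A) * (fun _ => (0 : A)) t) t := by
        intro t _; simpa using hasDerivAt_const t (1 : A)
      exact linear_ode_unique continuousOn_const h1 h2 (hp 0 h0).1 1 (by simp)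
    · exact hP' 0 h0
  · rw [hasFDerivAt_iff_isLittleO, Asymptotics.isLittleO_iff]
    intro η hη
    obtain ⟨q0, qd, -⟩ := hp x hx
    set q := p x with hq
    have hθx : ContinuousOn (fun t : ℝ => θ (t • x)) (Icc 0 1) :=
      hθ.continuousOn.comp (by fun_prop) (hmem x hx)
    obtain ⟨Cθ, hCθ⟩ := isCompact_Icc.exists_bound_of_continuousOn hθx
    obtain ⟨M, hM⟩ := isCompact_Icc.exists_bound_of_continuousOn (s := Icc (0 : ℝ) 1) (f := q)
      (fun t ht => (qd t ht).continuousAt.continuousWithinAt)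
    have hCθ0 : 0 ≤ Cθ := (norm_nonneg _).trans (hCθ 0 (by simp))
    have hM0 : 0 ≤ M := (norm_nonneg _).trans (hM 0 (by simp))
    set K : ℝ := Cθ * ‖x‖ + 1 with hK
    have hKpos : 0 < K := by positivity
    set G : ℝ := (Real.exp K - 1) / K with hG
    have hG0 : 0 ≤ G := by
      apply div_nonneg _ hKpos.le
      have := Real.add_one_le_exp K
      linarith
    set c : ℝ := M * (1 + Cθ) * G + 1 with hc
    have hcpos : 0 < c := by positivity
    -- a bound for the variation of the ray coefficient that is uniform in `t`
    have hdθ : ContinuousOn (fderiv ℝ θ) O := hθ.continuousOn_fderiv_of_isOpen hO le_rfl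
    have hdθx : ContinuousOn (fun t : ℝ => fderiv ℝ θ (t • x)) (Icc 0 1) :=
      hdθ.comp (f := fun t : ℝ => t • x) (by fun_prop) (hmem x hx)
    obtain ⟨D, hD⟩ : ∃ D, ∀ t ∈ Icc (0 : ℝ) 1, ‖fderiv ℝ θ (t • x)‖ ≤ D := by
      exact isCompact_Icc.exists_bound_of_continuousOn (E := E →L[ℝ] E →L[ℝ] A) hdθx
    have hD0 : 0 ≤ D := (norm_nonneg (fderiv ℝ θ ((0 : ℝ) • x))).trans (hD 0 (by simp))
    have hη' : 0 < η / c := by positivity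
    have hsmall : ∀ᶠ y in 𝓝 x, (η / c + Cθ + D * ‖x‖) * ‖y - x‖ < min 1 (η / c) := by
      have : Tendsto (fun y => (η / c + Cθ + D * ‖x‖) * ‖y - x‖) (𝓝 x) (𝓝 0) := by
        have h : Continuous fun y => (η / c + Cθ + D * ‖x‖) * ‖y - x‖ := by fun_prop
        simpa using h.tendsto x
      exact this.eventually_lt_const (lt_min one_pos hη')
    filter_upwards [eventually_ray_coeff_sub_le hO hs hθ hx hη', hsmall, hO.mem_nhds hx]
      with y hy1 hy2 hyO
    set h := y - x with hh
    obtain ⟨r0, rd, -⟩ := hp y hyO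
    have hvar : ∀ t ∈ Icc (0 : ℝ) 1, ‖θ (t • y) y - θ (t • x) x‖ ≤ min 1 (η / c) := by
      intro t ht
      have h1 := hy1 t ht
      have h2 : ‖θ (t • x) h + t • fderiv ℝ θ (t • x) h x‖ ≤ (Cθ + D * ‖x‖) * ‖h‖ := by
        refine (norm_add_le _ _).trans ?_
        have e1 : ‖θ (t • x) h‖ ≤ Cθ * ‖h‖ := ContinuousLinearMap.le_of_opNorm_le _ (hCθ t ht) h
        have e2 : ‖t • fderiv ℝ θ (t • x) h x‖ ≤ D * ‖x‖ * ‖h‖ := by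
          rw [norm_smul, Real.norm_of_nonneg ht.1]
          calc t * ‖fderiv ℝ θ (t • x) h x‖ ≤ 1 * (D * ‖h‖ * ‖x‖) := by
                gcongr
                · exact ht.2
                · exact ContinuousLinearMap.le_of_opNorm_le _
                    (ContinuousLinearMap.le_of_opNorm_le _ (hD t ht) h) x
            _ = _ := by ring
        linarith
      have h3 := norm_add_le (θ (t • y) y - θ (t • x) x -
        (θ (t • x) h + t • fderiv ℝ θ (t • x) h x)) (θ (t • x) h + t • fderiv ℝ θ (t • x) h x)
      rw [sub_add_cancel] at h3
      refine h3.trans (le_trans ?_ hy2.le)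
      linarith
    have hyK : ∀ t ∈ Icc (0 : ℝ) 1, ‖θ (t • y) y‖ ≤ K := by
      intro t ht
      have h1 : ‖θ (t • x) x‖ ≤ Cθ * ‖x‖ := ContinuousLinearMap.le_of_opNorm_le _ (hCθ t ht) x
      have h2 := norm_add_le (θ (t • y) y - θ (t • x) x) (θ (t • x) x)
      rw [sub_add_cancel] at h2
      have h3 := (hvar t ht).trans (min_le_left _ _)
      linarith
    -- the approximate solution along the ray through `y`
    set R : ℝ → A := fun t => q t * (1 + t • θ (t • x) h) with hR
    set R' : ℝ → A := fun t => q t * θ (t • x) x * (1 + t • θ (t • x) h) +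
      q t * (t • fderiv ℝ θ (t • x) x h + θ (t • x) h) with hR'
    have hRd : ∀ t ∈ Icc (0 : ℝ) 1, HasDerivAt R (R' t) t := by
      intro t ht
      have h1 : HasFDerivAt θ (fderiv ℝ θ (t • x)) (t • x) :=
        ((hθ.differentiableOn one_ne_zero).differentiableAt
          (hO.mem_nhds (hmem x hx t ht))).hasFDerivAt
      have h2 : HasDerivAt (fun s : ℝ => θ (s • x) h) (fderiv ℝ θ (t • x) x h) t := by
        simpa using (hasDerivAt_comp_ray h1).clm_apply (hasDerivAt_const t h)
      have h3 : HasDerivAt (fun s : ℝ => s • θ (s • x) h)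
          (t • fderiv ℝ θ (t • x) x h + (1 : ℝ) • θ (t • x) h) t := (hasDerivAt_id t).smul h2
      rw [one_smul] at h3
      exact (qd t ht).mul (h3.const_add 1)
    have herr : ∀ t ∈ Icc (0 : ℝ) 1,
        ‖R t * θ (t • y) y - R' t‖ ≤ M * (1 + Cθ) * (η / c) * ‖h‖ := by
      intro t ht
      have hf := hflat (t • x) (hmem x hx t ht) x h
      have hf' : fderiv ℝ θ (t • x) x h = fderiv ℝ θ (t • x) h x +
          (θ (t • x) h * θ (t • x) x - θ (t • x) x * θ (t • x) h) := by
        rw [← hf]; abel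
      have e : R t * θ (t • y) y - R' t = q t * ((θ (t • y) y - θ (t • x) x -
          (θ (t • x) h + t • fderiv ℝ θ (t • x) h x)) +
          t • (θ (t • x) h * (θ (t • y) y - θ (t • x) x))) := by
        simp only [hR, hR', hf']
        simp only [mul_add, add_mul, smul_add, smul_sub, mul_sub, mul_one, smul_mul_assoc,
          mul_smul_comm, mul_assoc]
        abel
      rw [e]
      refine (norm_mul_le _ _).trans ?_
      have e1 : ‖t • (θ (t • x) h * (θ (t • y) y - θ (t • x) x))‖ ≤ Cθ * ‖h‖ * (η / c) := by
        rw [norm_smul, Real.norm_of_nonneg ht.1]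
        calc t * ‖θ (t • x) h * (θ (t • y) y - θ (t • x) x)‖
            ≤ 1 * (Cθ * ‖h‖ * (η / c)) := by
              gcongr
              · exact ht.2
              · refine (norm_mul_le _ _).trans ?_
                gcongr
                · exact ContinuousLinearMap.le_of_opNorm_le _ (hCθ t ht) h
                · exact (hvar t ht).trans (min_le_right _ _)
          _ = _ := one_mul _
      calc ‖q t‖ * _ ≤ M * (η / c * ‖h‖ + Cθ * ‖h‖ * (η / c)) := by
            gcongr
            · exact hM t ht
            · exact (norm_add_le _ _).trans (add_le_add (hy1 t ht) e1)
        _ = _ := by ring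
    have hgr := norm_le_gronwallBound_of_norm_deriv_right_le (a := 0) (b := 1) (δ := 0) (K := K)
      (ε := M * (1 + Cθ) * (η / c) * ‖h‖)
      (f := fun t => p y t - R t) (f' := fun t => p y t * θ (t • y) y - R' t)
      (fun t ht => ((rd t ht).fun_sub (hRd t ht)).continuousAt.continuousWithinAt)
      (fun t ht => ((rd t (Ico_subset_Icc_self ht)).fun_sub
        (hRd t (Ico_subset_Icc_self ht))).hasDerivWithinAt)
      (by simp [hR, r0, q0]) (fun t ht => by
        have ht' := Ico_subset_Icc_self ht
        have e : p y t * θ (t • y) y - R' t = (p y t - R t) * θ (t • y) y +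
          (R t * θ (t • y) y - R' t) := by noncomm_ring
        rw [e]
        refine (norm_add_le _ _).trans (add_le_add ?_ (herr t ht'))
        rw [mul_comm K]
        exact (norm_mul_le _ _).trans (by gcongr; exact hyK t ht')) 1 (by simp)
    rw [gronwallBound_of_K_ne_0 hKpos.ne'] at hgr
    have hPy := hP y hyO
    have hPx := hP x hx
    simp only [hPy, hPx, ContinuousLinearMap.comp_apply, ContinuousLinearMap.mul_apply']
    have e : p y 1 - p x 1 - p x 1 * θ x h = p y 1 - R 1 := by
      simp only [hR, one_smul, ← hq]; noncomm_ring
    rw [e]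
    refine hgr.trans ?_
    have e2 : (0 : ℝ) * Real.exp (K * (1 - 0)) + M * (1 + Cθ) * (η / c) * ‖h‖ / K *
        (Real.exp (K * (1 - 0)) - 1) = (M * (1 + Cθ) * G) * (η / c) * ‖h‖ := by
      rw [hG, sub_zero, mul_one]; ring
    refine e2.trans_le ?_
    gcongr
    rw [← mul_div_assoc, div_le_iff₀ hcpos, mul_comm]
    gcongr
    rw [hc]
    linarith

/-- Solutions of `dP = P θ` with smooth `θ` are smooth. -/
lemma contDiffOn_of_frame {O : Set E} (hO : IsOpen O) {θ : E → E →L[ℝ] A}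
    (hθ : ContDiffOn ℝ ∞ θ O) {P : E → A}
    (hP : ∀ x ∈ O, HasFDerivAt P ((ContinuousLinearMap.mul ℝ A (P x)).comp (θ x)) x) :
    ContDiffOn ℝ ∞ P O := by
  rw [contDiffOn_infty]
  intro n
  induction n with
  | zero =>
    rw [Nat.cast_zero, contDiffOn_zero]
    exact fun x hx => (hP x hx).continuousAt.continuousWithinAt
  | succ n ih =>
    push_cast
    rw [contDiffOn_succ_iff_fderiv_of_isOpen hO]
    refine ⟨fun x hx => (hP x hx).differentiableAt.differentiableWithinAt, by simp, ?_⟩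
    have h1 : ContDiffOn ℝ n (fun x => (ContinuousLinearMap.mul ℝ A (P x)).comp (θ x)) O :=
      ((ContinuousLinearMap.mul ℝ A).contDiff.comp_contDiffOn ih).clm_comp
        (hθ.of_le (by exact_mod_cast le_top))
    exact h1.congr fun x hx => (hP x hx).fderiv

end FlatFrame

attribute [local instance] LieRing.ofAssociativeRing

/-! ### Involutions, eigenspaces and exponentials -/

section Group

variable {𝔸 : Type*} [NormedRing 𝔸] [NormedAlgebra ℂ 𝔸]

lemma lie_def {R : Type*} [Ring R] (x y : R) : ⁅x, y⁆ = x * y - y * x := rfl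

/-- One-parameter subgroups determine their generators. -/
lemma eq_of_exp_smul_eq [CompleteSpace 𝔸] {X Y : 𝔸}
    (h : ∀ t : ℝ, NormedSpace.exp (t • X) = NormedSpace.exp (t • Y)) : X = Y := by
  have hX : HasDerivAt (fun s : ℝ => NormedSpace.exp (s • X)) X 0 := by
    simpa using hasDerivAt_exp_smul_const (𝕂 := ℝ) X (0 : ℝ)
  have hY : HasDerivAt (fun s : ℝ => NormedSpace.exp (s • Y)) Y 0 := by
    simpa using hasDerivAt_exp_smul_const (𝕂 := ℝ) Y (0 : ℝ)
  rw [funext h] at hX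
  exact hX.unique hY

lemma exp_conj_units [CompleteSpace 𝔸] (k : 𝔸ˣ) (X : 𝔸) :
    NormedSpace.exp ((k : 𝔸) * X * (↑k⁻¹ : 𝔸)) = (k : 𝔸) * NormedSpace.exp X * (↑k⁻¹ : 𝔸) :=
  letI : NormedAlgebra ℚ 𝔸 := NormedAlgebra.restrictScalars ℚ ℂ 𝔸
  NormedSpace.exp_units_conj k X

namespace SymmetricPair

variable (P : SymmetricPair 𝔸)

/-- One-parameter subgroups, with their images under `τ` and `σ`. -/
lemma exists_exp (X : P.𝔤) (t : ℝ) : ∃ g : P.G, ((g : 𝔸ˣ) : 𝔸) = NormedSpace.exp (t • (X : 𝔸)) ∧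
    ((P.τ g : 𝔸ˣ) : 𝔸) = NormedSpace.exp (t • (P.dτ X : 𝔸)) ∧
    ((P.σ g : 𝔸ˣ) : 𝔸) = NormedSpace.exp (t • (P.dσ X : 𝔸)) := by
  obtain ⟨g, hg, hgX⟩ := (P.mem_𝔤 X).1 X.2 t
  have e : (((t : ℂ) • X : P.𝔤) : 𝔸) = t • (X : 𝔸) := by simp
  have h1 := P.τ_exp ((t : ℂ) • X) ⟨g, hg⟩ (by rw [e]; exact hgX)
  have h2 := P.σ_exp ((t : ℂ) • X) ⟨g, hg⟩ (by rw [e]; exact hgX)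
  refine ⟨⟨g, hg⟩, hgX, ?_, ?_⟩
  · rw [h1, LinearMap.map_smulₛₗ]; simp
  · rw [h2, map_smul]; simp

/-- The values of `τ` and `σ` on any element of `G` that equals `exp (t X)`. -/
lemma exists_exp_eq (X : P.𝔤) (g : P.G) {t : ℝ}
    (h : ((g : 𝔸ˣ) : 𝔸) = NormedSpace.exp (t • (X : 𝔸))) :
    ((P.τ g : 𝔸ˣ) : 𝔸) = NormedSpace.exp (t • (P.dτ X : 𝔸)) ∧
    ((P.σ g : 𝔸ˣ) : 𝔸) = NormedSpace.exp (t • (P.dσ X : 𝔸)) := by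
  obtain ⟨g', h1, h2, h3⟩ := P.exists_exp X t
  have : g = g' := Subtype.ext (Units.ext (h.trans h1.symm))
  rw [this]
  exact ⟨h2, h3⟩

lemma dτ_dτ [CompleteSpace 𝔸] (X : P.𝔤) : P.dτ (P.dτ X) = X := by
  refine Subtype.ext (eq_of_exp_smul_eq fun t => ?_)
  obtain ⟨g, h1, h2, -⟩ := P.exists_exp X t
  rw [← (P.exists_exp_eq _ _ h2).1, P.τ_τ, h1]

lemma dσ_dσ [CompleteSpace 𝔸] (X : P.𝔤) : P.dσ (P.dσ X) = X := by
  refine Subtype.ext (eq_of_exp_smul_eq fun t => ?_)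
  obtain ⟨g, h1, -, h2⟩ := P.exists_exp X t
  rw [← (P.exists_exp_eq _ _ h2).2, P.σ_σ, h1]

lemma dσ_dτ [CompleteSpace 𝔸] (X : P.𝔤) : P.dσ (P.dτ X) = P.dτ (P.dσ X) := by
  refine Subtype.ext (eq_of_exp_smul_eq fun t => ?_)
  obtain ⟨g, h1, h2, h3⟩ := P.exists_exp X t
  rw [← (P.exists_exp_eq _ _ h2).2, ← (P.exists_exp_eq _ _ h3).1, P.σ_τ]

lemma mem_𝔲₀ {X : 𝔸} : X ∈ P.𝔲₀ ↔
    ∃ h : X ∈ P.𝔤, P.dτ ⟨X, h⟩ = ⟨X, h⟩ ∧ P.dσ ⟨X, h⟩ = ⟨X, h⟩ := by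
  constructor
  · rintro ⟨⟨h, h1⟩, _, h2⟩
    exact ⟨h, h1, by simpa using h2⟩
  · rintro ⟨h, h1, h2⟩
    exact ⟨⟨h, h1⟩, h, by simpa using h2⟩

lemma mem_𝔲₁ {X : 𝔸} : X ∈ P.𝔲₁ ↔
    ∃ h : X ∈ P.𝔤, P.dτ ⟨X, h⟩ = ⟨X, h⟩ ∧ P.dσ ⟨X, h⟩ = -⟨X, h⟩ := by
  constructor
  · rintro ⟨⟨h, h1⟩, _, h2⟩
    exact ⟨h, h1, by simpa using h2⟩
  · rintro ⟨h, h1, h2⟩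
    exact ⟨⟨h, h1⟩, h, by simpa using h2⟩

variable {P}

lemma 𝔲₀_le_𝔲 {X : 𝔸} (h : X ∈ P.𝔲₀) : X ∈ P.𝔲 := h.1
lemma 𝔲₁_le_𝔲 {X : 𝔸} (h : X ∈ P.𝔲₁) : X ∈ P.𝔲 := h.1

lemma lie_mem_𝔲 {X Y : 𝔸} (hX : X ∈ P.𝔲) (hY : Y ∈ P.𝔲) : ⁅X, Y⁆ ∈ P.𝔲 := by
  obtain ⟨hX, h1⟩ := hX
  obtain ⟨hY, h2⟩ := hY
  refine ⟨P.𝔤.lie_mem hX hY, ?_⟩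
  have e : (⟨⁅X, Y⁆, P.𝔤.lie_mem hX hY⟩ : P.𝔤) = ⁅(⟨X, hX⟩ : P.𝔤), ⟨Y, hY⟩⁆ := rfl
  rw [e, P.dτ_lie, h1, h2]

lemma lie_mem_eigenspace {ε δ : ℤ} {X Y : 𝔸} (hX : X ∈ P.eigenspace ε)
    (hY : Y ∈ P.eigenspace δ) : ⁅X, Y⁆ ∈ P.eigenspace (ε * δ) := by
  obtain ⟨hX', hX, h1⟩ := hX
  obtain ⟨hY', hY, h2⟩ := hY
  refine ⟨lie_mem_𝔲 hX' hY', P.𝔤.lie_mem hX hY, ?_⟩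
  have e : (⟨⁅X, Y⁆, P.𝔤.lie_mem hX hY⟩ : P.𝔤) = ⁅(⟨X, hX⟩ : P.𝔤), ⟨Y, hY⟩⁆ := rfl
  rw [e, LieHom.map_lie, h1, h2, zsmul_lie, lie_zsmul, smul_smul]

lemma lie_mem_𝔲₀_of_𝔲₁ {X Y : 𝔸} (hX : X ∈ P.𝔲₁) (hY : Y ∈ P.𝔲₁) : ⁅X, Y⁆ ∈ P.𝔲₀ := by
  simpa using! lie_mem_eigenspace hX hY

lemma lie_mem_𝔲₀ {X Y : 𝔸} (hX : X ∈ P.𝔲₀) (hY : Y ∈ P.𝔲₀) : ⁅X, Y⁆ ∈ P.𝔲₀ := by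
  simpa using! lie_mem_eigenspace hX hY

lemma lie_mem_𝔲₁ {X Y : 𝔸} (hX : X ∈ P.𝔲₀) (hY : Y ∈ P.𝔲₁) : ⁅X, Y⁆ ∈ P.𝔲₁ := by
  simpa using! lie_mem_eigenspace hX hY

lemma lie_mem_𝔲₁' {X Y : 𝔸} (hX : X ∈ P.𝔲₁) (hY : Y ∈ P.𝔲₀) : ⁅X, Y⁆ ∈ P.𝔲₁ := by
  simpa using! lie_mem_eigenspace hX hY

lemma exp_mem_U₀ {X : 𝔸} (hX : X ∈ P.𝔲₀) (t : ℝ) :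
    ∃ g ∈ P.U₀, (g : 𝔸) = NormedSpace.exp (t • X) := by
  obtain ⟨h, h1, h2⟩ := P.mem_𝔲₀.1 hX
  obtain ⟨g, e1, e2, e3⟩ := P.exists_exp ⟨X, h⟩ t
  rw [h1] at e2
  rw [h2] at e3
  exact ⟨g, ⟨g.2, Subtype.ext (Units.ext (e2.trans e1.symm)),
    Subtype.ext (Units.ext (e3.trans e1.symm))⟩, e1⟩

variable (P) in
lemma isClosed_U₀ : IsClosed (P.U₀ : Set 𝔸ˣ) := by
  have h1 : IsClosed {g : P.G | P.τ g = g ∧ P.σ g = g} :=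
    (isClosed_eq P.continuous_τ continuous_id).inter (isClosed_eq P.continuous_σ continuous_id)
  have h2 := P.isClosed_G.isClosedEmbedding_subtypeVal.isClosedMap _ h1
  convert h2 using 1
  ext k
  constructor
  · rintro ⟨h, h1, h2⟩
    exact ⟨⟨k, h⟩, ⟨h1, h2⟩, rfl⟩
  · rintro ⟨⟨k', h⟩, ⟨h1, h2⟩, rfl⟩
    exact ⟨h, h1, h2⟩

lemma conj_mem_𝔤 [CompleteSpace 𝔸] {k : 𝔸ˣ} (hk : k ∈ P.G) {X : 𝔸} (hX : X ∈ P.𝔤) :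
    (k : 𝔸) * X * (↑k⁻¹ : 𝔸) ∈ P.𝔤 := by
  rw [P.mem_𝔤]
  intro t
  obtain ⟨g, hg, hgX⟩ := (P.mem_𝔤 X).1 hX t
  refine ⟨k * g * k⁻¹, P.G.mul_mem (P.G.mul_mem hk hg) (P.G.inv_mem hk), ?_⟩
  rw [← smul_mul_assoc, ← mul_smul_comm, exp_conj_units, ← hgX]
  simp

/-- The adjoint action of `U₀` commutes with the differentials of the involutions. -/
lemma conj_eq [CompleteSpace 𝔸] {k : 𝔸ˣ} (hk : k ∈ P.U₀) (X : P.𝔤) :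
    (P.dτ ⟨(k : 𝔸) * X * (↑k⁻¹ : 𝔸), conj_mem_𝔤 hk.1 X.2⟩ : 𝔸) =
      (k : 𝔸) * (P.dτ X : 𝔸) * (↑k⁻¹ : 𝔸) ∧
    (P.dσ ⟨(k : 𝔸) * X * (↑k⁻¹ : 𝔸), conj_mem_𝔤 hk.1 X.2⟩ : 𝔸) =
      (k : 𝔸) * (P.dσ X : 𝔸) * (↑k⁻¹ : 𝔸) := by
  obtain ⟨hkG, hτ, hσ⟩ := hk
  have hexp : ∀ (Y : 𝔸) (t : ℝ), NormedSpace.exp (t • ((k : 𝔸) * Y * (↑k⁻¹ : 𝔸))) =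
      (k : 𝔸) * NormedSpace.exp (t • Y) * (↑k⁻¹ : 𝔸) := by
    intro Y t
    rw [← smul_mul_assoc, ← mul_smul_comm, exp_conj_units]
  have key : ∀ t : ℝ, ∃ g : P.G,
      NormedSpace.exp (t • (P.dτ ⟨(k : 𝔸) * X * (↑k⁻¹ : 𝔸), conj_mem_𝔤 hkG X.2⟩ : 𝔸)) =
        (k : 𝔸) * NormedSpace.exp (t • (P.dτ X : 𝔸)) * (↑k⁻¹ : 𝔸) ∧
      NormedSpace.exp (t • (P.dσ ⟨(k : 𝔸) * X * (↑k⁻¹ : 𝔸), conj_mem_𝔤 hkG X.2⟩ : 𝔸)) =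
        (k : 𝔸) * NormedSpace.exp (t • (P.dσ X : 𝔸)) * (↑k⁻¹ : 𝔸) := by
    intro t
    obtain ⟨g, h1, h2, h3⟩ := P.exists_exp X t
    have h4 : (((⟨k, hkG⟩ * g * ⟨k, hkG⟩⁻¹ : P.G) : 𝔸ˣ) : 𝔸) = NormedSpace.exp (t •
        (((⟨(k : 𝔸) * X * (↑k⁻¹ : 𝔸), conj_mem_𝔤 hkG X.2⟩ : P.𝔤)) : 𝔸)) := by
      rw [hexp, ← h1]; simp
    obtain ⟨h5, h6⟩ := P.exists_exp_eq _ _ h4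
    refine ⟨g, ?_, ?_⟩
    · rw [← h5, ← h2, map_mul, map_mul, map_inv, hτ]; simp
    · rw [← h6, ← h3, map_mul, map_mul, map_inv, hσ]; simp
  constructor
  · refine eq_of_exp_smul_eq fun t => ?_
    obtain ⟨g, h, -⟩ := key t
    rw [h, hexp]
  · refine eq_of_exp_smul_eq fun t => ?_
    obtain ⟨g, -, h⟩ := key t
    rw [h, hexp]

lemma conj_mem_𝔲₁ [CompleteSpace 𝔸] {k : 𝔸ˣ} (hk : k ∈ P.U₀) {X : 𝔸} (hX : X ∈ P.𝔲₁) :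
    (k : 𝔸) * X * (↑k⁻¹ : 𝔸) ∈ P.𝔲₁ := by
  obtain ⟨h, h1, h2⟩ := P.mem_𝔲₁.1 hX
  obtain ⟨e1, e2⟩ := conj_eq hk ⟨X, h⟩
  refine P.mem_𝔲₁.2 ⟨conj_mem_𝔤 hk.1 h, Subtype.ext ?_, Subtype.ext ?_⟩
  · rw [e1, h1]
  · rw [e2, h2]; simp

/-- The eigenspace decomposition `𝔲 = 𝔲₀ + 𝔲₁`. -/
lemma exists_add_of_mem_𝔲 [CompleteSpace 𝔸] {X : 𝔸} (hX : X ∈ P.𝔲) :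
    ∃ Y ∈ P.𝔲₀, ∃ Z ∈ P.𝔲₁, X = Y + Z := by
  obtain ⟨h, h1⟩ := hX
  set x : P.𝔤 := ⟨X, h⟩ with hx
  refine ⟨((1 / 2 : ℂ) • (x + P.dσ x) : P.𝔤), ?_, ((1 / 2 : ℂ) • (x - P.dσ x) : P.𝔤), ?_, ?_⟩
  · refine P.mem_𝔲₀.2 ⟨((1 / 2 : ℂ) • (x + P.dσ x) : P.𝔤).2, ?_, ?_⟩
    · change P.dτ ((1 / 2 : ℂ) • (x + P.dσ x)) = (1 / 2 : ℂ) • (x + P.dσ x)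
      rw [LinearMap.map_smulₛₗ, map_add, ← P.dσ_dτ, h1]; simp [Complex.conj_ofNat]
    · change P.dσ ((1 / 2 : ℂ) • (x + P.dσ x)) = (1 / 2 : ℂ) • (x + P.dσ x)
      rw [map_smul, map_add, P.dσ_dσ, add_comm]
  · refine P.mem_𝔲₁.2 ⟨((1 / 2 : ℂ) • (x - P.dσ x) : P.𝔤).2, ?_, ?_⟩
    · change P.dτ ((1 / 2 : ℂ) • (x - P.dσ x)) = (1 / 2 : ℂ) • (x - P.dσ x)
      rw [LinearMap.map_smulₛₗ, map_sub, ← P.dσ_dτ, h1]; simp [Complex.conj_ofNat]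
    · change P.dσ ((1 / 2 : ℂ) • (x - P.dσ x)) = -((1 / 2 : ℂ) • (x - P.dσ x))
      rw [map_smul, map_sub, P.dσ_dσ, ← smul_neg, neg_sub]
  · have : x = (1 / 2 : ℂ) • (x + P.dσ x) + (1 / 2 : ℂ) • (x - P.dσ x) := by module
    exact congrArg Subtype.val this

/-- `𝔤` is the complexification `𝔲 + i𝔲` of its real form `𝔲`. -/
lemma exists_add_of_mem_𝔤 [CompleteSpace 𝔸] {X : 𝔸} (hX : X ∈ P.𝔤) :
    ∃ Y ∈ P.𝔲, ∃ Z ∈ P.𝔲, X = Y + Complex.I • Z := by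
  set x : P.𝔤 := ⟨X, hX⟩ with hx
  refine ⟨((1 / 2 : ℂ) • (x + P.dτ x) : P.𝔤), ?_,
    ((-Complex.I / 2 : ℂ) • (x - P.dτ x) : P.𝔤), ?_, ?_⟩
  · refine ⟨((1 / 2 : ℂ) • (x + P.dτ x) : P.𝔤).2, ?_⟩
    change P.dτ ((1 / 2 : ℂ) • (x + P.dτ x)) = (1 / 2 : ℂ) • (x + P.dτ x)
    rw [LinearMap.map_smulₛₗ, map_add, P.dτ_dτ, add_comm]; simp [Complex.conj_ofNat]
  · refine ⟨((-Complex.I / 2 : ℂ) • (x - P.dτ x) : P.𝔤).2, ?_⟩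
    change P.dτ ((-Complex.I / 2 : ℂ) • (x - P.dτ x)) = (-Complex.I / 2 : ℂ) • (x - P.dτ x)
    rw [LinearMap.map_smulₛₗ, map_sub, P.dτ_dτ]
    simp only [map_div₀, map_neg, Complex.conj_I, Complex.conj_ofNat]
    module
  · have : x = (1 / 2 : ℂ) • (x + P.dτ x) +
        Complex.I • (-Complex.I / 2 : ℂ) • (x - P.dτ x) := by
      rw [smul_smul, mul_div_assoc', mul_neg, Complex.I_mul_I, neg_neg]
      module
    exact congrArg Subtype.val this

end SymmetricPair

end Group

/-! ### Jacobson's lemma -/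

section Jacobson

variable {R : Type*} [Ring R] [Algebra ℂ R]

/-- `[f(x), y] = f'(x) [x, y]` if `x` commutes with `[x, y]`. -/
lemma aeval_mul_sub_mul_aeval {x y : R} (h : Commute x ⁅x, y⁆) (f : Polynomial ℂ) :
    Polynomial.aeval x f * y - y * Polynomial.aeval x f =
      Polynomial.aeval x (Polynomial.derivative f) * ⁅x, y⁆ := by
  induction f using Polynomial.induction_on' with
  | add f g hf hg =>
    simp only [map_add, add_mul, mul_add]
    rw [← hf, ← hg]; abel
  | monomial n c =>
    simp only [Polynomial.aeval_monomial, Polynomial.derivative_monomial]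
    induction n with
    | zero => simp [Algebra.commutes]
    | succ n ih =>
      have h' : x * ⁅x, y⁆ = ⁅x, y⁆ * x := h
      have e : algebraMap ℂ R c * x ^ (n + 1) * y - y * (algebraMap ℂ R c * x ^ (n + 1)) =
          algebraMap ℂ R c * x ^ n * ⁅x, y⁆ +
            (algebraMap ℂ R c * x ^ n * y - y * (algebraMap ℂ R c * x ^ n)) * x := by
        rw [lie_def, pow_succ]; noncomm_ring
      rw [e, ih, mul_assoc _ _ x, ← h', ← mul_assoc]
      rcases n with _ | n
      · simp
      · simp only [Nat.add_sub_cancel, pow_succ, map_mul]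
        push_cast
        simp only [mul_add, add_mul, mul_one, mul_assoc]
        abel

/-- **Jacobson's lemma**: a commutator `[x, y]` in a finite-dimensional algebra that commutes with
`x` is nilpotent. -/
lemma isNilpotent_lie_of_commute [FiniteDimensional ℂ R] {x y : R} (h : Commute x ⁅x, y⁆) :
    IsNilpotent ⁅x, y⁆ := by
  set z := ⁅x, y⁆ with hz
  -- if `f(x) zᵐ = 0`, then `f'(x) zᵐ⁺¹⁺ᵐ = 0`, so the degree of `f` can be lowered to `0`
  have key : ∀ d : ℕ, ∀ f : Polynomial ℂ, f ≠ 0 → f.natDegree ≤ d → ∀ m : ℕ,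
      Polynomial.aeval x f * z ^ m = 0 → IsNilpotent z := by
    intro d
    induction d with
    | zero =>
      intro f hf hd m hm
      obtain ⟨c, rfl⟩ := Polynomial.natDegree_eq_zero.1 (Nat.le_zero.1 hd)
      have hc : c ≠ 0 := by rintro rfl; simp at hf
      refine ⟨m, ?_⟩
      rw [Polynomial.aeval_C, ← Algebra.smul_def] at hm
      exact (smul_eq_zero.1 hm).resolve_left hc
    | succ d ih =>
      intro f hf hd m hm
      by_cases h0 : f.natDegree = 0
      · exact ih f hf (by omega) m hm
      · have hder : Polynomial.derivative f ≠ 0 := fun h' =>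
          h0 (Polynomial.derivative_eq_zero.1 h')
        refine ih (Polynomial.derivative f) hder
          (by have := Polynomial.natDegree_derivative_lt h0; omega) (m + 1 + m) ?_
        have hcomm : ∀ g : Polynomial ℂ, Commute (Polynomial.aeval x g) z := by
          intro g
          induction g using Polynomial.induction_on' with
          | add p q hp hq => rw [map_add]; exact hp.add_left hq
          | monomial n c =>
            rw [Polynomial.aeval_monomial]
            exact (show Commute _ _ from Algebra.commutes c z).mul_left (h.pow_left n)
        have e1 := aeval_mul_sub_mul_aeval h f
        rw [← hz] at e1
        have e2 : z ^ m * Polynomial.aeval x f = 0 := by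
          rw [← ((hcomm f).pow_right m).eq, hm]
        calc Polynomial.aeval x (Polynomial.derivative f) * z ^ (m + 1 + m)
            = z ^ m * (Polynomial.aeval x (Polynomial.derivative f) * z) * z ^ m := by
              rw [← mul_assoc, ← ((hcomm (Polynomial.derivative f)).pow_right m).eq, pow_add,
                pow_add, pow_one]
              simp only [mul_assoc]
          _ = (z ^ m * Polynomial.aeval x f) * y * z ^ m -
                z ^ m * y * (Polynomial.aeval x f * z ^ m) := by
              rw [← e1]; noncomm_ring
          _ = 0 := by rw [e2, hm]; simp
  have hx : IsIntegral ℂ x := Algebra.IsIntegral.isIntegral x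
  exact key _ (minpoly ℂ x) (minpoly.ne_zero hx) le_rfl 0 (by simp)

end Jacobson

/-! ### Reductive Lie algebras -/

section Reductive

variable {L : Type*} [LieRing L] [LieAlgebra ℂ L] [FiniteDimensional ℂ L]

/-- The kernel of the Killing form is solvable, hence central in a reductive Lie algebra. -/
lemma mem_center_of_killingForm_eq_zero [LieAlgebra.HasCentralRadical ℂ L] {z : L}
    (h : ∀ w, killingForm ℂ L z w = 0) : z ∈ LieAlgebra.center ℂ L := by
  rw [← LieAlgebra.HasCentralRadical.radical_eq_center]
  refine LieAlgebra.killingCompl_top_le_radical ℂ L ?_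
  rw [LieIdeal.mem_killingCompl]
  intro w _
  rw [LieModule.traceForm_comm]
  exact h w

/-- A reductive Lie algebra is the sum of its derived algebra and its center. -/
lemma span_lie_sup_center_eq_top [LieAlgebra.HasCentralRadical ℂ L] :
    Submodule.span ℂ {w : L | ∃ a b : L, ⁅a, b⁆ = w} ⊔
      (LieAlgebra.center ℂ L).toSubmodule = ⊤ := by
  by_contra hne
  -- a functional that vanishes on the sum is `κ(·, v)`; then `[b, v]` is central for all `b`, hence
  -- `ad(w) ∘ ad(v) = 0` and `κ(w, v) = 0` for all `w`
  obtain ⟨f, hf, hle⟩ := Submodule.exists_le_ker_of_lt_top _ (lt_top_iff_ne_top.2 hne)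
  apply hf
  set κ := killingForm ℂ L with hκ
  have hker : f ∈ (LinearMap.ker κ).dualAnnihilator := by
    rw [Submodule.mem_dualAnnihilator]
    intro w hw
    have : w ∈ LieAlgebra.center ℂ L := mem_center_of_killingForm_eq_zero fun v => by
      rw [← hκ, LinearMap.mem_ker.1 hw]; rfl
    exact LinearMap.mem_ker.1 (hle (Submodule.mem_sup_right this))
  rw [← LinearMap.range_dualMap_eq_dualAnnihilator_ker] at hker
  obtain ⟨φ, hφ⟩ := hker
  obtain ⟨v, rfl⟩ := (Module.evalEquiv ℂ L).surjective φ
  have hfv : ∀ w, f w = κ w v := by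
    intro w; rw [← hφ]; rfl
  have hcen : ∀ b : L, ⁅b, v⁆ ∈ LieAlgebra.center ℂ L := by
    intro b
    refine mem_center_of_killingForm_eq_zero fun w => ?_
    rw [LieModule.traceForm_comm, ← LieModule.traceForm_apply_lie_apply]
    refine (hfv _).symm.trans ?_
    exact LinearMap.mem_ker.1 (hle (Submodule.mem_sup_left (Submodule.subset_span ⟨w, b, rfl⟩)))
  ext w
  rw [hfv, hκ, LieModule.traceForm_apply_apply]
  have : LieModule.toEnd ℂ L L w ∘ₗ LieModule.toEnd ℂ L L v = 0 := by
    ext y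
    have h1 : ⁅v, y⁆ ∈ LieAlgebra.center ℂ L := by
      rw [← lie_skew]; exact neg_mem (hcen y)
    exact (LieModule.mem_maxTrivSubmodule ℂ L L _).1 h1 w
  rw [this]; simp

end Reductive

/-! ### The kernel of `ad(p)²` on `𝔲₁` -/

section AdSquare

variable {𝔸 : Type*} [NormedRing 𝔸] [NormedAlgebra ℂ 𝔸]

lemma iterate_lie_eq_zero {R : Type*} [Ring R] {z : R} (hz : IsNilpotent z) (y : R) :
    ∃ k : ℕ, (fun w => ⁅z, w⁆)^[k] y = 0 := by
  obtain ⟨k, hk⟩ := LieAlgebra.ad_nilpotent_of_nilpotent (R := ℤ) hz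
  refine ⟨k, ?_⟩
  have : ∀ j : ℕ, ((LieAlgebra.ad ℤ R z) ^ j) y = (fun w => ⁅z, w⁆)^[j] y := by
    intro j
    rw [Module.End.pow_apply]; rfl
  rw [← this, hk]; rfl

namespace SymmetricPair

variable {P : SymmetricPair 𝔸}

/-- A complex linear map on `𝔤` that vanishes on `𝔲₀` and `𝔲₁` is zero. -/
lemma linearMap_eq_zero [CompleteSpace 𝔸] {M : Type*} [AddCommGroup M] [Module ℂ M]
    (f : P.𝔤 →ₗ[ℂ] M) (h0 : ∀ x : P.𝔤, (x : 𝔸) ∈ P.𝔲₀ → f x = 0)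
    (h1 : ∀ x : P.𝔤, (x : 𝔸) ∈ P.𝔲₁ → f x = 0) : f = 0 := by
  have hu : ∀ x : P.𝔤, (x : 𝔸) ∈ P.𝔲 → f x = 0 := by
    intro x hx
    obtain ⟨Y, hY, Z, hZ, e⟩ := exists_add_of_mem_𝔲 hx
    have e' : x = (⟨Y, (𝔲₀_le_𝔲 hY).1⟩ : P.𝔤) + ⟨Z, (𝔲₁_le_𝔲 hZ).1⟩ := Subtype.ext e
    rw [e', map_add, h0 _ hY, h1 _ hZ, add_zero]
  ext x
  obtain ⟨Y, hY, Z, hZ, e⟩ := exists_add_of_mem_𝔤 x.2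
  have e' : x = (⟨Y, hY.1⟩ : P.𝔤) + Complex.I • ⟨Z, hZ.1⟩ := Subtype.ext e
  rw [e', map_add, map_smul, hu _ hY, hu _ hZ, smul_zero, add_zero]; rfl

end SymmetricPair

namespace SymmetricSpace

variable (S : SymmetricSpace 𝔸)

lemma B_lie_left {z x y : 𝔸} (hz : z ∈ S.𝔲) (hx : x ∈ S.𝔲) (hy : y ∈ S.𝔲) :
    S.B ⁅z, x⁆ y = -S.B x ⁅z, y⁆ := by
  rw [← lie_skew, map_neg, LinearMap.neg_apply, S.B_ad x hx z hz y hy]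

lemma B_self_eq_zero {x : 𝔸} (hx : x ∈ S.𝔲₁) : S.B x x = 0 ↔ x = 0 := by
  refine ⟨fun h => ?_, fun h => by simp [h]⟩
  by_contra hne
  exact (S.B_pos x hx hne).ne' h

/-- The adjoint action of a nilpotent element of `𝔲₀` on `𝔲₁` is nilpotent and skew, hence zero. -/
lemma lie_eq_zero_of_isNilpotent {z y : 𝔸} (hz : z ∈ S.𝔲₀) (hn : IsNilpotent z)
    (hy : y ∈ S.𝔲₁) : ⁅z, y⁆ = 0 := by
  obtain ⟨k, hk⟩ := iterate_lie_eq_zero hn y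
  induction k generalizing y with
  | zero => simp only [Function.iterate_zero, id] at hk; rw [hk, lie_zero]
  | succ k ih =>
    have h1 : ⁅z, y⁆ ∈ S.𝔲₁ := lie_mem_𝔲₁ hz hy
    have h2 : ⁅z, ⁅z, y⁆⁆ = 0 := ih h1 hk
    rw [← S.B_self_eq_zero h1, S.B_lie_left (𝔲₀_le_𝔲 hz) (𝔲₁_le_𝔲 hy) (𝔲₁_le_𝔲 h1), h2]
    simp

/-- An element `[p, x]` of `[𝔲₁, 𝔲₁]` that centralizes `𝔲₁` is central in `𝔤`: it is orthogonal to
`𝔤` for the Killing form. -/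
lemma mem_center_of_lie_eq_zero [FiniteDimensional ℂ 𝔸] {p x : 𝔸} (hp : p ∈ S.𝔲₁)
    (hx : x ∈ S.𝔲₁) (hz : ∀ y ∈ S.𝔲₁, ⁅⁅p, x⁆, y⁆ = 0) {w : 𝔸} (hw : w ∈ S.𝔤) :
    ⁅⁅p, x⁆, w⁆ = 0 := by
  have : CompleteSpace 𝔸 := FiniteDimensional.complete ℂ 𝔸
  have := S.reductive
  set z := ⁅p, x⁆ with hzdef
  have hz0 : z ∈ S.𝔲₀ := lie_mem_𝔲₀_of_𝔲₁ hp hx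
  -- `z = [p, x]` commutes with whatever centralizes `𝔲₁`
  have hzk : ∀ k : 𝔸, (∀ y ∈ S.𝔲₁, ⁅k, y⁆ = 0) → ⁅z, k⁆ = 0 := by
    intro k hk
    rw [hzdef, lie_lie, ← lie_skew x k, hk x hx, ← lie_skew p k, hk p hp]; simp
  have hker : ∀ w : S.𝔤, killingForm ℂ S.𝔤 ⟨z, (𝔲₀_le_𝔲 hz0).1⟩ w = 0 := by
    intro w
    suffices h : killingForm ℂ S.𝔤 ⟨z, (𝔲₀_le_𝔲 hz0).1⟩ = 0 by rw [h]; rfl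
    -- for `w` in `𝔲₀` or `𝔲₁` the square of `ad z ∘ ad w` vanishes
    have key : ∀ w : S.𝔤, (w : 𝔸) ∈ S.𝔲₀ ∨ (w : 𝔸) ∈ S.𝔲₁ →
        killingForm ℂ S.𝔤 ⟨z, (𝔲₀_le_𝔲 hz0).1⟩ w = 0 := by
      intro w hw
      rw [LieModule.traceForm_apply_apply]
      set T : S.𝔤 →ₗ[ℂ] S.𝔤 := LieModule.toEnd ℂ S.𝔤 S.𝔤 ⟨z, (𝔲₀_le_𝔲 hz0).1⟩ ∘ₗ
        LieModule.toEnd ℂ S.𝔤 S.𝔤 w with hT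
      have hTv : ∀ y : S.𝔤, ((T (T y) : S.𝔤) : 𝔸) = ⁅z, ⁅(w : 𝔸), ⁅z, ⁅(w : 𝔸), (y : 𝔸)⁆⁆⁆⁆ :=
        fun y => rfl
      have hTT : T ∘ₗ T = 0 := by
        apply linearMap_eq_zero
        · intro y hy
          apply Subtype.ext
          change ((T (T y) : S.𝔤) : 𝔸) = 0
          rw [hTv]
          rcases hw with hw | hw
          · set q := ⁅z, ⁅(w : 𝔸), (y : 𝔸)⁆⁆ with hq
            have hq1 : ∀ u ∈ S.𝔲₁, ⁅q, u⁆ = 0 := by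
              intro u hu
              rw [hq, lie_lie, hz u hu, lie_zero, sub_zero,
                hz _ (lie_mem_𝔲₁ (lie_mem_𝔲₀ hw hy) hu)]
            refine hzk _ fun u hu => ?_
            rw [lie_lie, hq1 u hu, hq1 _ (lie_mem_𝔲₁ hw hu)]; simp
          · rw [hz _ (lie_mem_𝔲₁' hw hy)]; simp
        · intro y hy
          apply Subtype.ext
          change ((T (T y) : S.𝔤) : 𝔸) = 0
          rw [hTv]
          rcases hw with hw | hw
          · rw [hz _ (lie_mem_𝔲₁ hw hy)]; simp
          · exact hz _ (lie_mem_𝔲₁' hw (lie_mem_𝔲₀ hz0 (lie_mem_𝔲₀_of_𝔲₁ hw hy)))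
      have hnil : IsNilpotent T := ⟨2, by rw [pow_two]; exact hTT⟩
      exact (LinearMap.isNilpotent_trace_of_isNilpotent hnil).eq_zero
    exact linearMap_eq_zero _ (fun w hw => key w (Or.inl hw)) (fun w hw => key w (Or.inr hw))
  have hc := mem_center_of_killingForm_eq_zero hker
  have := (LieModule.mem_maxTrivSubmodule ℂ S.𝔤 S.𝔤 _).1 hc ⟨w, hw⟩
  have h2 : ⁅w, z⁆ = 0 := congrArg Subtype.val this
  rw [← lie_skew, h2, neg_zero]

/-- An element `[p, x]` of `[𝔲₁, 𝔲₁]` that is central in `𝔤` vanishes: it is orthogonal to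
commutators and to central elements, which together span the reductive Lie algebra `𝔤`. -/
lemma lie_eq_zero_of_central [FiniteDimensional ℂ 𝔸] {p x : 𝔸} (hp : p ∈ S.𝔲₁)
    (hx : x ∈ S.𝔲₁) (hz : ∀ w ∈ S.𝔤, ⁅⁅p, x⁆, w⁆ = 0) : ⁅p, x⁆ = 0 := by
  have : CompleteSpace 𝔸 := FiniteDimensional.complete ℂ 𝔸
  have := S.reductive
  set z := ⁅p, x⁆ with hzdef
  have hzu : z ∈ S.𝔲 := lie_mem_𝔲 (𝔲₁_le_𝔲 hp) (𝔲₁_le_𝔲 hx)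
  have hbr : ∀ a ∈ S.𝔲, ∀ b ∈ S.𝔲, S.B z ⁅a, b⁆ = 0 := by
    intro a ha b hb
    rw [← S.B_ad z hzu a ha b hb, hz a ha.1]; simp
  -- `w + τ w` is twice the component of `w` in `𝔲`, where alone the form `B` is meaningful
  have hre : ∀ w : S.𝔤, S.B z ((w : 𝔸) + (S.dτ w : 𝔸)) = 0 := by
    intro w
    have hw : w ∈ Submodule.span ℂ {w : S.𝔤 | ∃ a b : S.𝔤, ⁅a, b⁆ = w} ⊔
        (LieAlgebra.center ℂ S.𝔤).toSubmodule := by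
      rw [span_lie_sup_center_eq_top]; trivial
    obtain ⟨w1, hw1, c, hc, rfl⟩ := Submodule.mem_sup.1 hw
    clear hw
    -- the factor `t` makes the claim stable under complex multiples, with which `τ` does not commute
    have h1 : ∀ t : ℂ, S.B z (((t • w1 : S.𝔤) : 𝔸) + (S.dτ (t • w1) : 𝔸)) = 0 := by
      induction hw1 using Submodule.span_induction with
      | mem w hw =>
        obtain ⟨a, b, rfl⟩ := hw
        intro t
        rw [← smul_lie]
        generalize t • a = a
        obtain ⟨a1, ha1, a2, ha2, ea⟩ := exists_add_of_mem_𝔤 a.2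
        obtain ⟨b1, hb1, b2, hb2, eb⟩ := exists_add_of_mem_𝔤 b.2
        have ea' : a = (⟨a1, ha1.1⟩ : S.𝔤) + Complex.I • ⟨a2, ha2.1⟩ := Subtype.ext ea
        have eb' : b = (⟨b1, hb1.1⟩ : S.𝔤) + Complex.I • ⟨b2, hb2.1⟩ := Subtype.ext eb
        have ta : (S.dτ a : 𝔸) = a1 - Complex.I • a2 := by
          rw [ea', map_add, LinearMap.map_smulₛₗ, ha1.2, ha2.2]; simp [sub_eq_add_neg]
        have tb : (S.dτ b : 𝔸) = b1 - Complex.I • b2 := by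
          rw [eb', map_add, LinearMap.map_smulₛₗ, hb1.2, hb2.2]; simp [sub_eq_add_neg]
        have e : ((⁅a, b⁆ : S.𝔤) : 𝔸) + (S.dτ ⁅a, b⁆ : 𝔸) =
            (2 : ℝ) • (⁅a1, b1⁆ - ⁅a2, b2⁆) := by
          rw [S.dτ_lie, LieSubalgebra.coe_bracket, LieSubalgebra.coe_bracket, ta, tb, ea, eb]
          simp only [lie_def, sub_mul, mul_sub, add_mul, mul_add, smul_mul_assoc, mul_smul_comm,
            two_smul]
          match_scalars <;> ring_nf
          all_goals simp [Complex.I_sq]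
        rw [e, map_smul, map_sub, hbr a1 ha1 b1 hb1, hbr a2 ha2 b2 hb2]; simp
      | zero => intro t; simp
      | add u v _ _ hu hv =>
        intro t
        have := hu t
        have h2 := hv t
        rw [smul_add, map_add]
        simp only [map_add, AddMemClass.coe_add] at this h2 ⊢
        linarith
      | smul s u _ hu => intro t; rw [smul_smul]; exact hu _
    have h1' := h1 1
    rw [one_smul] at h1'
    have hcc : ∀ v : S.𝔤, ⁅v, c⁆ = 0 := (LieModule.mem_maxTrivSubmodule ℂ S.𝔤 S.𝔤 _).1 hc
    have hcu : (c : 𝔸) + (S.dτ c : 𝔸) ∈ S.𝔲 := by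
      refine ⟨(c + S.dτ c).2, ?_⟩
      change S.dτ (c + S.dτ c) = c + S.dτ c
      rw [map_add, S.dτ_dτ, add_comm]
    have hxc : ⁅x, (c : 𝔸) + (S.dτ c : 𝔸)⁆ = 0 := by
      have e1 : ⁅(⟨x, hx.1.1⟩ : S.𝔤), c⁆ = 0 := hcc _
      have e2 : ⁅(⟨x, hx.1.1⟩ : S.𝔤), S.dτ c⁆ = 0 := by
        have := congrArg S.dτ (hcc (S.dτ ⟨x, hx.1.1⟩))
        rwa [S.dτ_lie, S.dτ_dτ, map_zero] at this
      have e1' : ⁅x, (c : 𝔸)⁆ = 0 := congrArg Subtype.val e1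
      have e2' : ⁅x, (S.dτ c : 𝔸)⁆ = 0 := congrArg Subtype.val e2
      rw [lie_add, e1', e2', add_zero]
    have h2 : S.B z ((c : 𝔸) + (S.dτ c : 𝔸)) = 0 := by
      rw [hzdef, S.B_ad p (𝔲₁_le_𝔲 hp) x (𝔲₁_le_𝔲 hx) _ hcu, hxc]; simp
    have e : ((w1 + c : S.𝔤) : 𝔸) + (S.dτ (w1 + c) : 𝔸) =
        ((w1 : 𝔸) + (S.dτ w1 : 𝔸)) + ((c : 𝔸) + (S.dτ c : 𝔸)) := by
      rw [map_add, AddMemClass.coe_add, AddMemClass.coe_add]; abel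
    rw [e, map_add, h1', h2, add_zero]
  refine S.B_nondegenerate z hzu fun w hw => ?_
  have := hre ⟨w, hw.1⟩
  rw [hw.2] at this
  simp only [map_add] at this
  linarith

/-- `ad(p)²` and `ad(p)` have the same kernel on `𝔲₁`. This is where reductivity of `𝔤` is used. -/
lemma lie_eq_zero_of_lie_lie_eq_zero [FiniteDimensional ℂ 𝔸] {p x : 𝔸} (hp : p ∈ S.𝔲₁)
    (hx : x ∈ S.𝔲₁) (h : ⁅p, ⁅p, x⁆⁆ = 0) : ⁅p, x⁆ = 0 := by
  have hnil : IsNilpotent ⁅p, x⁆ := isNilpotent_lie_of_commute (sub_eq_zero.1 h)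
  have hz : ∀ y ∈ S.𝔲₁, ⁅⁅p, x⁆, y⁆ = 0 := fun y hy =>
    S.lie_eq_zero_of_isNilpotent (lie_mem_𝔲₀_of_𝔲₁ hp hx) hnil hy
  exact S.lie_eq_zero_of_central hp hx fun w hw => S.mem_center_of_lie_eq_zero hp hx hz hw

end SymmetricSpace

end AdSquare

/-! ### Maximal abelian subspaces of `𝔲₁` -/

section MaxAbelian

variable {𝔸 : Type*} [NormedRing 𝔸] [NormedAlgebra ℂ 𝔸]

/-- `ad p` as a real linear map. -/
def adℝ (p : 𝔸) : 𝔸 →ₗ[ℝ] 𝔸 := LinearMap.mulLeft ℝ p - LinearMap.mulRight ℝ p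

lemma adℝ_apply (p x : 𝔸) : adℝ p x = ⁅p, x⁆ := rfl

lemma lie_real_smul (t : ℝ) (x y : 𝔸) : ⁅x, t • y⁆ = t • ⁅x, y⁆ := map_smul (adℝ x) t y

lemma real_smul_lie (t : ℝ) (x y : 𝔸) : ⁅t • x, y⁆ = t • ⁅x, y⁆ := by
  rw [← lie_skew, lie_real_smul, ← smul_neg, lie_skew]

lemma lie_comm_of_lie_eq_zero {R : Type*} [Ring R] {p q : R} (h : ⁅p, q⁆ = 0) (x : R) :
    ⁅p, ⁅q, x⁆⁆ = ⁅q, ⁅p, x⁆⁆ := by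
  rw [leibniz_lie, h, zero_lie, zero_add]

lemma lie_eq_zero_symm {R : Type*} [Ring R] {p q : R} : ⁅p, q⁆ = 0 ↔ ⁅q, p⁆ = 0 := by
  rw [← lie_skew, neg_eq_zero]

lemma conj_lie {R : Type*} [Ring R] (k : Rˣ) (x y : R) :
    (k : R) * ⁅x, y⁆ * (↑k⁻¹ : R) =
      ⁅(k : R) * x * (↑k⁻¹ : R), (k : R) * y * (↑k⁻¹ : R)⁆ := by
  simp only [lie_def, mul_sub, sub_mul, mul_assoc, Units.inv_mul_cancel_left]

lemma conj_conj_inv {R : Type*} [Ring R] (k : Rˣ) (x : R) :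
    (k : R) * ((↑k⁻¹ : R) * x * k) * (↑k⁻¹ : R) = x := by
  simp [mul_assoc]

lemma conj_inv_conj {R : Type*} [Ring R] (k : Rˣ) (x : R) :
    (↑k⁻¹ : R) * ((k : R) * x * (↑k⁻¹ : R)) * k = x := by
  simp [mul_assoc]

namespace SymmetricSpace

variable (S : SymmetricSpace 𝔸)

/-- The centralizer of `p` in `𝔲₁`. -/
def centralizer₁ (p : 𝔸) : Submodule ℝ 𝔸 := S.𝔲₁ ⊓ LinearMap.ker (adℝ p)

lemma mem_centralizer₁ {p x : 𝔸} : x ∈ S.centralizer₁ p ↔ x ∈ S.𝔲₁ ∧ ⁅p, x⁆ = 0 := Iff.rfl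

lemma lie_lie_mem {p q x : 𝔸} (hp : p ∈ S.𝔲₁) (hq : q ∈ S.𝔲₁) (hx : x ∈ S.𝔲₁) :
    ⁅p, ⁅q, x⁆⁆ ∈ S.𝔲₁ :=
  lie_mem_𝔲₁' hp (lie_mem_𝔲₀_of_𝔲₁ hq hx)

lemma B_symm₁ {x y : 𝔸} (hx : x ∈ S.𝔲₁) (hy : y ∈ S.𝔲₁) : S.B x y = S.B y x :=
  S.B_symm x (𝔲₁_le_𝔲 hx) y (𝔲₁_le_𝔲 hy)

/-- `ad(p)²` is symmetric on `𝔲₁`. -/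
lemma B_lie_lie {p x y : 𝔸} (hp : p ∈ S.𝔲₁) (hx : x ∈ S.𝔲₁) (hy : y ∈ S.𝔲₁) :
    S.B ⁅p, ⁅p, x⁆⁆ y = S.B x ⁅p, ⁅p, y⁆⁆ := by
  rw [S.B_lie_left (𝔲₁_le_𝔲 hp) (𝔲₀_le_𝔲 (lie_mem_𝔲₀_of_𝔲₁ hp hx)) (𝔲₁_le_𝔲 hy),
    S.B_lie_left (𝔲₁_le_𝔲 hp) (𝔲₁_le_𝔲 hx) (𝔲₀_le_𝔲 (lie_mem_𝔲₀_of_𝔲₁ hp hy)), neg_neg]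

lemma isCompact_conj (b : 𝔸) (hb : b ∈ S.𝔲₁) :
    IsCompact {y : 𝔸 | ∃ k ∈ S.U₀, y = (k : 𝔸) * b * (↑k⁻¹ : 𝔸)} := by
  have h := S.isCompact_isotropy.image (continuous_apply (⟨b, hb⟩ : S.𝔲₁))
  convert h using 1
  ext y
  constructor
  · rintro ⟨k, hk, rfl⟩
    exact ⟨fun X => (k : 𝔸) * (X : 𝔸) * (↑k⁻¹ : 𝔸), ⟨k, hk, fun _ => rfl⟩, rfl⟩
  · rintro ⟨f, ⟨k, hk, hf⟩, rfl⟩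
    exact ⟨k, hk, hf _⟩

variable [FiniteDimensional ℂ 𝔸]

/-- `𝔲₁` is the sum of the kernel and the image of `ad(p)²`. -/
lemma exists_add_lie_lie {p : 𝔸} (hp : p ∈ S.𝔲₁) {x : 𝔸} (hx : x ∈ S.𝔲₁) :
    ∃ x₀ ∈ S.centralizer₁ p, ∃ w ∈ S.𝔲₁, x = x₀ + ⁅p, ⁅p, w⁆⁆ := by
  set T : S.𝔲₁ →ₗ[ℝ] S.𝔲₁ := (adℝ p ∘ₗ adℝ p).restrict
    (fun x hx => S.lie_lie_mem hp hp hx) with hT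
  have hTv : ∀ y : S.𝔲₁, ((T y : S.𝔲₁) : 𝔸) = ⁅p, ⁅p, (y : 𝔸)⁆⁆ := fun y => rfl
  have hdisj : Disjoint (LinearMap.ker T) (LinearMap.range T) := by
    rw [Submodule.disjoint_def]
    rintro y hy ⟨w, rfl⟩
    have h0 : ⁅p, ⁅p, ((T w : S.𝔲₁) : 𝔸)⁆⁆ = 0 := by
      rw [← hTv, LinearMap.mem_ker.1 hy]; rfl
    apply Subtype.ext
    rw [ZeroMemClass.coe_zero, ← S.B_self_eq_zero (T w).2]
    nth_rewrite 1 [hTv]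
    rw [S.B_lie_lie hp w.2 (T w).2, h0, map_zero]
  have htop := Submodule.eq_top_of_disjoint (LinearMap.ker T) (LinearMap.range T)
    (by rw [add_comm, LinearMap.finrank_range_add_finrank_ker]) hdisj
  have hx' : (⟨x, hx⟩ : S.𝔲₁) ∈ LinearMap.ker T ⊔ LinearMap.range T := by rw [htop]; trivial
  obtain ⟨x₀, h0, _, ⟨w, rfl⟩, e⟩ := Submodule.mem_sup.1 hx'
  refine ⟨x₀, ⟨x₀.2, ?_⟩, w, w.2, (congrArg Subtype.val e).symm⟩
  refine S.lie_eq_zero_of_lie_lie_eq_zero hp x₀.2 ?_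
  rw [← hTv, LinearMap.mem_ker.1 h0]; rfl

/-- A small perturbation of `p` in a commuting direction does not enlarge its centralizer. -/
lemma exists_centralizer₁_le {p q : 𝔸} (hp : p ∈ S.𝔲₁) (hpq : ⁅p, q⁆ = 0) :
    ∃ ε : ℝ, ε ≠ 0 ∧ S.centralizer₁ (p + ε • q) ≤ S.centralizer₁ p := by
  set W : Submodule ℝ 𝔸 := S.𝔲₁.map (adℝ p ∘ₗ adℝ p) with hW
  set T : W →ₗ[ℝ] 𝔸 := (adℝ p ∘ₗ adℝ p).domRestrict W with hT
  have hinj : Function.Injective T := by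
    rw [injective_iff_map_eq_zero]
    rintro ⟨y, w, hw, rfl⟩ hy
    have h0 : ⁅p, ⁅p, ⁅p, ⁅p, w⁆⁆⁆⁆ = 0 := hy
    have h1 := S.lie_lie_mem hp hp hw
    have : ⁅p, ⁅p, w⁆⁆ = 0 := by
      rw [← S.B_self_eq_zero h1, S.B_lie_lie hp hw h1, h0, map_zero]
    exact Subtype.ext this
  obtain ⟨K, hK, hanti⟩ := T.exists_antilipschitzWith (LinearMap.ker_eq_bot.2 hinj)
  set C : ℝ := ‖LinearMap.toContinuousLinearMap (adℝ p ∘ₗ adℝ q)‖ with hC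
  have hCb : ∀ y, ‖⁅p, ⁅q, y⁆⁆‖ ≤ C * ‖y‖ := fun y =>
    (LinearMap.toContinuousLinearMap (adℝ p ∘ₗ adℝ q)).le_opNorm y
  have hC0 : 0 ≤ C := norm_nonneg _
  have hK0 : 0 ≤ (K : ℝ) := K.2
  -- `ad(p)²` is bounded below by `1 / K` on its image in `𝔲₁`, where `ε ad(p) ad(q)` has norm at most
  -- `1 / (2K)`
  set ε : ℝ := 1 / (2 * (K * C + 1)) with hε
  have hεpos : 0 < ε := by positivity
  refine ⟨ε, hεpos.ne', ?_⟩
  rintro x ⟨hx, hx0⟩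
  have hx0' : ⁅p, x⁆ + ε • ⁅q, x⁆ = 0 := by
    have : ⁅p + ε • q, x⁆ = 0 := hx0
    rwa [add_lie, real_smul_lie] at this
  obtain ⟨x₀, ⟨h0u, h0⟩, w, hw, rfl⟩ := S.exists_add_lie_lie hp hx
  have h0' : ⁅p, x₀⁆ = 0 := h0
  set y := ⁅p, ⁅p, w⁆⁆ with hy
  have hey : ⁅p, ⁅p, y⁆⁆ = -(ε • ⁅p, ⁅q, y⁆⁆) := by
    have h2 := congrArg (fun z => ⁅p, z⁆) hx0'
    simp only [lie_add, lie_real_smul, lie_zero, h0', zero_add, smul_add,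
      lie_comm_of_lie_eq_zero hpq x₀] at h2
    rw [smul_zero, zero_add] at h2
    exact eq_neg_of_add_eq_zero_left h2
  have hyW : y ∈ W := ⟨w, hw, rfl⟩
  have h3 : ‖y‖ ≤ K * ‖⁅p, ⁅p, y⁆⁆‖ := by
    have := hanti.le_mul_dist ⟨y, hyW⟩ 0
    rw [map_zero, dist_zero_right, dist_zero_right] at this
    exact this
  have h4 : ‖y‖ ≤ 1 / 2 * ‖y‖ := by
    rw [hey, norm_neg, norm_smul, Real.norm_of_nonneg hεpos.le] at h3
    calc ‖y‖ ≤ K * (ε * (C * ‖y‖)) := h3.trans (by gcongr; exact hCb y)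
      _ = (K * C) / (K * C + 1) * (1 / 2) * ‖y‖ := by rw [hε]; field_simp
      _ ≤ 1 * (1 / 2) * ‖y‖ := by
        gcongr
        rw [div_le_one (by positivity)]
        linarith
      _ = _ := by ring
  have hy0 : y = 0 := by
    rw [← norm_le_zero_iff]; linarith
  rw [hy0, add_zero]
  exact ⟨h0u, h0⟩

/-- Maximal abelian subspaces contain regular elements: a centralizer of minimal dimension among
those of the elements of `𝒜` commutes with `𝒜`. -/
lemma exists_centralizer₁_eq {𝒜 : Submodule ℝ 𝔸} (h𝒜 : S.IsMaxAbelian 𝒜) :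
    ∃ p ∈ 𝒜, S.centralizer₁ p = 𝒜 := by
  obtain ⟨p, hp, hmin⟩ : ∃ p ∈ 𝒜, ∀ q ∈ 𝒜,
      Module.finrank ℝ (S.centralizer₁ p) ≤ Module.finrank ℝ (S.centralizer₁ q) := by
    have hne : ((fun p => Module.finrank ℝ (S.centralizer₁ p)) '' (𝒜 : Set 𝔸)).Nonempty :=
      ⟨_, 0, 𝒜.zero_mem, rfl⟩
    obtain ⟨p, hp, e⟩ := Nat.sInf_mem hne
    exact ⟨p, hp, fun q hq => e.trans_le (Nat.sInf_le ⟨q, hq, rfl⟩)⟩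
  obtain ⟨⟨hsub, hab⟩, hmax⟩ := h𝒜
  have hcomm : ∀ x ∈ S.centralizer₁ p, ∀ q ∈ 𝒜, ⁅q, x⁆ = 0 := by
    intro x hx q hq
    obtain ⟨ε, hε, hle⟩ := S.exists_centralizer₁_le (hsub hp) (hab p hp q hq)
    have heq := Submodule.eq_of_le_of_finrank_le hle
      (hmin _ (𝒜.add_mem hp (𝒜.smul_mem ε hq)))
    have h1 : ⁅p + ε • q, x⁆ = 0 := by
      rw [← heq] at hx; exact hx.2
    have h2 : ⁅p, x⁆ = 0 := hx.2
    have h3 : ε • ⁅q, x⁆ = 0 := by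
      rwa [add_lie, h2, zero_add, real_smul_lie] at h1
    exact (smul_eq_zero.1 h3).resolve_left hε
  refine ⟨p, hp, le_antisymm (fun x hx => ?_) fun x hx => ⟨hsub hx, hab p hp x hx⟩⟩
  have hab' : S.IsAbelianIn (𝒜 ⊔ Submodule.span ℝ {x}) := by
    constructor
    · exact sup_le hsub (by rw [Submodule.span_singleton_le_iff_mem]; exact hx.1)
    · intro y hy z hz
      obtain ⟨y1, hy1, y2, hy2, rfl⟩ := Submodule.mem_sup.1 hy
      obtain ⟨z1, hz1, z2, hz2, rfl⟩ := Submodule.mem_sup.1 hz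
      obtain ⟨s, rfl⟩ := Submodule.mem_span_singleton.1 hy2
      obtain ⟨t, rfl⟩ := Submodule.mem_span_singleton.1 hz2
      have e1 : ⁅y1, t • x⁆ = 0 := by
        rw [lie_real_smul, hcomm x hx y1 hy1, smul_zero]
      have e2 : ⁅s • x, z1⁆ = 0 := by
        rw [lie_eq_zero_symm, lie_real_smul, hcomm x hx z1 hz1, smul_zero]
      have e3 : ⁅s • x, t • x⁆ = 0 := by
        rw [lie_real_smul, real_smul_lie, lie_self]; simp
      rw [add_lie, lie_add, lie_add, hab y1 hy1 z1 hz1, e1, e2, e3]; simp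
  have := hmax _ hab' le_sup_left
  rw [← this]
  exact Submodule.mem_sup_right (Submodule.mem_span_singleton_self x)

/-- Every `U₀`-orbit in `𝔲₁` meets the centralizer of every point `a` of `𝔲₁`: a minimum of
`B(·, a)` on the orbit commutes with `a`. -/
lemma exists_conj_lie_eq_zero {a b : 𝔸} (ha : a ∈ S.𝔲₁) (hb : b ∈ S.𝔲₁) :
    ∃ k ∈ S.U₀, ⁅(k : 𝔸) * b * (↑k⁻¹ : 𝔸), a⁆ = 0 := by
  have : CompleteSpace 𝔸 := FiniteDimensional.complete ℂ 𝔸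
  have hBc : Continuous fun y => S.B y a :=
    (LinearMap.toContinuousLinearMap (S.B.flip a)).continuous
  obtain ⟨b', ⟨k, hk, rfl⟩, hmin⟩ := (S.isCompact_conj b hb).exists_isMinOn
    ⟨b, 1, S.U₀.one_mem, by simp⟩ hBc.continuousOn
  refine ⟨k, hk, ?_⟩
  set b' := (k : 𝔸) * b * (↑k⁻¹ : 𝔸) with hb'
  have hb'u : b' ∈ S.𝔲₁ := conj_mem_𝔲₁ hk hb
  have hz : ∀ z ∈ S.𝔲₀, S.B z ⁅b', a⁆ = 0 := by
    intro z hz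
    set f : ℝ → ℝ := fun t => S.B (NormedSpace.exp (t • z) * b' * NormedSpace.exp (t • (-z))) a
      with hf
    have hd : HasDerivAt f (S.B ⁅z, b'⁆ a) 0 := by
      have h1 : HasDerivAt (fun s : ℝ => NormedSpace.exp (s • z)) z 0 := by
        simpa using hasDerivAt_exp_smul_const (𝕂 := ℝ) z (0 : ℝ)
      have h2 : HasDerivAt (fun s : ℝ => NormedSpace.exp (s • (-z))) (-z) 0 := by
        simpa using hasDerivAt_exp_smul_const (𝕂 := ℝ) (-z) (0 : ℝ)
      have h3 := (h1.mul_const b').mul h2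
      have h4 := (LinearMap.toContinuousLinearMap (S.B.flip a)).hasFDerivAt.comp_hasDerivAt
        (0 : ℝ) h3
      refine h4.congr_deriv ?_
      simp [lie_def, sub_eq_add_neg]
    have hmin' : IsLocalMin f 0 := by
      refine Filter.Eventually.of_forall fun t => ?_
      obtain ⟨g, hg, hgz⟩ := exp_mem_U₀ hz t
      have hginv : (↑g⁻¹ : 𝔸) = NormedSpace.exp (t • (-z)) := by
        apply Units.inv_eq_of_mul_eq_one_right
        let : NormedAlgebra ℚ 𝔸 := NormedAlgebra.restrictScalars ℚ ℂ 𝔸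
        rw [hgz, ← NormedSpace.exp_add_of_commute (by
          rw [smul_neg]; exact (Commute.refl _).neg_right)]
        simp
      have h5 : NormedSpace.exp (t • z) * b' * NormedSpace.exp (t • (-z)) ∈
          {y : 𝔸 | ∃ k ∈ S.U₀, y = (k : 𝔸) * b * (↑k⁻¹ : 𝔸)} := by
        refine ⟨g * k, S.U₀.mul_mem hg hk, ?_⟩
        rw [← hgz, ← hginv, hb', mul_inv_rev]
        simp [mul_assoc]
      have h6 := hmin h5
      simpa [hf] using h6
    have := hmin'.hasDerivAt_eq_zero hd
    rwa [S.B_ad z (𝔲₀_le_𝔲 hz) b' (𝔲₁_le_𝔲 hb'u) a (𝔲₁_le_𝔲 ha)] at this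
  have hba : ⁅b', a⁆ ∈ S.𝔲₀ := lie_mem_𝔲₀_of_𝔲₁ hb'u ha
  refine S.B_nondegenerate _ (𝔲₀_le_𝔲 hba) fun w hw => ?_
  obtain ⟨y, hy, z, hz1, rfl⟩ := exists_add_of_mem_𝔲 hw
  rw [map_add, S.B_orthogonal _ hba z hz1, S.B_symm _ (𝔲₀_le_𝔲 hba) y (𝔲₀_le_𝔲 hy), hz y hy,
    add_zero]

/-- All maximal abelian subspaces of `𝔲₁` are conjugate under `U₀`. -/
lemma exists_conj_maxAbelian {𝒜 𝒜' : Submodule ℝ 𝔸} (h𝒜 : S.IsMaxAbelian 𝒜)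
    (h𝒜' : S.IsMaxAbelian 𝒜') : ∃ k ∈ S.U₀, (∀ x ∈ 𝒜, (k : 𝔸) * x * (↑k⁻¹ : 𝔸) ∈ 𝒜') ∧
      ∀ y ∈ 𝒜', (↑k⁻¹ : 𝔸) * y * k ∈ 𝒜 := by
  have : CompleteSpace 𝔸 := FiniteDimensional.complete ℂ 𝔸
  obtain ⟨a, ha, hca⟩ := S.exists_centralizer₁_eq h𝒜'
  obtain ⟨b, hb, hcb⟩ := S.exists_centralizer₁_eq h𝒜
  obtain ⟨k, hk, hkb⟩ := S.exists_conj_lie_eq_zero (h𝒜'.1.1 ha) (h𝒜.1.1 hb)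
  have hb' : (k : 𝔸) * b * (↑k⁻¹ : 𝔸) ∈ 𝒜' := by
    rw [← hca]
    exact ⟨conj_mem_𝔲₁ hk (h𝒜.1.1 hb), lie_eq_zero_symm.1 hkb⟩
  have hinv : ∀ y ∈ 𝒜', (↑k⁻¹ : 𝔸) * y * k ∈ 𝒜 := by
    intro y hy
    rw [← hcb]
    refine ⟨by simpa using conj_mem_𝔲₁ (S.U₀.inv_mem hk) (h𝒜'.1.1 hy), ?_⟩
    have h1 : ⁅(k : 𝔸) * b * (↑k⁻¹ : 𝔸), y⁆ = 0 := h𝒜'.1.2 _ hb' y hy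
    have h2 := conj_lie k⁻¹ ((k : 𝔸) * b * (↑k⁻¹ : 𝔸)) y
    rw [h1, inv_inv, conj_inv_conj] at h2
    change ⁅b, (↑k⁻¹ : 𝔸) * y * k⁆ = 0
    rw [← h2]; simp
  refine ⟨k, hk, fun x hx => ?_, hinv⟩
  rw [← hca]
  refine ⟨conj_mem_𝔲₁ hk (h𝒜.1.1 hx), ?_⟩
  have h1 := conj_lie k ((↑k⁻¹ : 𝔸) * a * k) x
  rw [h𝒜.1.2 _ (hinv a ha) x hx, conj_conj_inv] at h1
  change ⁅a, (k : 𝔸) * x * (↑k⁻¹ : 𝔸)⁆ = 0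
  rw [← h1]; simp

end SymmetricSpace

end MaxAbelian

/-! ### Calculus of frames -/

section FrameCalculus

variable {E F A : Type*} [NormedAddCommGroup E] [NormedSpace ℝ E] [NormedAddCommGroup F]
  [NormedSpace ℝ F] [NormedRing A] [NormedAlgebra ℝ A]

/-- A function whose derivative takes values in a subspace `V` stays in `V`. -/
lemma mem_of_fderiv_mem [FiniteDimensional ℝ F] {O : Set E} (hs : StarConvex ℝ 0 O)
    (V : Submodule ℝ F) {f : E → F} {f' : E → E →L[ℝ] F} (hf : ∀ x ∈ O, HasFDerivAt f (f' x) x)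
    (hmem : ∀ x ∈ O, ∀ h, f' x h ∈ V) (h0 : f 0 ∈ V) : ∀ x ∈ O, f x ∈ V := by
  intro x hx
  rw [← Subspace.forall_mem_dualAnnihilator_apply_eq_zero_iff]
  intro φ hφ
  rw [Submodule.mem_dualAnnihilator] at hφ
  refine eq_zero_of_norm_fderiv_le hs (c := fun _ => 0) continuousOn_const
    (g := fun y => φ (f y)) (g' := fun y => (LinearMap.toContinuousLinearMap φ).comp (f' y))
    (fun y hy => ((LinearMap.toContinuousLinearMap φ).hasFDerivAt.comp y (hf y hy)))
    (fun y hy h => ?_) (hφ _ h0) x hx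
  have : φ (f' y h) = 0 := hφ _ (hmem y hy h)
  simp [this]

/-- Solutions of `dP = P θ` are determined by their value at the center. -/
lemma frame_unique {O : Set E} (hs : StarConvex ℝ 0 O) {θ : E → E →L[ℝ] A}
    (hθ : ContinuousOn θ O) {P Q : E → A}
    (hP : ∀ x ∈ O, HasFDerivAt P ((ContinuousLinearMap.mul ℝ A (P x)).comp (θ x)) x)
    (hQ : ∀ x ∈ O, HasFDerivAt Q ((ContinuousLinearMap.mul ℝ A (Q x)).comp (θ x)) x)
    (h0 : P 0 = Q 0) : ∀ x ∈ O, P x = Q x := by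
  intro x hx
  rw [← sub_eq_zero]
  refine eq_zero_of_norm_fderiv_le hs (c := fun y => ‖θ y‖) hθ.norm (g := fun y => P y - Q y)
    (fun y hy => (hP y hy).sub (hQ y hy)) (fun y _ h => ?_) (by simp [h0]) x hx
  have e : ((ContinuousLinearMap.mul ℝ A (P y)).comp (θ y) -
      (ContinuousLinearMap.mul ℝ A (Q y)).comp (θ y)) h = (P y - Q y) * θ y h := by
    simp [sub_mul]
  rw [e]
  calc ‖(P y - Q y) * θ y h‖ ≤ ‖P y - Q y‖ * (‖θ y‖ * ‖h‖) :=
        (norm_mul_le _ _).trans (by gcongr; exact (θ y).le_opNorm h)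
    _ = _ := by ring

/-- If the exponentials of the values of `θ` lie in a closed subgroup `H`, then so do the values of
the solution of `dP = P θ`, `P(0) = 1`. -/
lemma frame_mem [CompleteSpace A] {O : Set E} (hs : StarConvex ℝ 0 O) (H : Subgroup Aˣ)
    (hH : IsClosed (H : Set Aˣ)) {θ : E → E →L[ℝ] A} (hθ : ContinuousOn θ O)
    (hexp : ∀ x ∈ O, ∀ h, ∀ s : ℝ, ∃ g ∈ H, (g : A) = NormedSpace.exp (s • θ x h)) {P : E → Aˣ}
    (h0 : P 0 = 1) (hP : ∀ x ∈ O, HasFDerivAt (fun y => (P y : A))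
      ((ContinuousLinearMap.mul ℝ A (P x)).comp (θ x)) x) : ∀ x ∈ O, P x ∈ H := by
  intro x hx
  have hmem : ∀ t ∈ Icc (0 : ℝ) 1, t • x ∈ O := fun t ht => hs.smul_mem hx ht.1 ht.2
  exact mem_of_linear_ode H hH (θ := fun t => θ (t • x) x) (P := fun t => (P (t • x) : A))
    ((hθ.comp (by fun_prop) hmem).clm_apply continuousOn_const)
    (fun t ht => hexp _ (hmem t ht) x) (by simp [h0])
    (fun t ht => hasDerivAt_comp_ray (hP _ (hmem t ht))) (by simp)

variable [CompleteSpace A]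

lemma hasFDerivAt_frame_inv {θ : E →L[ℝ] A} {P : E → Aˣ} {x : E}
    (hP : HasFDerivAt (fun y => (P y : A)) ((ContinuousLinearMap.mul ℝ A (P x)).comp θ) x) :
    HasFDerivAt (fun y => (↑(P y)⁻¹ : A))
      (-((ContinuousLinearMap.mul ℝ A).flip (↑(P x)⁻¹ : A)).comp θ) x := by
  have h1 := (hasFDerivAt_ringInverse (𝕜 := ℝ) (P x)).comp x hP
  have e : (Ring.inverse ∘ fun y => (P y : A)) = fun y => (↑(P y)⁻¹ : A) := by
    ext y; simp
  rw [e] at h1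
  refine h1.congr_fderiv ?_
  ext h
  simp

/-- The derivative of `P c P⁻¹` for a solution of `dP = P θ`. -/
lemma hasFDerivAt_frame_conj {θ : E →L[ℝ] A} {P : E → Aˣ} {x : E} {c : E → A} {c' : E →L[ℝ] A}
    (hP : HasFDerivAt (fun y => (P y : A)) ((ContinuousLinearMap.mul ℝ A (P x)).comp θ) x)
    (hc : HasFDerivAt c c' x) {f' : E →L[ℝ] A}
    (hf' : ∀ h, f' h = (P x : A) * (c' h + ⁅θ h, c x⁆) * (↑(P x)⁻¹ : A)) :
    HasFDerivAt (fun y => (P y : A) * c y * (↑(P y)⁻¹ : A)) f' x := by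
  refine ((hP.mul' hc).mul' (hasFDerivAt_frame_inv hP)).congr_fderiv ?_
  ext h
  rw [hf']
  simp [lie_def, mul_add, add_mul, mul_sub, sub_mul, mul_assoc]
  abel

lemma contDiffOn_units_inv {O : Set E} {P : E → Aˣ} {k : WithTop ℕ∞}
    (hP : ContDiffOn ℝ k (fun y => (P y : A)) O) :
    ContDiffOn ℝ k (fun y => (↑(P y)⁻¹ : A)) O := by
  intro x hx
  have h1 := (contDiffAt_ringInverse ℝ (n := k) (P x)).comp_contDiffWithinAt x (hP x hx)
  refine h1.congr (fun y _ => ?_) ?_ <;> simp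

end FrameCalculus

/-! ### The Lax form of a solution and its frames -/

section Lax

variable {𝔸 : Type*} [NormedRing 𝔸] [NormedAlgebra ℂ 𝔸]

/-- The bracket as a continuous real bilinear map. -/
def lieL : 𝔸 →L[ℝ] 𝔸 →L[ℝ] 𝔸 := ContinuousLinearMap.mul ℝ 𝔸 - (ContinuousLinearMap.mul ℝ 𝔸).flip

@[simp] lemma lieL_apply (x y : 𝔸) : lieL x y = ⁅x, y⁆ := rfl

/-- The linear map `h ↦ ∑ᵢ hᵢ aᵢ`. -/
def linComb {n : ℕ} {F : Type*} [NormedAddCommGroup F] [NormedSpace ℝ F] (a : Fin n → F) :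
    (Fin n → ℝ) →L[ℝ] F :=
  ∑ i, (ContinuousLinearMap.proj (R := ℝ) (φ := fun _ : Fin n => ℝ) i).smulRight (a i)

section

variable {n : ℕ} {F : Type*} [NormedAddCommGroup F] [NormedSpace ℝ F]

lemma linComb_apply (a : Fin n → F) (h : Fin n → ℝ) : linComb a h = ∑ i, h i • a i := by
  simp [linComb]

@[simp] lemma linComb_single (a : Fin n → F) (i : Fin n) : linComb a (Pi.single i 1) = a i := by
  rw [linComb_apply, Finset.sum_eq_single i] <;> simp +contextual

lemma clm_pi_ext {f g : (Fin n → ℝ) →L[ℝ] F}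
    (h : ∀ i, f (Pi.single i 1) = g (Pi.single i 1)) : f = g := by
  apply ContinuousLinearMap.coe_injective
  refine LinearMap.pi_ext' fun i => LinearMap.ext_ring ?_
  exact h i

lemma range_linComb (a : Fin n → F) :
    LinearMap.range (linComb a : (Fin n → ℝ) →ₗ[ℝ] F) = Submodule.span ℝ (Set.range a) := by
  ext y
  rw [Submodule.mem_span_range_iff_exists_fun]
  simp only [LinearMap.mem_range, ContinuousLinearMap.coe_coe, linComb_apply]

end

variable {n : ℕ}

/-- The Lax form `θ_λ(h) = λ α(h) + [α(h), v]` with `α(h) = ∑ᵢ hᵢ aᵢ`. -/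
def laxForm (a : Fin n → 𝔸) (v : (Fin n → ℝ) → 𝔸) (lam : ℂ) (x : Fin n → ℝ) :
    (Fin n → ℝ) →L[ℝ] 𝔸 :=
  lam • linComb a + (lieL.flip (v x)).comp (linComb a)

lemma laxForm_apply (a : Fin n → 𝔸) (v : (Fin n → ℝ) → 𝔸) (lam : ℂ) (x h : Fin n → ℝ) :
    laxForm a v lam x h = lam • linComb a h + ⁅linComb a h, v x⁆ := rfl

lemma contDiffOn_laxForm (a : Fin n → 𝔸) {v : (Fin n → ℝ) → 𝔸} {O : Set (Fin n → ℝ)}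
    {k : WithTop ℕ∞} (hv : ContDiffOn ℝ k v O) (lam : ℂ) :
    ContDiffOn ℝ k (laxForm a v lam) O :=
  by
  have h : ContDiffOn ℝ k (fun x => (lieL (𝔸 := 𝔸)).flip (v x)) O :=
    (lieL (𝔸 := 𝔸)).flip.contDiff.comp_contDiffOn hv
  exact contDiffOn_const.add (h.clm_comp contDiffOn_const)

namespace SymmetricSpace

variable {S : SymmetricSpace 𝔸} {𝒜 : Submodule ℝ 𝔸} {a : Fin n → 𝔸}

lemma IsFrame.hasFDerivAt {O : Set (Fin n → ℝ)} {v : (Fin n → ℝ) → 𝔸}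
    {E : (Fin n → ℝ) → ℂ → 𝔸ˣ} (hE : S.IsFrame a O v E) {x : Fin n → ℝ} (hx : x ∈ O) (lam : ℂ) :
    HasFDerivAt (fun y => (E y lam : 𝔸))
      ((ContinuousLinearMap.mul ℝ 𝔸 (E x lam)).comp (laxForm a v lam x)) x := by
  refine (hE.differentiableAt x hx lam).hasFDerivAt.congr_fderiv (clm_pi_ext fun i => ?_)
  have := hE.eqn x hx lam i
  rw [pd] at this
  rw [this]
  simp [laxForm_apply]

lemma IsOrthonormalBasis.mem (ha : S.IsOrthonormalBasis 𝒜 a) (i : Fin n) : a i ∈ 𝒜 := by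
  rw [← ha.2]; exact Submodule.subset_span ⟨i, rfl⟩

lemma IsOrthonormalBasis.linComb_mem (ha : S.IsOrthonormalBasis 𝒜 a) (h : Fin n → ℝ) :
    linComb a h ∈ 𝒜 := by
  rw [linComb_apply]
  exact Submodule.sum_mem _ fun i _ => 𝒜.smul_mem _ (ha.mem i)

lemma IsOrthonormalBasis.B_linComb (ha : S.IsOrthonormalBasis 𝒜 a) (h : Fin n → ℝ) (i : Fin n) :
    S.B (linComb a h) (a i) = h i := by
  rw [linComb_apply]
  simp [ha.1]

lemma IsOrthonormalBasis.linComb_injective (ha : S.IsOrthonormalBasis 𝒜 a) :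
    Function.Injective (linComb a) := by
  intro h h' e
  ext i
  rw [← ha.B_linComb h i, e, ha.B_linComb]

/-- **Zero curvature**: the Lax form of a solution is flat for every `λ`. -/
lemma IsSolution.flat (h𝒜 : S.IsAbelianIn 𝒜) (ha : S.IsOrthonormalBasis 𝒜 a)
    {O : Set (Fin n → ℝ)} (hO : IsOpen O) {v : (Fin n → ℝ) → 𝔸} (hv : S.IsSolution 𝒜 a O v)
    (lam : ℂ) {x : Fin n → ℝ} (hx : x ∈ O) (u w : Fin n → ℝ) :
    fderiv ℝ (laxForm a v lam) x u w - fderiv ℝ (laxForm a v lam) x w u =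
      laxForm a v lam x w * laxForm a v lam x u - laxForm a v lam x u * laxForm a v lam x w := by
  have hvd : HasFDerivAt v (fderiv ℝ v x) x :=
    ((hv.contDiffOn.differentiableOn (by simp)).differentiableAt (hO.mem_nhds hx)).hasFDerivAt
  set D := fderiv ℝ v x with hD
  set α := linComb a with hα
  set θ := laxForm a v lam x with hθ
  have hder : ∀ u w, fderiv ℝ (laxForm a v lam) x u w = ⁅α w, D u⁆ := by
    intro u w
    have h1 : HasFDerivAt (fun y => laxForm a v lam y w) ((lieL (α w)).comp D) x := by
      have : (fun y => laxForm a v lam y w) = fun y => lam • α w + lieL (α w) (v y) := rfl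
      rw [this]
      exact ((lieL (α w)).hasFDerivAt.comp x hvd).const_add _
    have hd : DifferentiableAt ℝ (laxForm a v lam) x :=
      ((contDiffOn_laxForm a hv.contDiffOn lam).differentiableOn (by simp)).differentiableAt
        (hO.mem_nhds hx)
    have h2 : HasFDerivAt (fun y => laxForm a v lam y w)
        ((fderiv ℝ (laxForm a v lam) x).flip w) x := by
      refine (hd.hasFDerivAt.clm_apply (hasFDerivAt_const w x)).congr_fderiv ?_
      ext h; simp
    exact congrArg (fun L => L u) (h2.unique h1)
  rw [hder, hder, ← lie_def]
  -- both sides are bilinear, so it is enough to compare them on basis vectors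
  have key : ∀ i j : Fin n, ⁅a i, D (Pi.single j 1)⁆ - ⁅a j, D (Pi.single i 1)⁆ =
      ⁅lam • a i + ⁅a i, v x⁆, lam • a j + ⁅a j, v x⁆⁆ := by
    intro i j
    have hc : ⁅a i, a j⁆ = 0 := h𝒜.2 _ (ha.mem i) _ (ha.mem j)
    have e1 : ⁅lam • a i + ⁅a i, v x⁆, lam • a j + ⁅a j, v x⁆⁆ = ⁅⁅a i, v x⁆, ⁅a j, v x⁆⁆ := by
      rw [add_lie, lie_add, lie_add, smul_lie, lie_smul, hc, smul_lie, lie_smul,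
        lie_comm_of_lie_eq_zero hc, ← lie_skew (a j) ⁅a i, v x⁆, smul_zero, smul_zero, zero_add,
        smul_neg, neg_add_cancel_left]
    rw [e1]
    by_cases hij : i = j
    · subst hij; simp
    · exact hv.eqn x hx i j hij
  have step1 : ∀ i : Fin n, ∀ u, ⁅a i, D u⁆ - ⁅α u, D (Pi.single i 1)⁆ =
      ⁅lam • a i + ⁅a i, v x⁆, θ u⁆ := by
    intro i u
    have : (lieL (a i)).comp D - (lieL.flip (D (Pi.single i 1))).comp α =
        (lieL (lam • a i + ⁅a i, v x⁆)).comp θ := clm_pi_ext fun j => by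
      have := key i j
      simpa only [hα, hθ, sub_apply, ContinuousLinearMap.comp_apply,
        ContinuousLinearMap.flip_apply, lieL_apply, laxForm_apply, linComb_single] using this
    exact congrArg (fun L => L u) this
  have step2 : (lieL.flip (D u)).comp α - (lieL (α u)).comp D = (lieL.flip (θ u)).comp θ :=
    clm_pi_ext fun i => by
      simpa only [hα, hθ, sub_apply, ContinuousLinearMap.comp_apply,
        ContinuousLinearMap.flip_apply, lieL_apply, laxForm_apply, linComb_single] using step1 i u
  exact congrArg (fun L => L w) step2

lemma laxForm_mem_𝔤 (h𝒜 : S.IsAbelianIn 𝒜) (ha : S.IsOrthonormalBasis 𝒜 a)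
    {v : (Fin n → ℝ) → 𝔸} {x : Fin n → ℝ} (hv : v x ∈ S.𝔲₁) (lam : ℂ) (h : Fin n → ℝ) :
    laxForm a v lam x h ∈ S.𝔤 := by
  have h1 := h𝒜.1 (ha.linComb_mem h)
  rw [laxForm_apply]
  exact S.𝔤.add_mem (S.𝔤.smul_mem _ h1.1.1) (S.𝔤.lie_mem h1.1.1 hv.1.1)

variable [FiniteDimensional ℂ 𝔸]

/-- Solutions have frames. -/
lemma IsSolution.exists_frame (h𝒜 : S.IsAbelianIn 𝒜) (ha : S.IsOrthonormalBasis 𝒜 a)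
    {O : Set (Fin n → ℝ)} (hO : IsOpen O) (hs : StarConvex ℝ 0 O) {v : (Fin n → ℝ) → 𝔸}
    (hv : S.IsSolution 𝒜 a O v) : ∃ E : (Fin n → ℝ) → ℂ → 𝔸ˣ, S.IsFrame a O v E := by
  have : CompleteSpace 𝔸 := FiniteDimensional.complete ℂ 𝔸
  have hex := fun lam : ℂ => exists_flat_frame hO hs
    (contDiffOn_laxForm a (hv.contDiffOn.of_le (by simp)) lam)
    (fun x hx u w => hv.flat h𝒜 ha hO lam hx u w)
  choose P hP0 hP using hex
  refine ⟨fun x lam => P lam x, ⟨fun x hx lam => ?_, hP0, fun x hx lam =>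
    (hP lam x hx).differentiableAt, fun x hx lam i => ?_⟩⟩
  · refine frame_mem hs S.G S.isClosed_G (contDiffOn_laxForm a hv.contDiffOn lam).continuousOn
      (fun y hy h s => ?_) (hP0 lam) (hP lam) x hx
    exact (S.mem_𝔤 _).1 (laxForm_mem_𝔤 h𝒜 ha (hv.mem y hy) lam h) s
  · rw [pd, (hP lam x hx).fderiv]
    simp [laxForm_apply]

/-- For `λ = 0` a frame takes values in `U₀`. -/
lemma IsFrame.mem_U₀ (h𝒜 : S.IsAbelianIn 𝒜) (ha : S.IsOrthonormalBasis 𝒜 a)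
    {O : Set (Fin n → ℝ)} (hs : StarConvex ℝ 0 O) {v : (Fin n → ℝ) → 𝔸}
    (hvc : ContinuousOn v O) (hvm : ∀ x ∈ O, v x ∈ S.𝔲₁) {E : (Fin n → ℝ) → ℂ → 𝔸ˣ}
    (hE : S.IsFrame a O v E) : ∀ x ∈ O, E x 0 ∈ S.U₀ := by
  have : CompleteSpace 𝔸 := FiniteDimensional.complete ℂ 𝔸
  refine frame_mem hs S.U₀ S.isClosed_U₀ (θ := laxForm a v 0)
    (contDiffOn_zero.1 (contDiffOn_laxForm a (contDiffOn_zero.2 hvc) 0))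
    (fun y hy h s => ?_) (hE.init 0) (fun x hx => hE.hasFDerivAt hx 0)
  apply exp_mem_U₀
  rw [laxForm_apply, zero_smul, zero_add]
  exact lie_mem_𝔲₀_of_𝔲₁ (h𝒜.1 (ha.linComb_mem h)) (hvm y hy)

end SymmetricSpace

end Lax

/-! ### First order perturbation of linear equations -/

section Spectral

variable {A : Type*} [NormedRing A] [NormedAlgebra ℂ A]

/-- First order perturbation theory: if `Fλ` solves `F' = λ F m` with `Fλ(0) = 1`, then
`Fλ(1) = 1 + λ ∫ m + O(λ²)`. -/
lemma hasDerivAt_of_linear_ode_smul {m : ℝ → A} (hm : ContinuousOn m (Icc 0 1))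
    {F : ℂ → ℝ → A} {Y : ℝ → A} (hF0 : ∀ lam, F lam 0 = 1)
    (hF : ∀ lam, ∀ t ∈ Icc (0 : ℝ) 1, HasDerivAt (F lam) (lam • (F lam t * m t)) t)
    (hY0 : Y 0 = 0) (hY : ∀ t ∈ Icc (0 : ℝ) 1, HasDerivAt Y (m t) t) :
    HasDerivAt (fun lam => F lam 1) (Y 1) 0 := by
  obtain ⟨C, hC⟩ := isCompact_Icc.exists_bound_of_continuousOn hm
  have hC' : ∀ t ∈ Icc (0 : ℝ) 1, ‖m t‖ ≤ C + 1 := fun t ht => (hC t ht).trans (by linarith)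
  have hCpos : 0 < C + 1 :=
    lt_of_le_of_lt ((norm_nonneg _).trans (hC 0 (by simp))) (by linarith)
  set K := C + 1 with hK
  -- a uniform estimate of order `λ` for `Fλ - 1`
  have hg : ∀ lam : ℂ, ‖lam‖ ≤ 1 → ∀ t ∈ Icc (0 : ℝ) 1,
      ‖F lam t - 1‖ ≤ ‖lam‖ * (Real.exp K - 1) := by
    intro lam hl t ht
    have h1 := norm_le_gronwallBound_of_norm_deriv_right_le (f := fun t => F lam t - 1)
      (f' := fun t => lam • (F lam t * m t)) (δ := 0) (K := K) (ε := ‖lam‖ * K) (a := 0) (b := 1)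
      (fun s hs => ((hF lam s hs).sub_const 1).continuousAt.continuousWithinAt)
      (fun s hs => ((hF lam s ⟨hs.1, hs.2.le⟩).sub_const 1).hasDerivWithinAt)
      (by simp [hF0]) (fun s hs => ?_) t ht
    · refine h1.trans ?_
      rw [gronwallBound, if_neg hCpos.ne', zero_mul, zero_add, sub_zero,
        mul_div_assoc, div_self hCpos.ne', mul_one]
      gcongr
      nlinarith [ht.2]
    · have hms := hC' s ⟨hs.1, hs.2.le⟩
      have e : lam • (F lam s * m s) = lam • ((F lam s - 1) * m s) + lam • m s := by
        rw [← smul_add]; congr 1; noncomm_ring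
      rw [e]
      refine (norm_add_le _ _).trans ?_
      rw [norm_smul, norm_smul]
      have h2 : ‖(F lam s - 1) * m s‖ ≤ ‖F lam s - 1‖ * K := (norm_mul_le _ _).trans (by gcongr)
      have h3 : ‖lam‖ * ‖(F lam s - 1) * m s‖ ≤ 1 * (‖F lam s - 1‖ * K) := by gcongr
      have h4 : ‖lam‖ * ‖m s‖ ≤ ‖lam‖ * K := by gcongr
      linarith
  -- hence an estimate of order `λ²` for `Fλ - 1 - λ Y`
  have hD : ∀ lam : ℂ, ‖lam‖ ≤ 1 →
      ‖F lam 1 - 1 - lam • Y 1‖ ≤ ((Real.exp K - 1) * K) * ‖lam‖ ^ 2 := by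
    intro lam hl
    have hd : ∀ t ∈ Icc (0 : ℝ) 1, HasDerivWithinAt (fun t => F lam t - 1 - lam • Y t)
        (lam • ((F lam t - 1) * m t)) (Icc 0 1) t := by
      intro t ht
      have h1 := (((hF lam t ht).sub_const 1).sub ((hY t ht).const_smul lam)).hasDerivWithinAt
        (s := Icc 0 1)
      have e : lam • ((F lam t - 1) * m t) = lam • (F lam t * m t) - lam • m t := by
        rw [← smul_sub]; congr 1; noncomm_ring
      rw [e]; exact h1
    have h2 := norm_image_sub_le_of_norm_deriv_le_segment_01' hd
      (C := ((Real.exp K - 1) * K) * ‖lam‖ ^ 2) (fun s hs => ?_)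
    · simpa [hF0, hY0] using h2
    · have hs' : s ∈ Icc (0 : ℝ) 1 := ⟨hs.1, hs.2.le⟩
      have he : 0 ≤ Real.exp K - 1 := by linarith [Real.add_one_le_exp K]
      calc ‖lam • ((F lam s - 1) * m s)‖ ≤ ‖lam‖ * (‖F lam s - 1‖ * ‖m s‖) := by
            rw [norm_smul]; gcongr; exact norm_mul_le _ _
        _ ≤ ‖lam‖ * ((‖lam‖ * (Real.exp K - 1)) * K) := by
            gcongr
            · exact hg lam hl s hs'
            · exact hC' s hs'
        _ = _ := by ring
  -- for `λ = 0` the solution is constant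
  have hF00 : F 0 1 = 1 := by
    have := hg 0 (by simp) 1 (by simp)
    simpa [sub_eq_zero] using this
  rw [hasDerivAt_iff_isLittleO]
  refine Asymptotics.IsBigO.trans_isLittleO (g := fun lam : ℂ => ‖lam‖ ^ 2) ?_ ?_
  · refine Asymptotics.IsBigO.of_bound ((Real.exp K - 1) * K) ?_
    filter_upwards [Metric.closedBall_mem_nhds (0 : ℂ) one_pos] with lam hl
    rw [hF00]
    simpa using hD lam (by simpa using hl)
  · simp only [sub_zero]
    exact Asymptotics.isLittleO_norm_pow_id one_lt_two

end Spectral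

/-! ### The Sym formula -/

section SymMap

variable {𝔸 : Type*} [NormedRing 𝔸] [NormedAlgebra ℂ 𝔸] {n : ℕ}

/-- Conjugation by the unit `P`, as a continuous real linear map. -/
def conjL (P : 𝔸ˣ) : 𝔸 →L[ℝ] 𝔸 :=
  ((ContinuousLinearMap.mul ℝ 𝔸).flip (↑P⁻¹ : 𝔸)).comp (ContinuousLinearMap.mul ℝ 𝔸 (P : 𝔸))

lemma conjL_apply (P : 𝔸ˣ) (x : 𝔸) : conjL P x = (P : 𝔸) * x * (↑P⁻¹ : 𝔸) := rfl

lemma contDiffOn_conjL [CompleteSpace 𝔸] {E : Type*} [NormedAddCommGroup E] [NormedSpace ℝ E]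
    {O : Set E} {P : E → 𝔸ˣ} {k : WithTop ℕ∞} (hP : ContDiffOn ℝ k (fun y => (P y : 𝔸)) O) :
    ContDiffOn ℝ k (fun y => conjL (P y)) O := by
  have h1 : ContDiffOn ℝ k (fun y => ContinuousLinearMap.mul ℝ 𝔸 (P y : 𝔸)) O :=
    (ContinuousLinearMap.mul ℝ 𝔸).contDiff.comp_contDiffOn hP
  have h2 : ContDiffOn ℝ k (fun y => (ContinuousLinearMap.mul ℝ 𝔸).flip (↑(P y)⁻¹ : 𝔸)) O :=
    (ContinuousLinearMap.mul ℝ 𝔸).flip.contDiff.comp_contDiffOn (contDiffOn_units_inv hP)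
  exact h2.clm_comp h1

/-- The form `h ↦ P α(h) P⁻¹` with `α(h) = ∑ᵢ hᵢ aᵢ`. -/
def conjForm (a : Fin n → 𝔸) (P : 𝔸ˣ) : (Fin n → ℝ) →L[ℝ] 𝔸 := (conjL P).comp (linComb a)

lemma conjForm_apply (a : Fin n → 𝔸) (P : 𝔸ˣ) (h : Fin n → ℝ) :
    conjForm a P h = (P : 𝔸) * linComb a h * (↑P⁻¹ : 𝔸) := rfl

lemma contDiffOn_conjForm [CompleteSpace 𝔸] (a : Fin n → 𝔸) {O : Set (Fin n → ℝ)}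
    {P : (Fin n → ℝ) → 𝔸ˣ} {k : WithTop ℕ∞} (hP : ContDiffOn ℝ k (fun y => (P y : 𝔸)) O) :
    ContDiffOn ℝ k (fun y => conjForm a (P y)) O :=
  (contDiffOn_conjL hP).clm_comp contDiffOn_const

namespace SymmetricSpace

variable {S : SymmetricSpace 𝔸} {𝒜 : Submodule ℝ 𝔸} {a : Fin n → 𝔸}

lemma IsFrame.contDiffOn {O : Set (Fin n → ℝ)} (hO : IsOpen O) {v : (Fin n → ℝ) → 𝔸}
    (hv : ContDiffOn ℝ ∞ v O) {E : (Fin n → ℝ) → ℂ → 𝔸ˣ} (hE : S.IsFrame a O v E) (lam : ℂ) :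
    ContDiffOn ℝ ∞ (fun y => (E y lam : 𝔸)) O :=
  contDiffOn_of_frame hO (contDiffOn_laxForm a hv lam) fun _ hx => hE.hasFDerivAt hx lam

variable [FiniteDimensional ℂ 𝔸]

/-- The form `h ↦ E₀ α(h) E₀⁻¹` is closed. -/
lemma IsFrame.conjForm_symm (h𝒜 : S.IsAbelianIn 𝒜) (ha : S.IsOrthonormalBasis 𝒜 a)
    {O : Set (Fin n → ℝ)} (hO : IsOpen O) {v : (Fin n → ℝ) → 𝔸} (hv : ContDiffOn ℝ ∞ v O)
    {E : (Fin n → ℝ) → ℂ → 𝔸ˣ} (hE : S.IsFrame a O v E) {x : Fin n → ℝ} (hx : x ∈ O)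
    (u w : Fin n → ℝ) :
    fderiv ℝ (fun y => conjForm a (E y 0)) x u w = fderiv ℝ (fun y => conjForm a (E y 0)) x w u := by
  have : CompleteSpace 𝔸 := FiniteDimensional.complete ℂ 𝔸
  have hder : ∀ u w, fderiv ℝ (fun y => conjForm a (E y 0)) x u w =
      (E x 0 : 𝔸) * ⁅⁅linComb a u, v x⁆, linComb a w⁆ * (↑(E x 0)⁻¹ : 𝔸) := by
    intro u w
    have hd : DifferentiableAt ℝ (fun y => conjForm a (E y 0)) x :=
      ((contDiffOn_conjForm a (hE.contDiffOn hO hv 0)).differentiableOn (by simp)).differentiableAt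
        (hO.mem_nhds hx)
    have h2 : HasFDerivAt (fun y => conjForm a (E y 0) w)
        ((fderiv ℝ (fun y => conjForm a (E y 0)) x).flip w) x := by
      refine (hd.hasFDerivAt.clm_apply (hasFDerivAt_const w x)).congr_fderiv ?_
      ext h; simp
    have h1 := hasFDerivAt_frame_conj (hE.hasFDerivAt hx 0) (hasFDerivAt_const (linComb a w) x)
      (f' := (conjL (E x 0)).comp
        ((lieL.flip (linComb a w)).comp (laxForm a v 0 x))) (fun h => by simp [conjL_apply])
    have h3 := congrArg (fun L => L u) (h2.unique h1)
    rw [ContinuousLinearMap.flip_apply] at h3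
    rw [h3]
    simp [-lie_lie, laxForm_apply, conjL_apply]
  rw [hder, hder]
  congr 2
  have hc : ⁅linComb a u, linComb a w⁆ = 0 := h𝒜.2 _ (ha.linComb_mem u) _ (ha.linComb_mem w)
  rw [← lie_skew, ← lie_skew _ (linComb a u), lie_comm_of_lie_eq_zero hc]

/-- The Sym formula: on a convex domain `Y = (∂E/∂λ) E⁻¹` at `λ = 0` exists and is the primitive
of `h ↦ E₀ α(h) E₀⁻¹` that vanishes at `0`. -/
lemma IsFrame.symMap (h𝒜 : S.IsAbelianIn 𝒜) (ha : S.IsOrthonormalBasis 𝒜 a)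
    {O : Set (Fin n → ℝ)} (hO : IsOpen O) (hconv : Convex ℝ O) (h0 : 0 ∈ O)
    {v : (Fin n → ℝ) → 𝔸} (hv : ContDiffOn ℝ ∞ v O) {E : (Fin n → ℝ) → ℂ → 𝔸ˣ}
    (hE : S.IsFrame a O v E) :
    (∀ x ∈ O, DifferentiableAt ℂ (fun lam : ℂ => (E x lam : 𝔸)) 0) ∧
    CurvedFlats.symMap E 0 = 0 ∧
    ∀ x ∈ O, HasFDerivAt (CurvedFlats.symMap E) (conjForm a (E x 0)) x := by
  have : CompleteSpace 𝔸 := FiniteDimensional.complete ℂ 𝔸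
  have hc := contDiffOn_conjForm a (hE.contDiffOn hO hv 0)
  obtain ⟨Y', hY'⟩ := hconv.exists_forall_hasFDerivAt_of_fderiv_symmetric hO
    (hc.differentiableOn (by simp)) (fun x hx u w => hE.conjForm_symm h𝒜 ha hO hv hx u w)
  set Y := fun x => Y' x - Y' 0 with hYdef
  have hY : ∀ x ∈ O, HasFDerivAt Y (conjForm a (E x 0)) x := fun x hx => (hY' x hx).sub_const _
  have hs : StarConvex ℝ 0 O := hconv.starConvex h0
  have key : ∀ x ∈ O, HasDerivAt (fun lam : ℂ => (E x lam : 𝔸)) (Y x * E x 0) 0 := by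
    intro x hx
    have hmem : ∀ t ∈ Icc (0 : ℝ) 1, t • x ∈ O := fun t ht => hs.smul_mem hx ht.1 ht.2
    have h1 := hasDerivAt_of_linear_ode_smul (m := fun t => conjForm a (E (t • x) 0) x)
      (F := fun lam t => (E (t • x) lam : 𝔸) * (↑(E (t • x) 0)⁻¹ : 𝔸)) (Y := fun t => Y (t • x))
      ((hc.continuousOn.comp (by fun_prop) hmem).clm_apply continuousOn_const)
      (fun lam => by simp [hE.init]) (fun lam t ht => ?_) (by simp [hYdef])
      (fun t ht => hasDerivAt_comp_ray (hY _ (hmem t ht)))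
    · have h2 := h1.mul_const (E x 0 : 𝔸)
      simpa [mul_assoc] using h2
    · have h3 := hasDerivAt_comp_ray ((hE.hasFDerivAt (hmem t ht) lam).mul'
        (hasFDerivAt_frame_inv (hE.hasFDerivAt (hmem t ht) 0)))
      refine h3.congr_deriv ?_
      simp [laxForm_apply, conjForm_apply, mul_add, mul_assoc]
  have heq : ∀ x ∈ O, CurvedFlats.symMap E x = Y x := fun x hx => by
    rw [CurvedFlats.symMap, (key x hx).deriv]; simp [mul_assoc]
  refine ⟨fun x hx => (key x hx).differentiableAt, by rw [heq 0 h0]; simp [hYdef], fun x hx => ?_⟩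
  exact (hY x hx).congr_of_eventuallyEq (eventually_of_mem (hO.mem_nhds hx) heq)

end SymmetricSpace

end SymMap

/-! ### Curved flats from frames -/

section CurvedFlat

variable {𝔸 : Type*} [NormedRing 𝔸] [NormedAlgebra ℂ 𝔸] {n : ℕ}

/-- Metrics with constant coefficients are flat. -/
lemma riemann_eq_zero_of_const {m : ℕ} {g : (Fin m → ℝ) → Matrix (Fin m) (Fin m) ℝ}
    {c : Matrix (Fin m) (Fin m) ℝ} (hg : ∀ w, g w = c) (l k i j : Fin m) (w : Fin m → ℝ) :
    riemann g l k i j w = 0 := by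
  have h : ∀ l i j, christoffel g l i j = fun _ => 0 := fun l i j => by
    ext w; simp [christoffel, pd, hg]
  simp [riemann, h, pd]

namespace SymmetricSpace

variable {S : SymmetricSpace 𝔸} {𝒜 : Submodule ℝ 𝔸} {a : Fin n → 𝔸}

/-- Conjugation by an element of `U₀` preserves abelian subspaces. -/
lemma IsAbelianIn.comap_conj [CompleteSpace 𝔸] (h𝒜 : S.IsAbelianIn 𝒜) {k : 𝔸ˣ} (hk : k ∈ S.U₀) :
    S.IsAbelianIn (𝒜.comap (conjL k : 𝔸 →ₗ[ℝ] 𝔸)) := by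
  have hk' := S.U₀.inv_mem hk
  have hinv : ∀ y : 𝔸, (↑k⁻¹ : 𝔸) * y * k = (↑k⁻¹ : 𝔸) * y * (↑(k⁻¹)⁻¹ : 𝔸) := by simp
  refine ⟨fun x hx => ?_, fun x hx z hz => ?_⟩
  · have hx' : (k : 𝔸) * x * (↑k⁻¹ : 𝔸) ∈ 𝒜 := hx
    rw [← conj_inv_conj k x, hinv]
    exact conj_mem_𝔲₁ hk' (h𝒜.1 hx')
  · have e : ⁅(k : 𝔸) * x * (↑k⁻¹ : 𝔸), (k : 𝔸) * z * (↑k⁻¹ : 𝔸)⁆ = 0 := h𝒜.2 _ hx _ hz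
    rw [← conj_inv_conj k x, ← conj_inv_conj k z, hinv, hinv, ← conj_lie, e, mul_zero, zero_mul]

/-- Conjugation by an element of `U₀` preserves maximal abelian subspaces. -/
lemma IsMaxAbelian.conj [CompleteSpace 𝔸] (h𝒜 : S.IsMaxAbelian 𝒜) {k : 𝔸ˣ} (hk : k ∈ S.U₀)
    {𝒯 : Submodule ℝ 𝔸} (h : ∀ y, y ∈ 𝒯 ↔ (↑k⁻¹ : 𝔸) * y * k ∈ 𝒜) : S.IsMaxAbelian 𝒯 := by
  have e : 𝒯 = 𝒜.comap (conjL k⁻¹ : 𝔸 →ₗ[ℝ] 𝔸) := by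
    ext y
    rw [h, Submodule.mem_comap, ContinuousLinearMap.coe_coe, conjL_apply, inv_inv]
  refine ⟨e ▸ h𝒜.1.comap_conj (S.U₀.inv_mem hk),
    fun 𝒜' h𝒜' hle => le_antisymm (fun y hy => ?_) hle⟩
  have e' := h𝒜.2 _ (h𝒜'.comap_conj hk) fun x hx => by
    rw [Submodule.mem_comap, ContinuousLinearMap.coe_coe, conjL_apply]
    apply hle
    rwa [h, conj_inv_conj]
  rw [h, ← e', Submodule.mem_comap, ContinuousLinearMap.coe_coe, conjL_apply, conj_conj_inv]
  exact hy

variable [FiniteDimensional ℂ 𝔸]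

/-- The map `Y` of a global frame is a curved flat. -/
theorem IsFrame.curvedFlat (h𝒜 : S.IsMaxAbelian 𝒜) (ha : S.IsOrthonormalBasis 𝒜 a)
    {v : (Fin n → ℝ) → 𝔸} (hv : S.IsSolution 𝒜 a univ v) {E : (Fin n → ℝ) → ℂ → 𝔸ˣ}
    (hE : S.IsFrame a univ v E) :
    (∀ x, DifferentiableAt ℂ (fun lam : ℂ => (E x lam : 𝔸)) 0) ∧
      S.IsImmersion univ (CurvedFlats.symMap E) ∧ S.IsFlat univ (CurvedFlats.symMap E) ∧
      S.HasMaxAbelianTangent univ (CurvedFlats.symMap E) := by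
  have : CompleteSpace 𝔸 := FiniteDimensional.complete ℂ 𝔸
  obtain ⟨h1, h2, h3⟩ := hE.symMap h𝒜.1 ha isOpen_univ convex_univ (mem_univ 0) hv.contDiffOn
  have hU : ∀ x, E x 0 ∈ S.U₀ := fun x =>
    hE.mem_U₀ h𝒜.1 ha (starConvex_univ 0) hv.contDiffOn.continuousOn hv.mem x (mem_univ x)
  have hfd : ∀ x, fderiv ℝ (CurvedFlats.symMap E) x = conjForm a (E x 0) :=
    fun x => (h3 x (mem_univ x)).fderiv
  have hα : ∀ h, linComb a h ∈ S.𝔲₁ := fun h => h𝒜.1.1 (ha.linComb_mem h)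
  refine ⟨fun x => h1 x (mem_univ x), ⟨?_, fun x hx => ?_, fun x _ => ?_⟩, fun w _ l k i j => ?_,
    fun x _ => ?_⟩
  · rw [contDiffOn_infty_iff_fderiv_of_isOpen isOpen_univ]
    refine ⟨fun x hx => (h3 x hx).differentiableAt.differentiableWithinAt, ?_⟩
    rw [funext hfd]
    exact contDiffOn_conjForm a (hE.contDiffOn isOpen_univ hv.contDiffOn 0)
  · refine mem_of_fderiv_mem (starConvex_univ 0) S.𝔲₁ h3 (fun y _ h => ?_) ?_ x hx
    · exact conj_mem_𝔲₁ (hU y) (hα h)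
    · rw [h2]; exact S.𝔲₁.zero_mem
  · rw [hfd]
    intro h h' e
    apply ha.linComb_injective
    rw [← conj_inv_conj (E x 0) (linComb a h), ← conj_inv_conj (E x 0) (linComb a h')]
    exact congrArg (fun y => (↑(E x 0)⁻¹ : 𝔸) * y * (E x 0 : 𝔸)) e
  · refine riemann_eq_zero_of_const (c := 1) (fun w => ?_) l k i j w
    ext i j
    rw [firstForm, Matrix.of_apply, pd, pd, hfd, conjForm_apply, conjForm_apply,
      S.B_Ad _ (hU w) _ (hα _) _ (hα _), linComb_single, linComb_single, ha.1, Matrix.one_apply]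
  · refine h𝒜.conj (hU x) fun y => ?_
    rw [tangentSpace, hfd, LinearMap.mem_range]
    constructor
    · rintro ⟨h, rfl⟩
      rw [ContinuousLinearMap.coe_coe, conjForm_apply, conj_inv_conj]
      exact ha.linComb_mem h
    · intro hy
      rw [← ha.2, ← range_linComb] at hy
      obtain ⟨h, hh⟩ := hy
      refine ⟨h, ?_⟩
      rw [ContinuousLinearMap.coe_coe] at hh ⊢
      rw [conjForm_apply, hh, conj_conj_inv]

end SymmetricSpace

end CurvedFlat

/-! ### Algebra of the tangent spaces -/

section Pointwise

variable {𝔸 : Type*} [NormedRing 𝔸] [NormedAlgebra ℂ 𝔸] {m : ℕ}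

namespace SymmetricSpace

variable {S : SymmetricSpace 𝔸}

/-- The brackets of `𝔲₀` with an abelian subspace of `𝔲₁` are orthogonal to that subspace. -/
lemma B_lie_abelian {F q q' : 𝔸} (hF : F ∈ S.𝔲₀) (hq : q ∈ S.𝔲₁) (hq' : q' ∈ S.𝔲₁)
    (h : ⁅q, q'⁆ = 0) : S.B ⁅F, q⁆ q' = 0 := by
  rw [S.B_ad _ (𝔲₀_le_𝔲 hF) _ (𝔲₁_le_𝔲 hq) _ (𝔲₁_le_𝔲 hq'), h, map_zero]

/-- Elements of `𝔲₀` act by skew operators, so one that preserves an abelian subspace of `𝔲₁`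
centralizes it. -/
lemma lie_eq_zero_of_lie_mem {T : Submodule ℝ 𝔸} (hT : S.IsAbelianIn T) {F : 𝔸} (hF : F ∈ S.𝔲₀)
    (h : ∀ q ∈ T, ⁅F, q⁆ ∈ T) {q : 𝔸} (hq : q ∈ T) : ⁅F, q⁆ = 0 := by
  rw [← S.B_self_eq_zero (hT.1 (h q hq))]
  exact B_lie_abelian hF (hT.1 hq) (hT.1 (h q hq)) (hT.2 _ hq _ (h q hq))

/-- An element of `𝔲₀` that commutes with `p` commutes with the centralizer of `p` in `𝔲₁`, if
this centralizer is abelian. -/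
lemma lie_eq_zero_of_lie_centralizer₁ {T : Submodule ℝ 𝔸} (hT : S.IsAbelianIn T) {p : 𝔸}
    (hpT : S.centralizer₁ p = T) {F : 𝔸} (hF : F ∈ S.𝔲₀) (h : ⁅p, F⁆ = 0) {q : 𝔸}
    (hq : q ∈ T) : ⁅F, q⁆ = 0 := by
  refine lie_eq_zero_of_lie_mem hT hF (fun q hq => ?_) hq
  rw [← hpT] at hq ⊢
  have hpq : ⁅p, q⁆ = 0 := hq.2
  rw [mem_centralizer₁, lie_comm_of_lie_eq_zero h, hpq, lie_zero]
  exact ⟨lie_mem_𝔲₁ hF hq.1, rfl⟩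

/-- If `a` and `b` commute and `z` commutes with both, then `[[a, V], [b, V]]` is orthogonal
to `z`. -/
lemma B_lie_lie_lie_eq_zero {a b V z : 𝔸} (ha : a ∈ S.𝔲₁) (hb : b ∈ S.𝔲₁) (hV : V ∈ S.𝔲₁)
    (hz : z ∈ S.𝔲₀) (hab : ⁅a, b⁆ = 0) (haz : ⁅a, z⁆ = 0) (hbz : ⁅b, z⁆ = 0) :
    S.B ⁅⁅a, V⁆, ⁅b, V⁆⁆ z = 0 := by
  have key : ∀ {a b : 𝔸}, a ∈ S.𝔲₁ → b ∈ S.𝔲₁ → ⁅b, z⁆ = 0 →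
      S.B ⁅⁅a, V⁆, ⁅b, V⁆⁆ z = -S.B ⁅b, ⁅a, V⁆⁆ ⁅V, z⁆ := by
    intro a b ha hb hbz
    have haV := 𝔲₀_le_𝔲 (lie_mem_𝔲₀_of_𝔲₁ ha hV)
    rw [S.B_ad _ haV _ (𝔲₀_le_𝔲 (lie_mem_𝔲₀_of_𝔲₁ hb hV)) _ (𝔲₀_le_𝔲 hz),
      S.B_lie_left (𝔲₁_le_𝔲 hb) haV (𝔲₁_le_𝔲 (lie_mem_𝔲₁' hV hz)), neg_neg, leibniz_lie b V z, hbz,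
      lie_zero, add_zero]
  have h1 := key ha hb hbz
  have h2 := key hb ha haz
  rw [lie_comm_of_lie_eq_zero hab, ← h1, ← lie_skew, map_neg, LinearMap.neg_apply] at h2
  linarith

lemma sum_mem_range (D : (Fin m → ℝ) →L[ℝ] 𝔸) (x : 𝔸) :
    ∑ i, S.B x (D (Pi.single i 1)) • D (Pi.single i 1) ∈
      LinearMap.range (D : (Fin m → ℝ) →ₗ[ℝ] 𝔸) :=
  Submodule.sum_mem _ fun _ _ => Submodule.smul_mem _ _ ⟨_, rfl⟩

variable [FiniteDimensional ℂ 𝔸]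

/-- `𝔲₀` is the sum of the centralizer of `p` in `𝔲₀` and of `[p, 𝔲₁]`. -/
lemma exists_add_lie {p : 𝔸} (hp : p ∈ S.𝔲₁) {z : 𝔸} (hz : z ∈ S.𝔲₀) :
    ∃ y ∈ S.𝔲₁, ⁅p, z - ⁅p, y⁆⁆ = 0 := by
  obtain ⟨c, hc, y, hy, e⟩ := S.exists_add_lie_lie hp (lie_mem_𝔲₁' hp hz)
  refine ⟨y, hy, ?_⟩
  have e' : ⁅p, z - ⁅p, y⁆⁆ = c := by rw [lie_sub, e]; abel
  have hz' : z - ⁅p, y⁆ ∈ S.𝔲₀ := S.𝔲₀.sub_mem hz (lie_mem_𝔲₀_of_𝔲₁ hp hy)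
  rw [e', ← S.B_self_eq_zero hc.1]
  nth_rewrite 1 [← e']
  have hpc : ⁅p, c⁆ = 0 := hc.2
  rw [S.B_lie_left (𝔲₁_le_𝔲 hp) (𝔲₀_le_𝔲 hz') (𝔲₁_le_𝔲 hc.1), hpc, map_zero, neg_zero]

/-- Criterion for the vanishing of an element of `𝔲₀`: it preserves a maximal abelian subspace `T`
and is orthogonal to the centralizer of `T` in `𝔲₀`. -/
lemma eq_zero_of_lie_mem {T : Submodule ℝ 𝔸} (hT : S.IsAbelianIn T) {p : 𝔸}
    (hpT : S.centralizer₁ p = T) (hp : p ∈ T) {F : 𝔸} (hF : F ∈ S.𝔲₀)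
    (h : ∀ q ∈ T, ⁅F, q⁆ ∈ T)
    (horth : ∀ z ∈ S.𝔲₀, (∀ q ∈ T, ⁅q, z⁆ = 0) → S.B F z = 0) : F = 0 := by
  have : CompleteSpace 𝔸 := FiniteDimensional.complete ℂ 𝔸
  have hp₁ := hT.1 hp
  refine S.B_nondegenerate F (𝔲₀_le_𝔲 hF) fun Y hY => ?_
  obtain ⟨z, hz, x, hx, rfl⟩ := exists_add_of_mem_𝔲 hY
  obtain ⟨y, hy, hyz⟩ := exists_add_lie hp₁ hz
  have hz' : z - ⁅p, y⁆ ∈ S.𝔲₀ := S.𝔲₀.sub_mem hz (lie_mem_𝔲₀_of_𝔲₁ hp₁ hy)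
  have h1 : S.B F (z - ⁅p, y⁆) = 0 := horth _ hz' fun q hq =>
    lie_eq_zero_symm.1 (lie_eq_zero_of_lie_centralizer₁ hT hpT hz' hyz hq)
  have h2 : S.B F ⁅p, y⁆ = 0 := by
    rw [← S.B_ad _ (𝔲₀_le_𝔲 hF) _ (𝔲₁_le_𝔲 hp₁) _ (𝔲₁_le_𝔲 hy),
      lie_eq_zero_of_lie_mem hT hF h hp, map_zero, LinearMap.zero_apply]
  rw [map_add, S.B_orthogonal F hF x hx, add_zero, ← sub_add_cancel z ⁅p, y⁆, map_add, h1, h2,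
    add_zero]

variable (S) in
/-- The operator `x ↦ [p, [p, πx]] + ∑ᵢ B(πx, uᵢ) uᵢ + (x - πx)`, where `uᵢ` are the values of `D`
on the standard basis.  For a projection `π` onto `𝔲₁`, its restriction to `𝔲₁` is the sum of
`ad(p)²` and a positive operator with image in the range of `D`. -/
def tangentOp (π : 𝔸 →L[ℝ] 𝔸) (D : (Fin m → ℝ) →L[ℝ] 𝔸) (p : 𝔸) : 𝔸 →L[ℝ] 𝔸 :=
  LinearMap.toContinuousLinearMap
    ((adℝ p ∘ₗ adℝ p ∘ₗ (π : 𝔸 →ₗ[ℝ] 𝔸)) +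
      ∑ i, ((S.B.flip (D (Pi.single i 1))) ∘ₗ (π : 𝔸 →ₗ[ℝ] 𝔸)).smulRight (D (Pi.single i 1)) +
      (LinearMap.id - (π : 𝔸 →ₗ[ℝ] 𝔸)))

lemma tangentOp_apply (π : 𝔸 →L[ℝ] 𝔸) (D : (Fin m → ℝ) →L[ℝ] 𝔸) (p x : 𝔸) :
    S.tangentOp π D p x = ⁅p, ⁅p, π x⁆⁆ +
      ∑ i, S.B (π x) (D (Pi.single i 1)) • D (Pi.single i 1) + (x - π x) := by
  simp [tangentOp, -lie_lie, adℝ_apply]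

variable {π : 𝔸 →L[ℝ] 𝔸} {D : (Fin m → ℝ) →L[ℝ] 𝔸} {p : 𝔸}

lemma mem_of_tangentOp_mem (hπ : ∀ x, π x ∈ S.𝔲₁)
    (hT : LinearMap.range (D : (Fin m → ℝ) →ₗ[ℝ] 𝔸) ≤ S.𝔲₁) (hp : p ∈ S.𝔲₁) {x : 𝔸}
    (h : S.tangentOp π D p x ∈ S.𝔲₁) : x ∈ S.𝔲₁ := by
  rw [tangentOp_apply] at h
  have h1 := (S.𝔲₁.add_mem_iff_right (S.𝔲₁.add_mem (S.lie_lie_mem hp hp (hπ x))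
    (hT (sum_mem_range (S := S) D (π x))))).1 h
  exact (S.𝔲₁.sub_mem_iff_left (hπ x)).1 h1

lemma tangentOp_injective (hπ : ∀ x, π x ∈ S.𝔲₁) (hπ' : ∀ x ∈ S.𝔲₁, π x = x)
    (hT : S.IsAbelianIn (LinearMap.range (D : (Fin m → ℝ) →ₗ[ℝ] 𝔸)))
    (hp : p ∈ LinearMap.range (D : (Fin m → ℝ) →ₗ[ℝ] 𝔸))
    (hpT : S.centralizer₁ p = LinearMap.range (D : (Fin m → ℝ) →ₗ[ℝ] 𝔸)) :
    Function.Injective (S.tangentOp π D p) := by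
  rw [injective_iff_map_eq_zero]
  intro x hx0
  have hp₁ := hT.1 hp
  have hx : x ∈ S.𝔲₁ := mem_of_tangentOp_mem hπ hT.1 hp₁ (by rw [hx0]; exact S.𝔲₁.zero_mem)
  rw [tangentOp_apply, hπ' x hx, sub_self, add_zero] at hx0
  set Q := ∑ i, S.B x (D (Pi.single i 1)) • D (Pi.single i 1) with hQ
  have hQm : Q ∈ LinearMap.range (D : (Fin m → ℝ) →ₗ[ℝ] 𝔸) := sum_mem_range D x
  have hpQ : ⁅p, Q⁆ = 0 := hT.2 _ hp _ hQm
  -- the two summands of the operator are orthogonal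
  have hQ0 : Q = 0 := by
    rw [← S.B_self_eq_zero (hT.1 hQm)]
    nth_rewrite 1 [eq_neg_of_add_eq_zero_right hx0]
    rw [map_neg, LinearMap.neg_apply, S.B_lie_lie hp₁ hx (hT.1 hQm), hpQ, lie_zero, map_zero,
      neg_zero]
  rw [hQ0, add_zero] at hx0
  have hxT : x ∈ LinearMap.range (D : (Fin m → ℝ) →ₗ[ℝ] 𝔸) := by
    rw [← hpT]
    exact ⟨hx, S.lie_eq_zero_of_lie_lie_eq_zero hp₁ hx hx0⟩
  have hsum : ∑ i, S.B x (D (Pi.single i 1)) * S.B x (D (Pi.single i 1)) = 0 := by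
    have := congrArg (S.B x) hQ0
    rw [hQ, map_sum, map_zero] at this
    simpa using this
  have hz : ∀ i, S.B x (D (Pi.single i 1)) = 0 := fun i =>
    mul_self_eq_zero.1 ((Finset.sum_eq_zero_iff_of_nonneg fun j _ => mul_self_nonneg _).1 hsum i
      (Finset.mem_univ i))
  obtain ⟨h, hh⟩ := hxT
  rw [← S.B_self_eq_zero hx]
  have : (LinearMap.toContinuousLinearMap (S.B x)).comp D = 0 := clm_pi_ext fun i => hz i
  have := congrArg (fun L => L h) this
  rw [← hh] at this ⊢
  exact this

/-- The injectivity of the operator forces the centralizer of `p` to be the range of `D`. -/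
lemma centralizer₁_eq_range (hπ' : ∀ x ∈ S.𝔲₁, π x = x)
    (hT : S.IsAbelianIn (LinearMap.range (D : (Fin m → ℝ) →ₗ[ℝ] 𝔸)))
    (hp : p ∈ LinearMap.range (D : (Fin m → ℝ) →ₗ[ℝ] 𝔸))
    (hinj : Function.Injective (S.tangentOp π D p)) :
    S.centralizer₁ p = LinearMap.range (D : (Fin m → ℝ) →ₗ[ℝ] 𝔸) := by
  set T := LinearMap.range (D : (Fin m → ℝ) →ₗ[ℝ] 𝔸) with hTdef
  have hle : T ≤ S.centralizer₁ p := fun x hx => ⟨hT.1 hx, hT.2 _ hp _ hx⟩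
  have hval : ∀ x ∈ S.centralizer₁ p, S.tangentOp π D p x ∈ T := by
    intro x hx
    have h0 : ⁅p, x⁆ = 0 := hx.2
    rw [tangentOp_apply, hπ' x hx.1, h0, lie_zero, zero_add, sub_self, add_zero]
    exact sum_mem_range D x
  refine le_antisymm (fun x hx => ?_) hle
  let R : T →ₗ[ℝ] T := (S.tangentOp π D p : 𝔸 →ₗ[ℝ] 𝔸).restrict fun y hy => hval y (hle hy)
  have hR : Function.Injective R := fun y y' e => Subtype.ext (hinj (congrArg Subtype.val e))
  obtain ⟨y, hy⟩ := LinearMap.surjective_of_injective hR ⟨_, hval x hx⟩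
  have : (y : 𝔸) = x := hinj (congrArg Subtype.val hy)
  rw [← this]
  exact y.2

end SymmetricSpace

end Pointwise

/-! ### Potentials of submanifolds with abelian tangent spaces -/

section Potential

variable {𝔸 : Type*} [NormedRing 𝔸] [NormedAlgebra ℂ 𝔸] {m : ℕ}

/-- The derivative of a function with values in a subspace takes values in that subspace (including
the junk value `0`). -/
lemma fderiv_mem_of_forall_mem {E F : Type*} [NormedAddCommGroup E] [NormedSpace ℝ E]
    [NormedAddCommGroup F] [NormedSpace ℝ F] [FiniteDimensional ℝ F] (V : Submodule ℝ F)
    {O : Set E} (hO : IsOpen O) {f : E → F} (hf : ∀ x ∈ O, f x ∈ V) {x : E} (hx : x ∈ O) (h : E) :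
    fderiv ℝ f x h ∈ V := by
  by_cases hd : DifferentiableAt ℝ f x
  · rw [← Subspace.forall_mem_dualAnnihilator_apply_eq_zero_iff]
    intro φ hφ
    rw [Submodule.mem_dualAnnihilator] at hφ
    have h1 := (LinearMap.toContinuousLinearMap φ).hasFDerivAt.comp x hd.hasFDerivAt
    have h2 : HasFDerivAt (LinearMap.toContinuousLinearMap φ ∘ f) (0 : E →L[ℝ] ℝ) x :=
      (hasFDerivAt_const (0 : ℝ) x).congr_of_eventuallyEq
        (eventually_of_mem (hO.mem_nhds hx) fun y hy => hφ _ (hf y hy))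
    exact congrArg (fun L => L h) (h1.unique h2)
  · rw [fderiv_zero_of_not_differentiableAt hd]
    exact V.zero_mem

/-- The Leibniz rule for the bracket. -/
lemma hasFDerivAt_lie {E : Type*} [NormedAddCommGroup E] [NormedSpace ℝ E] {f g : E → 𝔸}
    {f' g' : E →L[ℝ] 𝔸} {x : E} (hf : HasFDerivAt f f' x) (hg : HasFDerivAt g g' x) :
    HasFDerivAt (fun y => ⁅f y, g y⁆) ((lieL (f x)).comp g' + (lieL.flip (g x)).comp f') x :=
  ((lieL.hasFDerivAt.comp x hf).clm_apply hg).congr_fderiv (by ext h; simp [-lie_lie])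

lemma contDiffOn_lie {E : Type*} [NormedAddCommGroup E] [NormedSpace ℝ E] {O : Set E}
    {f g : E → 𝔸} {k : WithTop ℕ∞} (hf : ContDiffOn ℝ k f O) (hg : ContDiffOn ℝ k g O) :
    ContDiffOn ℝ k (fun y => ⁅f y, g y⁆) O := by
  have h : ContDiffOn ℝ k (fun y => lieL (f y)) O := (lieL (𝔸 := 𝔸)).contDiff.comp_contDiffOn hf
  exact h.clm_apply hg

namespace SymmetricSpace

variable (S : SymmetricSpace 𝔸)

/-- `V` is a potential on `O` for the map `X` with abelian tangent spaces: in the direction `c`, for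
which `p = ∂_c X` has the tangent space as its centralizer, the connection `∂_ξ - ad [∂_ξ X, V]`
maps `p` to a tangent vector. -/
structure IsPotential (O : Set (Fin m → ℝ)) (X V : (Fin m → ℝ) → 𝔸) (c : Fin m → ℝ) : Prop where
  isOpen : IsOpen O
  contDiffOn_map : ContDiffOn ℝ ∞ X O
  contDiffOn : ContDiffOn ℝ ∞ V O
  mem : ∀ x ∈ O, V x ∈ S.𝔲₁
  abelian : ∀ x ∈ O, S.IsAbelianIn (tangentSpace X x)
  centralizer₁_eq : ∀ x ∈ O, S.centralizer₁ (fderiv ℝ X x c) = tangentSpace X x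
  second_deriv_mem : ∀ x ∈ O, fderiv ℝ (fderiv ℝ X) x c c - ⁅⁅fderiv ℝ X x c, V x⁆, fderiv ℝ X x c⁆ ∈
    tangentSpace X x

lemma fderiv_mem_tangentSpace (X : (Fin m → ℝ) → 𝔸) (x h : Fin m → ℝ) :
    fderiv ℝ X x h ∈ tangentSpace X x := ⟨h, rfl⟩

section Exists

variable [FiniteDimensional ℂ 𝔸]

/-- A linear projection onto `𝔲₁`. -/
lemma exists_projection : ∃ π : 𝔸 →L[ℝ] 𝔸, (∀ x, π x ∈ S.𝔲₁) ∧ ∀ x ∈ S.𝔲₁, π x = x := by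
  obtain ⟨g, hg⟩ := LinearMap.exists_extend (LinearMap.id : S.𝔲₁ →ₗ[ℝ] S.𝔲₁)
  refine ⟨LinearMap.toContinuousLinearMap (S.𝔲₁.subtype ∘ₗ g), fun x => (g x).2, fun x hx => ?_⟩
  exact congrArg Subtype.val (congrArg (fun L => L ⟨x, hx⟩) hg)

variable {S}

/-- Submanifolds with maximal abelian tangent spaces locally admit potentials: `-V` is the preimage of
`∂_c ∂_c X` under the invertible operator `tangentOp`, which differs from `ad(p)²` on `𝔲₁` by an
operator with tangent values. -/
lemma exists_isPotential {W : Set (Fin m → ℝ)} {X : (Fin m → ℝ) → 𝔸} (hW : IsOpen W)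
    (hX : ContDiffOn ℝ ∞ X W) (hT : S.HasMaxAbelianTangent W X) {w₀ : Fin m → ℝ} (hw₀ : w₀ ∈ W) :
    ∃ O ⊆ W, w₀ ∈ O ∧ ∃ V c, S.IsPotential O X V c := by
  have : CompleteSpace 𝔸 := FiniteDimensional.complete ℂ 𝔸
  obtain ⟨π, hπ, hπ'⟩ := S.exists_projection
  obtain ⟨p₀, ⟨c, rfl⟩, hp⟩ := S.exists_centralizer₁_eq (hT w₀ hw₀)
  have hD : ContDiffOn ℝ ∞ (fderiv ℝ X) W :=
    ((contDiffOn_infty_iff_fderiv_of_isOpen hW).1 hX).2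
  have hDD : ContDiffOn ℝ ∞ (fderiv ℝ (fderiv ℝ X)) W :=
    ((contDiffOn_infty_iff_fderiv_of_isOpen hW).1 hD).2
  have hDa : ∀ h, ContDiffOn ℝ ∞ (fun x => fderiv ℝ X x h) W := fun h =>
    hD.clm_apply contDiffOn_const
  set L : (Fin m → ℝ) → 𝔸 →L[ℝ] 𝔸 := fun x => S.tangentOp π (fderiv ℝ X x) (fderiv ℝ X x c)
    with hL
  have hLs : ContDiffOn ℝ ∞ L W := by
    rw [contDiffOn_clm_apply]
    intro y
    simp only [hL, tangentOp_apply]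
    refine ((contDiffOn_lie (hDa c) (contDiffOn_lie (hDa c) contDiffOn_const)).add
      (ContDiffOn.sum fun i _ => ?_)).add contDiffOn_const
    have hB : ContDiffOn ℝ ∞ (fun x => S.B (π y) (fderiv ℝ X x (Pi.single i 1))) W :=
      (LinearMap.toContinuousLinearMap (S.B (π y))).contDiff.comp_contDiffOn (hDa _)
    exact hB.smul (hDa _)
  set O : Set (Fin m → ℝ) := W ∩ L ⁻¹' {A | IsUnit A} with hO
  have hOo : IsOpen O := hLs.continuousOn.isOpen_inter_preimage hW Units.isOpen
  have hOW : O ⊆ W := inter_subset_left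
  have hinj : ∀ x ∈ O, Function.Injective (L x) := fun x hx =>
    (ContinuousLinearMap.isUnit_iff_bijective.1 hx.2).1
  have hab : ∀ x ∈ O, S.IsAbelianIn (tangentSpace X x) := fun x hx => (hT x hx.1).1
  set V : (Fin m → ℝ) → 𝔸 := fun x => -(Ring.inverse (L x) (fderiv ℝ (fderiv ℝ X) x c c)) with hV
  have hLV : ∀ x ∈ O, L x (V x) = -(fderiv ℝ (fderiv ℝ X) x c c) := by
    intro x hx
    have h1 := Ring.mul_inverse_cancel _ hx.2
    have h2 := congrArg (fun A : 𝔸 →L[ℝ] 𝔸 => A (fderiv ℝ (fderiv ℝ X) x c c)) h1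
    rw [hV, map_neg]
    exact congrArg Neg.neg h2
  have hmem2 : ∀ x ∈ O, ∀ u w, fderiv ℝ (fderiv ℝ X) x u w ∈ S.𝔲₁ := by
    intro x hx u w
    have h1 : HasFDerivAt (fun y => fderiv ℝ X y w) ((fderiv ℝ (fderiv ℝ X) x).flip w) x := by
      refine (((hD.differentiableOn (by simp)).differentiableAt
        (hW.mem_nhds hx.1)).hasFDerivAt.clm_apply (hasFDerivAt_const w x)).congr_fderiv ?_
      ext h; simp
    have h2 := fderiv_mem_of_forall_mem S.𝔲₁ hOo
      (fun y hy => (hab y hy).1 (fderiv_mem_tangentSpace X y w)) hx u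
    rwa [h1.fderiv] at h2
  have hVm : ∀ x ∈ O, V x ∈ S.𝔲₁ := fun x hx =>
    mem_of_tangentOp_mem hπ (hab x hx).1 ((hab x hx).1 (fderiv_mem_tangentSpace X x c))
      (by change L x (V x) ∈ _; rw [hLV x hx]; exact S.𝔲₁.neg_mem (hmem2 x hx c c))
  refine ⟨O, hOW, ⟨hw₀, ?_⟩, V, c, hOo, hX.mono hOW, ?_, hVm, hab, fun x hx => ?_, fun x hx => ?_⟩
  · have h1 := tangentOp_injective hπ hπ' (hT w₀ hw₀).1 (fderiv_mem_tangentSpace X w₀ c) hp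
    exact ContinuousLinearMap.isUnit_iff_bijective.2
      ⟨h1, LinearMap.surjective_of_injective (f := (L w₀ : 𝔸 →ₗ[ℝ] 𝔸)) h1⟩
  · have h1 : ContDiffOn ℝ ∞ (fun x => Ring.inverse (L x)) O := fun x hx => by
      obtain ⟨u, hu⟩ := hx.2
      have h2 := contDiffAt_ringInverse ℝ (n := ∞) u
      rw [hu] at h2
      exact h2.comp_contDiffWithinAt x (hLs.mono hOW x hx)
    exact (h1.clm_apply (((hDD.mono hOW).clm_apply contDiffOn_const).clm_apply
      contDiffOn_const)).neg
  · exact centralizer₁_eq_range hπ' (hab x hx) (fderiv_mem_tangentSpace X x c) (hinj x hx)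
  · have h1 := hLV x hx
    simp only [hL] at h1
    rw [tangentOp_apply, hπ' _ (hVm x hx), sub_self, add_zero] at h1
    have h2 : fderiv ℝ (fderiv ℝ X) x c c - ⁅⁅fderiv ℝ X x c, V x⁆, fderiv ℝ X x c⁆ =
        -∑ i, S.B (V x) (fderiv ℝ X x (Pi.single i 1)) • fderiv ℝ X x (Pi.single i 1) := by
      rw [← lie_skew, sub_neg_eq_add, eq_neg_iff_add_eq_zero, add_assoc, h1, add_neg_cancel]
    rw [h2]
    exact Submodule.neg_mem _ (sum_mem_range _ _)

end Exists

variable {S} {O : Set (Fin m → ℝ)} {X V : (Fin m → ℝ) → 𝔸} {c : Fin m → ℝ}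

namespace IsPotential

lemma hasFDerivAt_fderiv (hV : S.IsPotential O X V c) {x : Fin m → ℝ} (hx : x ∈ O) :
    HasFDerivAt (fderiv ℝ X) (fderiv ℝ (fderiv ℝ X) x) x :=
  ((((contDiffOn_infty_iff_fderiv_of_isOpen hV.isOpen).1 hV.contDiffOn_map).2.differentiableOn
    (by simp)).differentiableAt (hV.isOpen.mem_nhds hx)).hasFDerivAt

lemma hasFDerivAt_fderiv_apply (hV : S.IsPotential O X V c) {x : Fin m → ℝ} (hx : x ∈ O)
    (w : Fin m → ℝ) :
    HasFDerivAt (fun y => fderiv ℝ X y w) ((fderiv ℝ (fderiv ℝ X) x).flip w) x := by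
  refine ((hV.hasFDerivAt_fderiv hx).clm_apply (hasFDerivAt_const w x)).congr_fderiv ?_
  ext h; simp

lemma hasFDerivAt (hV : S.IsPotential O X V c) {x : Fin m → ℝ} (hx : x ∈ O) :
    HasFDerivAt V (fderiv ℝ V x) x :=
  ((hV.contDiffOn.differentiableOn (by simp)).differentiableAt
    (hV.isOpen.mem_nhds hx)).hasFDerivAt

lemma fderiv_fderiv_symm (hV : S.IsPotential O X V c) {x : Fin m → ℝ} (hx : x ∈ O)
    (u w : Fin m → ℝ) :
    fderiv ℝ (fderiv ℝ X) x u w = fderiv ℝ (fderiv ℝ X) x w u :=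
  (hV.contDiffOn_map.contDiffAt (hV.isOpen.mem_nhds hx)).isSymmSndFDerivAt
    (by rw [minSmoothness_of_isRCLikeNormedField]; exact ENat.LEInfty.out) u w

lemma fderiv_mem (hV : S.IsPotential O X V c) {x : Fin m → ℝ} (hx : x ∈ O) (u : Fin m → ℝ) :
    fderiv ℝ X x u ∈ S.𝔲₁ := (hV.abelian x hx).1 (fderiv_mem_tangentSpace X x u)

lemma lie_fderiv (hV : S.IsPotential O X V c) {x : Fin m → ℝ} (hx : x ∈ O) (u w : Fin m → ℝ) :
    ⁅fderiv ℝ X x u, fderiv ℝ X x w⁆ = 0 :=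
  (hV.abelian x hx).2 _ (fderiv_mem_tangentSpace X x u) _ (fderiv_mem_tangentSpace X x w)

/-- The derivative of the relation `[t, p] = 0` between a tangent field `t` and `p = ∂_c X`. -/
lemma lie_fderiv_tangent (hV : S.IsPotential O X V c) {t : (Fin m → ℝ) → 𝔸}
    (ht : ∀ x ∈ O, t x ∈ tangentSpace X x) {x : Fin m → ℝ} (hx : x ∈ O)
    (hd : DifferentiableAt ℝ t x) (u : Fin m → ℝ) :
    ⁅fderiv ℝ t x u, fderiv ℝ X x c⁆ = -⁅t x, fderiv ℝ (fderiv ℝ X) x u c⁆ := by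
  have h1 := hasFDerivAt_lie hd.hasFDerivAt (hV.hasFDerivAt_fderiv_apply hx c)
  have h2 : HasFDerivAt (fun y => ⁅t y, fderiv ℝ X y c⁆) (0 : (Fin m → ℝ) →L[ℝ] 𝔸) x :=
    (hasFDerivAt_const (0 : 𝔸) x).congr_of_eventuallyEq
      (eventually_of_mem (hV.isOpen.mem_nhds hx) fun y hy =>
        (hV.abelian y hy).2 _ (ht y hy) _ (fderiv_mem_tangentSpace X y c))
  have h3 : ⁅t x, fderiv ℝ (fderiv ℝ X) x u c⁆ + ⁅fderiv ℝ t x u, fderiv ℝ X x c⁆ = 0 :=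
    congrArg (fun L => L u) (h1.unique h2)
  rw [eq_neg_iff_add_eq_zero, add_comm, h3]

lemma mem_tangentSpace (hV : S.IsPotential O X V c) {x : Fin m → ℝ} (hx : x ∈ O) {y : 𝔸}
    (hy : y ∈ S.𝔲₁) (h : ⁅y, fderiv ℝ X x c⁆ = 0) : y ∈ tangentSpace X x := by
  rw [← hV.centralizer₁_eq x hx]
  exact ⟨hy, lie_eq_zero_symm.1 h⟩

variable [FiniteDimensional ℂ 𝔸]

lemma fderiv_fderiv_mem (hV : S.IsPotential O X V c) {x : Fin m → ℝ} (hx : x ∈ O)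
    (u w : Fin m → ℝ) : fderiv ℝ (fderiv ℝ X) x u w ∈ S.𝔲₁ := by
  have h2 := fderiv_mem_of_forall_mem S.𝔲₁ hV.isOpen (fun y hy => hV.fderiv_mem hy w) hx u
  rwa [(hV.hasFDerivAt_fderiv_apply hx w).fderiv] at h2

/-- The connection maps the field `p` to tangent vectors, in all directions and not only in the
direction `c`. -/
lemma conn_mem_aux (hV : S.IsPotential O X V c) {x : Fin m → ℝ} (hx : x ∈ O) (u : Fin m → ℝ) :
    fderiv ℝ (fderiv ℝ X) x u c - ⁅⁅fderiv ℝ X x u, V x⁆, fderiv ℝ X x c⁆ ∈ tangentSpace X x := by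
  have hVx := hV.mem x hx
  refine hV.mem_tangentSpace hx (S.𝔲₁.sub_mem (hV.fderiv_fderiv_mem hx u c)
    (lie_mem_𝔲₁ (lie_mem_𝔲₀_of_𝔲₁ (hV.fderiv_mem hx u) hVx) (hV.fderiv_mem hx c))) ?_
  have h1 := hV.lie_fderiv_tangent (t := fun y => fderiv ℝ X y u)
    (fun y _ => fderiv_mem_tangentSpace X y u) hx
    (hV.hasFDerivAt_fderiv_apply hx u).differentiableAt c
  rw [(hV.hasFDerivAt_fderiv_apply hx u).fderiv, ContinuousLinearMap.flip_apply,
    hV.fderiv_fderiv_symm hx] at h1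
  have h2 := (hV.abelian x hx).2 _ (fderiv_mem_tangentSpace X x u) _ (hV.second_deriv_mem x hx)
  have hc := hV.lie_fderiv hx u c
  rw [lie_sub, sub_eq_zero] at h2
  set p := fderiv ℝ X x c
  set q := fderiv ℝ X x u
  rw [sub_lie, h1, h2, ← lie_skew ⁅p, V x⁆ p, lie_neg, neg_neg, ← lie_skew ⁅⁅q, V x⁆, p⁆ p,
    ← lie_skew ⁅q, V x⁆ p, lie_neg, neg_neg, lie_comm_of_lie_eq_zero hc ⁅p, V x⁆,
    lie_comm_of_lie_eq_zero hc (V x), sub_self]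

/-- The connection preserves the tangent fields. -/
lemma conn_tangent_mem (hV : S.IsPotential O X V c) {t : (Fin m → ℝ) → 𝔸}
    (ht : ∀ x ∈ O, t x ∈ tangentSpace X x) {x : Fin m → ℝ} (hx : x ∈ O)
    (hd : DifferentiableAt ℝ t x) (u : Fin m → ℝ) :
    fderiv ℝ t x u - ⁅⁅fderiv ℝ X x u, V x⁆, t x⁆ ∈ tangentSpace X x := by
  have htm : ∀ y ∈ O, t y ∈ S.𝔲₁ := fun y hy => (hV.abelian y hy).1 (ht y hy)
  have hω := lie_mem_𝔲₀_of_𝔲₁ (hV.fderiv_mem hx u) (hV.mem x hx)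
  refine hV.mem_tangentSpace hx (S.𝔲₁.sub_mem (fderiv_mem_of_forall_mem S.𝔲₁ hV.isOpen htm hx u)
    (lie_mem_𝔲₁ hω (htm x hx))) ?_
  have h1 := hV.lie_fderiv_tangent ht hx hd u
  have h2 := (hV.abelian x hx).2 _ (ht x hx) _ (hV.conn_mem_aux hx u)
  have hc := (hV.abelian x hx).2 _ (ht x hx) _ (fderiv_mem_tangentSpace X x c)
  rw [lie_sub, sub_eq_zero] at h2
  set Ω := ⁅fderiv ℝ X x u, V x⁆
  rw [sub_lie, h1, h2, lie_lie Ω (t x), hc, lie_zero, zero_sub, sub_self]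

end IsPotential

end SymmetricSpace

end Potential

/-! ### The flat connection of a potential and its parallel gauge -/

section Gauge

/-- A function `G` with `dG(u) = G ∘ Γ(u)` that vanishes at the center vanishes identically. -/
lemma eq_zero_of_fderiv_eq_comp {E F : Type*} [NormedAddCommGroup E] [NormedSpace ℝ E]
    [NormedAddCommGroup F] [NormedSpace ℝ F] {O : Set E} (hs : StarConvex ℝ 0 O)
    {Γ : E → E →L[ℝ] E →L[ℝ] E} (hΓ : ContinuousOn Γ O) {G : E → E →L[ℝ] F}
    {G' : E → E →L[ℝ] E →L[ℝ] F} (hG : ∀ x ∈ O, HasFDerivAt G (G' x) x)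
    (h : ∀ x ∈ O, ∀ u, G' x u = (G x).comp (Γ x u)) (h0 : G 0 = 0) : ∀ x ∈ O, G x = 0 := by
  refine eq_zero_of_norm_fderiv_le hs (ContinuousOn.norm (E := E →L[ℝ] E →L[ℝ] E) hΓ) hG
    (fun x hx u => ?_) h0
  rw [h x hx]
  calc ‖(G x).comp (Γ x u)‖ ≤ ‖G x‖ * ‖Γ x u‖ := ContinuousLinearMap.opNorm_comp_le _ _
    _ ≤ ‖G x‖ * (‖Γ x‖ * ‖u‖) := by gcongr; exact (Γ x).le_opNorm u
    _ = _ := by ring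

variable {𝔸 : Type*} [NormedRing 𝔸] [NormedAlgebra ℂ 𝔸] {m : ℕ}

namespace SymmetricSpace

variable {S : SymmetricSpace 𝔸} {O : Set (Fin m → ℝ)} {X V : (Fin m → ℝ) → 𝔸} {c : Fin m → ℝ}

/-- The form `ξ ↦ -[∂_ξ X, V]` of the connection defined by a potential `V`. -/
def connForm (X V : (Fin m → ℝ) → 𝔸) (x : Fin m → ℝ) : (Fin m → ℝ) →L[ℝ] 𝔸 :=
  -((lieL.flip (V x)).comp (fderiv ℝ X x))

lemma connForm_apply (X V : (Fin m → ℝ) → 𝔸) (x u : Fin m → ℝ) :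
    connForm X V x u = -⁅fderiv ℝ X x u, V x⁆ := rfl

namespace IsPotential

lemma mono (hV : S.IsPotential O X V c) {O' : Set (Fin m → ℝ)} (hO' : IsOpen O') (h : O' ⊆ O) :
    S.IsPotential O' X V c :=
  ⟨hO', hV.contDiffOn_map.mono h, hV.contDiffOn.mono h, fun x hx => hV.mem x (h hx),
    fun x hx => hV.abelian x (h hx), fun x hx => hV.centralizer₁_eq x (h hx),
    fun x hx => hV.second_deriv_mem x (h hx)⟩

lemma contDiffOn_fderiv (hV : S.IsPotential O X V c) : ContDiffOn ℝ ∞ (fderiv ℝ X) O :=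
  ((contDiffOn_infty_iff_fderiv_of_isOpen hV.isOpen).1 hV.contDiffOn_map).2

lemma contDiffOn_connForm (hV : S.IsPotential O X V c) : ContDiffOn ℝ ∞ (connForm X V) O := by
  have h : ContDiffOn ℝ ∞ (fun x => (lieL (𝔸 := 𝔸)).flip (V x)) O :=
    (lieL (𝔸 := 𝔸)).flip.contDiff.comp_contDiffOn hV.contDiffOn
  exact (h.clm_comp hV.contDiffOn_fderiv).neg

/-- The derivative of the bracket `[∂_w X, V]`. -/
lemma hasFDerivAt_lie_fderiv (hV : S.IsPotential O X V c) {x : Fin m → ℝ} (hx : x ∈ O)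
    (w : Fin m → ℝ) :
    HasFDerivAt (fun y => ⁅fderiv ℝ X y w, V y⁆) ((lieL (fderiv ℝ X x w)).comp (fderiv ℝ V x) +
      (lieL.flip (V x)).comp ((fderiv ℝ (fderiv ℝ X) x).flip w)) x :=
  hasFDerivAt_lie (hV.hasFDerivAt_fderiv_apply hx w) (hV.hasFDerivAt hx)

variable [FiniteDimensional ℂ 𝔸]

/-- The second covariant derivatives of a tangent field are tangent. -/
lemma second_conn_mem (hV : S.IsPotential O X V c) {x : Fin m → ℝ} (hx : x ∈ O)
    (u w z : Fin m → ℝ) :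
    fderiv ℝ (fderiv ℝ fun y => fderiv ℝ X y z) x u w -
        (⁅⁅fderiv ℝ X x w, V x⁆, fderiv ℝ (fun y => fderiv ℝ X y z) x u⁆ +
          ⁅⁅fderiv ℝ X x w, fderiv ℝ V x u⁆ + ⁅fderiv ℝ (fderiv ℝ X) x u w, V x⁆,
            fderiv ℝ X x z⁆) -
      ⁅⁅fderiv ℝ X x u, V x⁆, fderiv ℝ (fun y => fderiv ℝ X y z) x w -
        ⁅⁅fderiv ℝ X x w, V x⁆, fderiv ℝ X x z⁆⁆ ∈ tangentSpace X x := by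
  set g : (Fin m → ℝ) → 𝔸 := fun y => fderiv ℝ X y z with hg
  have hgs : ContDiffOn ℝ ∞ g O := hV.contDiffOn_fderiv.clm_apply contDiffOn_const
  have hgd : ∀ y ∈ O, DifferentiableAt ℝ g y := fun y hy =>
    (hV.hasFDerivAt_fderiv_apply hy z).differentiableAt
  have hgg : HasFDerivAt (fderiv ℝ g) (fderiv ℝ (fderiv ℝ g) x) x :=
    ((((contDiffOn_infty_iff_fderiv_of_isOpen hV.isOpen).1 hgs).2.differentiableOn
      (by simp)).differentiableAt (hV.isOpen.mem_nhds hx)).hasFDerivAt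
  have hgw : HasFDerivAt (fun y => fderiv ℝ g y w) ((fderiv ℝ (fderiv ℝ g) x).flip w) x :=
    (hgg.clm_apply (hasFDerivAt_const w x)).congr_fderiv (by ext h; simp)
  have ht : ∀ y ∈ O, fderiv ℝ g y w - ⁅⁅fderiv ℝ X y w, V y⁆, g y⁆ ∈ tangentSpace X y :=
    fun y hy => hV.conn_tangent_mem (fun y _ => fderiv_mem_tangentSpace X y z) hy (hgd y hy) w
  have hd := hgw.fun_sub (hasFDerivAt_lie (hV.hasFDerivAt_lie_fderiv hx w) (hgd x hx).hasFDerivAt)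
  have h := hV.conn_tangent_mem ht hx hd.differentiableAt u
  rw [hd.fderiv] at h
  exact h

/-- The connection defined by a potential is flat. -/
lemma curvature_eq_zero (hV : S.IsPotential O X V c) {x : Fin m → ℝ} (hx : x ∈ O)
    (u w : Fin m → ℝ) :
    ⁅fderiv ℝ X x w, fderiv ℝ V x u⁆ - ⁅fderiv ℝ X x u, fderiv ℝ V x w⁆ =
      ⁅⁅fderiv ℝ X x u, V x⁆, ⁅fderiv ℝ X x w, V x⁆⁆ := by
  have hVd : ∀ h, fderiv ℝ V x h ∈ S.𝔲₁ :=
    fun h => fderiv_mem_of_forall_mem S.𝔲₁ hV.isOpen hV.mem hx h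
  have hVx := hV.mem x hx
  have hDm := fun h => hV.fderiv_mem hx h
  have hDV : ∀ h h', ⁅fderiv ℝ X x h, fderiv ℝ V x h'⁆ ∈ S.𝔲₀ := fun h h' =>
    lie_mem_𝔲₀_of_𝔲₁ (hDm h) (hVd h')
  have hω : ∀ h, ⁅fderiv ℝ X x h, V x⁆ ∈ S.𝔲₀ := fun h => lie_mem_𝔲₀_of_𝔲₁ (hDm h) hVx
  rw [← sub_eq_zero]
  refine eq_zero_of_lie_mem (hV.abelian x hx) (hV.centralizer₁_eq x hx)
    (fderiv_mem_tangentSpace X x c)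
    (S.𝔲₀.sub_mem (S.𝔲₀.sub_mem (hDV w u) (hDV u w)) (lie_mem_𝔲₀ (hω u) (hω w))) ?_ ?_
  · -- the curvature is the commutator of covariant derivatives, so it preserves tangent fields
    rintro _ ⟨z, rfl⟩
    have h1 := hV.second_conn_mem hx u w z
    have h2 := hV.second_conn_mem hx w u z
    have hgs : ContDiffOn ℝ ∞ (fun y => fderiv ℝ X y z) O :=
      hV.contDiffOn_fderiv.clm_apply contDiffOn_const
    have hsymm : fderiv ℝ (fderiv ℝ fun y => fderiv ℝ X y z) x w u =
        fderiv ℝ (fderiv ℝ fun y => fderiv ℝ X y z) x u w :=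
      (hgs.contDiffAt (hV.isOpen.mem_nhds hx)).isSymmSndFDerivAt
        (by rw [minSmoothness_of_isRCLikeNormedField]; exact ENat.LEInfty.out) w u
    rw [hsymm, hV.fderiv_fderiv_symm hx w u] at h2
    have h3 := Submodule.sub_mem _ h2 h1
    rw [ContinuousLinearMap.coe_coe]
    convert h3 using 1
    rw [sub_lie, sub_lie, lie_lie ⁅fderiv ℝ X x u, V x⁆, add_lie, add_lie, lie_sub, lie_sub]
    abel
  · intro z hz hcz
    have hD0 : ∀ h, ⁅fderiv ℝ X x h, z⁆ = 0 := fun h => hcz _ (fderiv_mem_tangentSpace X x h)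
    have h1 : ∀ h h', S.B ⁅fderiv ℝ X x h, fderiv ℝ V x h'⁆ z = 0 := fun h h' => by
      rw [S.B_lie_left (𝔲₁_le_𝔲 (hDm h)) (𝔲₁_le_𝔲 (hVd h')) (𝔲₀_le_𝔲 hz), hD0, map_zero, neg_zero]
    rw [map_sub, map_sub, LinearMap.sub_apply, LinearMap.sub_apply, h1, h1,
      B_lie_lie_lie_eq_zero (hDm u) (hDm w) hVx hz (hV.lie_fderiv hx u w) (hD0 u) (hD0 w), sub_self,
      sub_self]

/-- The connection has a parallel gauge with values in `U₀`. -/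
lemma exists_gauge (hV : S.IsPotential O X V c) (hs : StarConvex ℝ 0 O) :
    ∃ H : (Fin m → ℝ) → 𝔸ˣ, H 0 = 1 ∧ (∀ x ∈ O, H x ∈ S.U₀) ∧
      ∀ x ∈ O, HasFDerivAt (fun y => (H y : 𝔸))
        ((ContinuousLinearMap.mul ℝ 𝔸 (H x)).comp (connForm X V x)) x := by
  have : CompleteSpace 𝔸 := FiniteDimensional.complete ℂ 𝔸
  have hflat : ∀ x ∈ O, ∀ u w, fderiv ℝ (connForm X V) x u w - fderiv ℝ (connForm X V) x w u =
      connForm X V x w * connForm X V x u - connForm X V x u * connForm X V x w := by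
    intro x hx u w
    have hder : ∀ u w, fderiv ℝ (connForm X V) x u w =
        -(⁅fderiv ℝ X x w, fderiv ℝ V x u⁆ + ⁅fderiv ℝ (fderiv ℝ X) x u w, V x⁆) := by
      intro u w
      have hd := ((hV.contDiffOn_connForm.differentiableOn (by simp)).differentiableAt
        (hV.isOpen.mem_nhds hx)).hasFDerivAt
      have h1 : HasFDerivAt (fun y => connForm X V y w) ((fderiv ℝ (connForm X V) x).flip w) x :=
        (hd.clm_apply (hasFDerivAt_const w x)).congr_fderiv (by ext h; simp)
      exact congrArg (fun L => L u) (h1.unique (hV.hasFDerivAt_lie_fderiv hx w).neg)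
    rw [hder, hder, hV.fderiv_fderiv_symm hx w u, ← lie_def, connForm_apply, connForm_apply,
      neg_lie, lie_neg, neg_neg,
      ← lie_skew ⁅fderiv ℝ X x w, V x⁆, ← hV.curvature_eq_zero hx u w]
    abel
  obtain ⟨H, hH0, hH⟩ := exists_flat_frame hV.isOpen hs
    (hV.contDiffOn_connForm.of_le (by simp)) hflat
  exact ⟨H, hH0, frame_mem hs S.U₀ S.isClosed_U₀ hV.contDiffOn_connForm.continuousOn
    (fun x hx h s => exp_mem_U₀ (S.𝔲₀.neg_mem (lie_mem_𝔲₀_of_𝔲₁ (hV.fderiv_mem hx h)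
      (hV.mem x hx))) s) hH0 hH, hH⟩

end IsPotential

/-- In the parallel gauge the differential of `X` becomes `ξ ↦ H (∂_ξ X) H⁻¹`. -/
def gaugedForm (X : (Fin m → ℝ) → 𝔸) (H : (Fin m → ℝ) → 𝔸ˣ) (x : Fin m → ℝ) :
    (Fin m → ℝ) →L[ℝ] 𝔸 := (conjL (H x)).comp (fderiv ℝ X x)

lemma gaugedForm_apply (X : (Fin m → ℝ) → 𝔸) (H : (Fin m → ℝ) → 𝔸ˣ) (x u : Fin m → ℝ) :
    gaugedForm X H x u = (H x : 𝔸) * fderiv ℝ X x u * (↑(H x)⁻¹ : 𝔸) := rfl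

namespace IsPotential

variable [FiniteDimensional ℂ 𝔸] {H : (Fin m → ℝ) → 𝔸ˣ}

lemma contDiffOn_gaugedForm (hV : S.IsPotential O X V c)
    (hH : ∀ x ∈ O, HasFDerivAt (fun y => (H y : 𝔸))
      ((ContinuousLinearMap.mul ℝ 𝔸 (H x)).comp (connForm X V x)) x) :
    ContDiffOn ℝ ∞ (gaugedForm X H) O := by
  have : CompleteSpace 𝔸 := FiniteDimensional.complete ℂ 𝔸
  exact (contDiffOn_conjL (contDiffOn_of_frame hV.isOpen hV.contDiffOn_connForm hH)).clm_comp
    hV.contDiffOn_fderiv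

lemma fderiv_gaugedForm (hV : S.IsPotential O X V c)
    (hH : ∀ x ∈ O, HasFDerivAt (fun y => (H y : 𝔸))
      ((ContinuousLinearMap.mul ℝ 𝔸 (H x)).comp (connForm X V x)) x) {x : Fin m → ℝ} (hx : x ∈ O)
    (u w : Fin m → ℝ) :
    fderiv ℝ (gaugedForm X H) x u w = conjL (H x)
      (fderiv ℝ (fderiv ℝ X) x u w - ⁅⁅fderiv ℝ X x u, V x⁆, fderiv ℝ X x w⁆) := by
  have : CompleteSpace 𝔸 := FiniteDimensional.complete ℂ 𝔸
  have hd := (((hV.contDiffOn_gaugedForm hH).differentiableOn (by simp)).differentiableAt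
    (hV.isOpen.mem_nhds hx)).hasFDerivAt
  have h1 : HasFDerivAt (fun y => gaugedForm X H y w) ((fderiv ℝ (gaugedForm X H) x).flip w) x :=
    (hd.clm_apply (hasFDerivAt_const w x)).congr_fderiv (by ext h; simp)
  have h2 := hasFDerivAt_frame_conj (hH x hx) (hV.hasFDerivAt_fderiv_apply hx w)
    (f' := (conjL (H x)).comp ((fderiv ℝ (fderiv ℝ X) x).flip w +
      (lieL.flip (fderiv ℝ X x w)).comp (connForm X V x))) (fun _ => rfl)
  have h3 := congrArg (fun L => L u) (h1.unique h2)
  rw [ContinuousLinearMap.flip_apply] at h3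
  rw [h3, sub_eq_add_neg, ← neg_lie]
  rfl

/-- The gauged differential of `X` is closed. -/
lemma fderiv_gaugedForm_symm (hV : S.IsPotential O X V c)
    (hH : ∀ x ∈ O, HasFDerivAt (fun y => (H y : 𝔸))
      ((ContinuousLinearMap.mul ℝ 𝔸 (H x)).comp (connForm X V x)) x) {x : Fin m → ℝ} (hx : x ∈ O)
    (u w : Fin m → ℝ) :
    fderiv ℝ (gaugedForm X H) x u w = fderiv ℝ (gaugedForm X H) x w u := by
  rw [hV.fderiv_gaugedForm hH hx, hV.fderiv_gaugedForm hH hx, hV.fderiv_fderiv_symm hx u w,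
    ← lie_skew _ (fderiv ℝ X x w), lie_comm_of_lie_eq_zero (hV.lie_fderiv hx w u), lie_skew]

/-- The gauged differential of `X` takes values in the fixed tangent space at `0`. -/
lemma gaugedForm_mem (hV : S.IsPotential O X V c) (hs : StarConvex ℝ 0 O)
    {R : 𝔸 →L[ℝ] (Fin m → ℝ)} (hR : ∀ x ∈ O, IsUnit (R.comp (fderiv ℝ X x))) (hH0 : H 0 = 1)
    (hH : ∀ x ∈ O, HasFDerivAt (fun y => (H y : 𝔸))
      ((ContinuousLinearMap.mul ℝ 𝔸 (H x)).comp (connForm X V x)) x) :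
    ∀ x ∈ O, ∀ u, gaugedForm X H x u ∈ tangentSpace X 0 := by
  have : CompleteSpace 𝔸 := FiniteDimensional.complete ℂ 𝔸
  intro x hx u
  rw [← Subspace.forall_mem_dualAnnihilator_apply_eq_zero_iff]
  intro φ' hφ'
  rw [Submodule.mem_dualAnnihilator] at hφ'
  set φ : 𝔸 →L[ℝ] ℝ := LinearMap.toContinuousLinearMap φ' with hφ
  have hA := hV.contDiffOn_gaugedForm hH
  have hHs := contDiffOn_of_frame hV.isOpen hV.contDiffOn_connForm hH
  -- the derivatives of the gauged form are `A ∘ Γ` for a continuous family of operators `Γ`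
  set Γ : (Fin m → ℝ) → (Fin m → ℝ) →L[ℝ] (Fin m → ℝ) →L[ℝ] (Fin m → ℝ) := fun x =>
    (ContinuousLinearMap.compL ℝ (Fin m → ℝ) 𝔸 (Fin m → ℝ)
      ((Ring.inverse (R.comp (fderiv ℝ X x))).comp (R.comp (conjL (H x)⁻¹)))).comp
        (fderiv ℝ (gaugedForm X H) x) with hΓ
  have hΓc : ContinuousOn Γ O := by
    have h1 : ContinuousOn (fun x => Ring.inverse (R.comp (fderiv ℝ X x))) O := fun x hx => by
      obtain ⟨a, ha⟩ := hR x hx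
      have h2 := (contDiffAt_ringInverse ℝ (n := 0) a).continuousAt
      rw [ha] at h2
      have h3 : ContinuousOn (fun x => R.comp (fderiv ℝ X x)) O :=
        (contDiffOn_const.clm_comp hV.contDiffOn_fderiv).continuousOn
      exact h2.comp_continuousWithinAt (f := fun x => R.comp (fderiv ℝ X x)) (h3 x hx)
    have h2 : ContinuousOn (fun x => conjL (H x)⁻¹) O := by
      refine (contDiffOn_conjL (k := ∞) (P := fun x => (H x)⁻¹) ?_).continuousOn
      exact contDiffOn_units_inv hHs
    have h3 : ContinuousOn (fderiv ℝ (gaugedForm X H)) O :=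
      ((contDiffOn_infty_iff_fderiv_of_isOpen hV.isOpen).1 hA).2.continuousOn
    have h4 : ContinuousOn (fun x => (Ring.inverse (R.comp (fderiv ℝ X x))).comp
        (R.comp (conjL (H x)⁻¹))) O := h1.clm_comp (continuousOn_const.clm_comp h2)
    have h5 : ContinuousOn (fun x => ContinuousLinearMap.compL ℝ (Fin m → ℝ) 𝔸 (Fin m → ℝ)
        ((Ring.inverse (R.comp (fderiv ℝ X x))).comp (R.comp (conjL (H x)⁻¹)))) O :=
      (ContinuousLinearMap.compL ℝ (Fin m → ℝ) 𝔸 (Fin m → ℝ)).continuous.comp_continuousOn h4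
    exact h5.clm_comp h3
  have hΓA : ∀ x ∈ O, ∀ u, fderiv ℝ (gaugedForm X H) x u = (gaugedForm X H x).comp (Γ x u) := by
    intro x hx u
    ext1 w
    have h1 := hV.fderiv_gaugedForm hH hx u w
    have h2 := hV.conn_tangent_mem (fun y _ => fderiv_mem_tangentSpace X y w) hx
      (hV.hasFDerivAt_fderiv_apply hx w).differentiableAt u
    rw [(hV.hasFDerivAt_fderiv_apply hx w).fderiv, ContinuousLinearMap.flip_apply] at h2
    obtain ⟨γ, hγ⟩ := h2
    rw [ContinuousLinearMap.coe_coe] at hγ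
    rw [← hγ] at h1
    have h3 : Γ x u w = γ := by
      have h4 : Γ x u w = Ring.inverse (R.comp (fderiv ℝ X x))
          (R (conjL (H x)⁻¹ (fderiv ℝ (gaugedForm X H) x u w))) := rfl
      have h5 := congrArg (fun A => A γ) (Ring.inverse_mul_cancel _ (hR x hx))
      rw [h4, h1, conjL_apply, conjL_apply, inv_inv, conj_inv_conj]
      exact h5
    rw [ContinuousLinearMap.comp_apply, h3, h1]
    rfl
  have key := eq_zero_of_fderiv_eq_comp hs hΓc (G := fun x => φ.comp (gaugedForm X H x))
    (G' := fun x => (ContinuousLinearMap.compL ℝ (Fin m → ℝ) 𝔸 ℝ φ).comp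
      (fderiv ℝ (gaugedForm X H) x))
    (fun y hy => ((ContinuousLinearMap.compL ℝ (Fin m → ℝ) 𝔸 ℝ φ).hasFDerivAt.comp y
      ((hA.differentiableOn (by simp)).differentiableAt (hV.isOpen.mem_nhds hy)).hasFDerivAt))
    (fun y hy h => ?_) ?_ x hx
  · exact congrArg (fun L => L u) key
  · change φ.comp (fderiv ℝ (gaugedForm X H) y h) = _
    rw [hΓA y hy]; rfl
  · ext1 w
    change φ' (gaugedForm X H 0 w) = 0
    rw [gaugedForm_apply, hH0]
    simpa using hφ' _ (fderiv_mem_tangentSpace X 0 w)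

end IsPotential

end SymmetricSpace

end Gauge

/-! ### Inverse charts and gauges with values in a fixed maximal abelian subspace -/

section LocalForm

/-- The inverse function theorem on a ball of coordinates. -/
lemma exists_inverse_chart {E F : Type*} [NormedAddCommGroup E] [NormedSpace ℝ E] [CompleteSpace E]
    [NormedAddCommGroup F] [NormedSpace ℝ F] {U : Set E} (hU : IsOpen U) (h0 : (0 : E) ∈ U)
    {f : E → F} (hf : ContDiffOn ℝ ∞ f U) (hf0 : f 0 = 0)
    (hf' : ∀ x ∈ U, ∃ e : E ≃L[ℝ] F, HasFDerivAt f (e : E →L[ℝ] F) x) :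
    ∃ (r : ℝ) (φ : OpenPartialHomeomorph F E), 0 < r ∧ φ.source = Metric.ball 0 r ∧
      φ.target ⊆ U ∧ φ 0 = 0 ∧ ContDiffOn ℝ ∞ φ φ.source ∧ ContDiffOn ℝ ∞ φ.symm φ.target ∧
      ∀ x ∈ Metric.ball 0 r, f (φ x) = x := by
  obtain ⟨e, he⟩ := hf' 0 h0
  have hfa : ∀ x ∈ U, ContDiffAt ℝ ∞ f x := fun x hx => hf.contDiffAt (hU.mem_nhds hx)
  set f₁ := ((hfa 0 h0).toOpenPartialHomeomorph f he (by simp)).restrOpen U hU with hf₁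
  have hcoe : ∀ x, f₁ x = f x := fun x => rfl
  have hsrc : f₁.source ⊆ U := by
    rw [hf₁, OpenPartialHomeomorph.restrOpen_source]; exact inter_subset_right
  have h0s : (0 : E) ∈ f₁.source := by
    rw [hf₁, OpenPartialHomeomorph.restrOpen_source]
    exact ⟨ContDiffAt.mem_toOpenPartialHomeomorph_source _ he _, h0⟩
  have h0t : (0 : F) ∈ f₁.target := by
    rw [← hf0, ← hcoe]; exact f₁.map_source h0s
  obtain ⟨r, hr, hball⟩ := Metric.isOpen_iff.1 f₁.open_target 0 h0t
  refine ⟨r, f₁.symm.restrOpen (Metric.ball 0 r) Metric.isOpen_ball, hr, ?_, ?_, ?_, ?_, ?_, ?_⟩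
  · rw [OpenPartialHomeomorph.restrOpen_source]
    exact inter_eq_right.2 hball
  · exact fun y hy => hsrc hy.1
  · change f₁.symm 0 = 0
    rw [← hf0, ← hcoe, f₁.left_inv h0s]
  · intro x hx
    rw [OpenPartialHomeomorph.restrOpen_source] at hx
    obtain ⟨e', he'⟩ := hf' _ (hsrc (f₁.map_target hx.1))
    exact (f₁.contDiffAt_symm hx.1 he' (hfa _ (hsrc (f₁.map_target hx.1)))).contDiffWithinAt
  · exact ContDiffOn.mono (s := U) hf fun y hy => hsrc hy.1
  · intro x hx
    exact f₁.right_inv (hball hx)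

variable {𝔸 : Type*} [NormedRing 𝔸] [NormedAlgebra ℂ 𝔸] {m n : ℕ}

namespace SymmetricSpace

variable {S : SymmetricSpace 𝔸} {𝒜 : Submodule ℝ 𝔸} {a : Fin n → 𝔸}

/-- If the Lax form at `λ = 0` of a field `v` is `g⁻¹ dg`, then `v` is a solution. -/
lemma isSolution_of_frame {O : Set (Fin n → ℝ)} (hO : IsOpen O) {v : (Fin n → ℝ) → 𝔸}
    (hv : ContDiffOn ℝ ∞ v O) (hmem : ∀ x ∈ O, v x ∈ S.𝔲₁)
    (horth : ∀ x ∈ O, ∀ b ∈ 𝒜, S.B b (v x) = 0) {g : (Fin n → ℝ) → 𝔸ˣ}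
    (hg : ∀ x ∈ O, HasFDerivAt (fun y => (g y : 𝔸))
      ((ContinuousLinearMap.mul ℝ 𝔸 (g x)).comp (laxForm a v 0 x)) x) :
    S.IsSolution 𝒜 a O v := by
  refine ⟨hv, hmem, horth, fun x hx i j _ => ?_⟩
  have hvd : HasFDerivAt v (fderiv ℝ v x) x :=
    ((hv.differentiableOn (by simp)).differentiableAt (hO.mem_nhds hx)).hasFDerivAt
  set f' : (Fin n → ℝ) → (Fin n → ℝ) →L[ℝ] 𝔸 := fun y =>
    (ContinuousLinearMap.mul ℝ 𝔸 (g y)).comp (laxForm a v 0 y) with hf'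
  have hf's : ContDiffOn ℝ ∞ f' O := by
    have h1 : ContDiffOn ℝ ∞ (fun y => ContinuousLinearMap.mul ℝ 𝔸 (g y : 𝔸)) O :=
      (ContinuousLinearMap.mul ℝ 𝔸).contDiff.comp_contDiffOn
        (contDiffOn_of_frame hO (contDiffOn_laxForm a hv 0) hg)
    exact h1.clm_comp (contDiffOn_laxForm a hv 0)
  have hd : HasFDerivAt f' (fderiv ℝ f' x) x :=
    ((hf's.differentiableOn (by simp)).differentiableAt (hO.mem_nhds hx)).hasFDerivAt
  have hsymm := second_derivative_symmetric_of_eventually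
    (eventually_of_mem (hO.mem_nhds hx) hg) hd
  have hder : ∀ u w, fderiv ℝ f' x u w = (g x : 𝔸) *
      (⁅linComb a u, v x⁆ * ⁅linComb a w, v x⁆ + ⁅linComb a w, fderiv ℝ v x u⁆) := by
    intro u w
    have h1 : HasFDerivAt (fun y => f' y w) ((fderiv ℝ f' x).flip w) x :=
      (hd.clm_apply (hasFDerivAt_const w x)).congr_fderiv (by ext h; simp)
    have h2 : HasFDerivAt (fun y => laxForm a v 0 y w)
        ((lieL (linComb a w)).comp (fderiv ℝ v x)) x :=
      ((lieL (linComb a w)).hasFDerivAt.comp x hvd).const_add ((0 : ℂ) • linComb a w)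
    have h3 := congrArg (fun L => L u) (h1.unique ((hg x hx).mul' h2))
    rw [ContinuousLinearMap.flip_apply] at h3
    rw [h3]
    simp [-lie_lie, laxForm_apply, mul_add, mul_assoc, add_comm]
  have h := hsymm (Pi.single i 1) (Pi.single j 1)
  rw [hder, hder, Units.mul_right_inj] at h
  simp only [linComb_single] at h
  rw [lie_def ⁅a i, v x⁆, pd, pd]
  rw [sub_eq_sub_iff_add_eq_add, add_comm, ← h]

/-- The coordinates `y ↦ (B(y, aᵢ))ᵢ` on `𝒜`. -/
def coordL (S : SymmetricSpace 𝔸) [FiniteDimensional ℂ 𝔸] (a : Fin n → 𝔸) :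
    𝔸 →L[ℝ] (Fin n → ℝ) :=
  ContinuousLinearMap.pi fun i => LinearMap.toContinuousLinearMap (S.B.flip (a i))

variable [FiniteDimensional ℂ 𝔸]

lemma coordL_apply (y : 𝔸) (i : Fin n) : S.coordL a y i = S.B y (a i) := rfl

lemma IsOrthonormalBasis.coordL_linComb (ha : S.IsOrthonormalBasis 𝒜 a) (h : Fin n → ℝ) :
    S.coordL a (linComb a h) = h :=
  funext fun i => ha.B_linComb h i

lemma IsOrthonormalBasis.linComb_coordL (ha : S.IsOrthonormalBasis 𝒜 a) {y : 𝔸} (hy : y ∈ 𝒜) :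
    linComb a (S.coordL a y) = y := by
  rw [← ha.2, ← range_linComb] at hy
  obtain ⟨h, rfl⟩ := hy
  rw [ContinuousLinearMap.coe_coe, ha.coordL_linComb]

/-- The map `y ↦ y - ∑ᵢ B(y, aᵢ) aᵢ`; on `𝔲₁` it is the orthogonal projection along `𝒜`. -/
def normalL (S : SymmetricSpace 𝔸) (a : Fin n → 𝔸) : 𝔸 →L[ℝ] 𝔸 :=
  ContinuousLinearMap.id ℝ 𝔸 - (linComb a).comp (S.coordL a)

lemma normalL_apply (y : 𝔸) : S.normalL a y = y - linComb a (S.coordL a y) := rfl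

lemma IsOrthonormalBasis.normalL_mem (h𝒜 : S.IsAbelianIn 𝒜) (ha : S.IsOrthonormalBasis 𝒜 a)
    {y : 𝔸} (hy : y ∈ S.𝔲₁) : S.normalL a y ∈ S.𝔲₁ :=
  S.𝔲₁.sub_mem hy (h𝒜.1 (ha.linComb_mem _))

lemma IsOrthonormalBasis.B_normalL (h𝒜 : S.IsAbelianIn 𝒜) (ha : S.IsOrthonormalBasis 𝒜 a)
    {y : 𝔸} (hy : y ∈ S.𝔲₁) {b : 𝔸} (hb : b ∈ 𝒜) : S.B b (S.normalL a y) = 0 := by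
  rw [S.B_symm₁ (h𝒜.1 hb) (ha.normalL_mem h𝒜 hy), ← ha.linComb_coordL hb]
  have : (LinearMap.toContinuousLinearMap (S.B (S.normalL a y))).comp (linComb a) = 0 :=
    clm_pi_ext fun i => by
      change S.B (S.normalL a y) (linComb a (Pi.single i 1)) = 0
      rw [linComb_single, normalL_apply, map_sub, LinearMap.sub_apply, ha.B_linComb, coordL_apply,
        sub_self]
  exact congrArg (fun L : (Fin n → ℝ) →L[ℝ] ℝ => L (S.coordL a b)) this

lemma IsOrthonormalBasis.lie_normalL (h𝒜 : S.IsAbelianIn 𝒜) (ha : S.IsOrthonormalBasis 𝒜 a)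
    (y : 𝔸) {b : 𝔸} (hb : b ∈ 𝒜) : ⁅b, S.normalL a y⁆ = ⁅b, y⁆ := by
  rw [normalL_apply, lie_sub, h𝒜.2 _ hb _ (ha.linComb_mem _), sub_zero]

/-- Around the parameter `0`, a submanifold with maximal abelian tangent spaces admits a gauge `Q`
in which its differential becomes an isomorphism onto the fixed maximal abelian subspace `𝒜`. -/
lemma exists_gauge_maxAbelian (h𝒜 : S.IsMaxAbelian 𝒜) {W : Set (Fin m → ℝ)}
    {X : (Fin m → ℝ) → 𝔸} (hW : IsOpen W) (hX : S.IsImmersion W X)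
    (hT : S.HasMaxAbelianTangent W X) (h0 : (0 : Fin m → ℝ) ∈ W) :
    ∃ (ρ : ℝ) (V : (Fin m → ℝ) → 𝔸) (c : Fin m → ℝ) (Q : (Fin m → ℝ) → 𝔸ˣ), 0 < ρ ∧
      Metric.ball 0 ρ ⊆ W ∧ S.IsPotential (Metric.ball 0 ρ) X V c ∧
      (∀ x ∈ Metric.ball (0 : Fin m → ℝ) ρ, Q x ∈ S.U₀) ∧
      (∀ x ∈ Metric.ball (0 : Fin m → ℝ) ρ, HasFDerivAt (fun y => (Q y : 𝔸))
        ((ContinuousLinearMap.mul ℝ 𝔸 (Q x)).comp (connForm X V x)) x) ∧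
      ∀ x ∈ Metric.ball (0 : Fin m → ℝ) ρ, (∀ u, gaugedForm X Q x u ∈ 𝒜) ∧
        ∀ y ∈ 𝒜, ∃ u, gaugedForm X Q x u = y := by
  have : CompleteSpace 𝔸 := FiniteDimensional.complete ℂ 𝔸
  obtain ⟨O, hOW, h0O, V, c, hV⟩ := exists_isPotential hW hX.contDiffOn hT h0
  obtain ⟨R', hR'⟩ := LinearMap.exists_leftInverse_of_injective
    (fderiv ℝ X 0 : (Fin m → ℝ) →ₗ[ℝ] 𝔸) (LinearMap.ker_eq_bot.2 (hX.injective 0 h0))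
  -- the immersion stays injective near `0` because `R ∘ dX` stays invertible
  set R : 𝔸 →L[ℝ] (Fin m → ℝ) := LinearMap.toContinuousLinearMap R'
  have hRs : ContinuousOn (fun x => R.comp (fderiv ℝ X x)) O :=
    (contDiffOn_const.clm_comp hV.contDiffOn_fderiv).continuousOn
  have hO' : IsOpen (O ∩ (fun x => R.comp (fderiv ℝ X x)) ⁻¹' {A | IsUnit A}) :=
    hRs.isOpen_inter_preimage hV.isOpen Units.isOpen
  obtain ⟨ρ, hρ, hball⟩ := Metric.isOpen_iff.1 hO' 0 ⟨h0O, by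
    have : R.comp (fderiv ℝ X 0) = 1 := by
      ext1 u; exact congrArg (fun L => L u) hR'
    change IsUnit (R.comp (fderiv ℝ X 0))
    rw [this]; exact isUnit_one⟩
  have hV' := hV.mono Metric.isOpen_ball fun x hx => (hball hx).1
  have hs : StarConvex ℝ 0 (Metric.ball (0 : Fin m → ℝ) ρ) :=
    (convex_ball _ _).starConvex (Metric.mem_ball_self hρ)
  obtain ⟨H, hH0, hHU, hH⟩ := hV'.exists_gauge hs
  have hHmem := hV'.gaugedForm_mem hs (fun x hx => (hball hx).2) hH0 hH
  obtain ⟨k, hk, hk1, hk2⟩ := S.exists_conj_maxAbelian h𝒜 (hT 0 h0)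
  have hQ : ∀ x u, gaugedForm X (fun x => k⁻¹ * H x) x u = (↑k⁻¹ : 𝔸) * gaugedForm X H x u * k := by
    intro x u; simp [gaugedForm_apply, mul_assoc]
  refine ⟨ρ, V, c, fun x => k⁻¹ * H x, hρ, fun x hx => hOW (hball hx).1, hV',
    fun x hx => S.U₀.mul_mem (S.U₀.inv_mem hk) (hHU x hx), fun x hx => ?_,
    fun x hx => ⟨fun u => ?_, fun y hy => ?_⟩⟩
  · refine ((ContinuousLinearMap.mul ℝ 𝔸 (↑k⁻¹ : 𝔸)).hasFDerivAt.comp x (hH x hx)).congr_fderiv ?_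
    ext u; simp [mul_assoc]
  · rw [hQ]
    exact hk2 _ (hHmem x hx u)
  · -- the conjugate of the tangent space at `0` contains the maximal tangent space at `x`
    have e := (hT x (hOW (hball hx).1)).2 _ ((hT 0 h0).1.comap_conj (hHU x hx)) (by
      rintro _ ⟨u, rfl⟩; exact hHmem x hx u)
    have h1 : (↑(H x)⁻¹ : 𝔸) * ((k : 𝔸) * y * (↑k⁻¹ : 𝔸)) * H x ∈ tangentSpace X x := by
      rw [← e, Submodule.mem_comap, ContinuousLinearMap.coe_coe, conjL_apply, conj_conj_inv]
      exact hk1 y hy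
    obtain ⟨u, hu⟩ := h1
    rw [ContinuousLinearMap.coe_coe] at hu
    refine ⟨u, ?_⟩
    rw [hQ, gaugedForm_apply, hu, conj_conj_inv, conj_inv_conj]

end SymmetricSpace

end LocalForm

/-! ### Local form of submanifolds with maximal abelian tangent spaces -/

section Converse

variable {𝔸 : Type*} [NormedRing 𝔸] [NormedAlgebra ℂ 𝔸] {m n : ℕ}

namespace SymmetricSpace

variable {S : SymmetricSpace 𝔸} {𝒜 : Submodule ℝ 𝔸} {a : Fin n → 𝔸} [FiniteDimensional ℂ 𝔸]

/-- A closed form whose values are isomorphisms onto `𝒜` becomes the constant form `h ↦ ∑ᵢ hᵢ aᵢ` in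
suitable coordinates `φ` around `0`: the components of a primitive are inverse to `φ`. -/
lemma exists_coordinates (ha : S.IsOrthonormalBasis 𝒜 a) {U : Set (Fin m → ℝ)} (hU : IsOpen U)
    (hconv : Convex ℝ U) (h0 : (0 : Fin m → ℝ) ∈ U) {A : (Fin m → ℝ) → (Fin m → ℝ) →L[ℝ] 𝔸}
    (hA : ContDiffOn ℝ ∞ A U) (hsymm : ∀ x ∈ U, ∀ u w, fderiv ℝ A x u w = fderiv ℝ A x w u)
    (hinj : ∀ x ∈ U, Function.Injective (A x)) (hmem : ∀ x ∈ U, ∀ u, A x u ∈ 𝒜)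
    (hsurj : ∀ x ∈ U, ∀ y ∈ 𝒜, ∃ u, A x u = y) :
    ∃ (r : ℝ) (φ : OpenPartialHomeomorph (Fin n → ℝ) (Fin m → ℝ)), 0 < r ∧
      φ.source = Metric.ball 0 r ∧ φ.target ⊆ U ∧ φ 0 = 0 ∧ ContDiffOn ℝ ∞ φ φ.source ∧
      ContDiffOn ℝ ∞ φ.symm φ.target ∧
      ∀ x ∈ Metric.ball (0 : Fin n → ℝ) r, ∀ h, A (φ x) (fderiv ℝ φ x h) = linComb a h := by
  have : CompleteSpace 𝔸 := FiniteDimensional.complete ℂ 𝔸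
  obtain ⟨Z', hZ'⟩ := hconv.exists_forall_hasFDerivAt_of_fderiv_symmetric hU
    (hA.differentiableOn (by simp)) hsymm
  set f : (Fin m → ℝ) → (Fin n → ℝ) := fun x => S.coordL a (Z' x - Z' 0) with hf
  have hfd : ∀ x ∈ U, HasFDerivAt f ((S.coordL a).comp (A x)) x := fun x hx =>
    (S.coordL a).hasFDerivAt.comp x ((hZ' x hx).sub_const _)
  have hfs : ContDiffOn ℝ ∞ f U := by
    rw [contDiffOn_infty_iff_fderiv_of_isOpen hU]
    refine ⟨fun x hx => (hfd x hx).differentiableAt.differentiableWithinAt, ?_⟩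
    exact (contDiffOn_const.clm_comp hA).congr fun x hx => (hfd x hx).fderiv
  have hfe : ∀ x ∈ U, ∃ e : (Fin m → ℝ) ≃L[ℝ] (Fin n → ℝ),
      HasFDerivAt f (e : (Fin m → ℝ) →L[ℝ] (Fin n → ℝ)) x := by
    intro x hx
    have hbij : Function.Bijective ((S.coordL a).comp (A x)) := by
      constructor
      · intro u w e
        apply hinj x hx
        rw [← ha.linComb_coordL (hmem x hx u), ← ha.linComb_coordL (hmem x hx w)]
        exact congrArg (linComb a) e
      · intro h
        obtain ⟨u, hu⟩ := hsurj x hx _ (ha.linComb_mem h)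
        exact ⟨u, by rw [ContinuousLinearMap.comp_apply, hu, ha.coordL_linComb]⟩
    refine ⟨(LinearEquiv.ofBijective
      ((S.coordL a).comp (A x) : (Fin m → ℝ) →ₗ[ℝ] (Fin n → ℝ)) hbij).toContinuousLinearEquiv,
      (hfd x hx).congr_fderiv ?_⟩
    ext1 u; rfl
  obtain ⟨r, φ, hr, h1, h2, h3, h4, h5, h6⟩ := exists_inverse_chart hU h0 hfs (by simp [hf]) hfe
  refine ⟨r, φ, hr, h1, h2, h3, h4, h5, fun x hx h => ?_⟩
  have hxs : x ∈ φ.source := by rw [h1]; exact hx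
  have hφx : φ x ∈ U := h2 (φ.map_source hxs)
  have hφd : HasFDerivAt φ (fderiv ℝ φ x) x :=
    ((h4.differentiableOn (by simp)).differentiableAt (φ.open_source.mem_nhds hxs)).hasFDerivAt
  have h7 : HasFDerivAt (fun y => f (φ y)) (ContinuousLinearMap.id ℝ (Fin n → ℝ)) x :=
    (hasFDerivAt_id x).congr_of_eventuallyEq
      (eventually_of_mem (Metric.isOpen_ball.mem_nhds hx) h6)
  have h8 : S.coordL a (A (φ x) (fderiv ℝ φ x h)) = h :=
    congrArg (fun L : (Fin n → ℝ) →L[ℝ] (Fin n → ℝ) => L h)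
      (((hfd _ hφx).comp x hφd).unique h7)
  rw [← ha.linComb_coordL (hmem _ hφx _), h8]

/-- The local form of submanifolds with maximal abelian tangent spaces, around the parameter `0`. -/
theorem exists_local_form (h𝒜 : S.IsMaxAbelian 𝒜) (ha : S.IsOrthonormalBasis 𝒜 a)
    {W : Set (Fin m → ℝ)} {X : (Fin m → ℝ) → 𝔸} (hW : IsOpen W) (hX : S.IsImmersion W X)
    (hT : S.HasMaxAbelianTangent W X) (h0 : (0 : Fin m → ℝ) ∈ W) :
    ∃ (r : ℝ) (v : (Fin n → ℝ) → 𝔸) (E : (Fin n → ℝ) → ℂ → 𝔸ˣ)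
      (φ : OpenPartialHomeomorph (Fin n → ℝ) (Fin m → ℝ)) (k : 𝔸ˣ),
      0 < r ∧ S.IsSolution 𝒜 a (Metric.ball 0 r) v ∧ S.IsFrame a (Metric.ball 0 r) v E ∧
      (∀ x ∈ Metric.ball (0 : Fin n → ℝ) r,
        DifferentiableAt ℂ (fun lam : ℂ => (E x lam : 𝔸)) 0) ∧
      φ.source = Metric.ball 0 r ∧ φ.target ⊆ W ∧ φ 0 = 0 ∧
      ContDiffOn ℝ ∞ φ φ.source ∧ ContDiffOn ℝ ∞ φ.symm φ.target ∧
      k ∈ S.U₀ ∧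
      ∀ x ∈ Metric.ball (0 : Fin n → ℝ) r,
        X (φ x) = X 0 + (k : 𝔸) * CurvedFlats.symMap E x * (↑k⁻¹ : 𝔸) := by
  have : CompleteSpace 𝔸 := FiniteDimensional.complete ℂ 𝔸
  obtain ⟨ρ, V, c, Q, hρ, hρW, hV, hQU, hQ, hQA⟩ := exists_gauge_maxAbelian h𝒜 hW hX hT h0
  have hinj : ∀ x ∈ Metric.ball (0 : Fin m → ℝ) ρ, Function.Injective (gaugedForm X Q x) := by
    intro x hx u w e
    apply hX.injective x (hρW hx)
    rw [← conj_inv_conj (Q x) (fderiv ℝ X x u), ← conj_inv_conj (Q x) (fderiv ℝ X x w)]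
    exact congrArg (fun y => (↑(Q x)⁻¹ : 𝔸) * y * (Q x : 𝔸)) e
  obtain ⟨r, φ, hr, hsrc, htgt, hφ0, hφs, hφs', hφA⟩ := exists_coordinates ha Metric.isOpen_ball
    (convex_ball _ _) (Metric.mem_ball_self hρ) (hV.contDiffOn_gaugedForm hQ)
    (fun x hx u w => hV.fderiv_gaugedForm_symm hQ hx u w) hinj (fun x hx => (hQA x hx).1)
    (fun x hx => (hQA x hx).2)
  set O := Metric.ball (0 : Fin n → ℝ) r with hO
  have hOo : IsOpen O := Metric.isOpen_ball
  have h0O : (0 : Fin n → ℝ) ∈ O := Metric.mem_ball_self hr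
  have hOc : Convex ℝ O := convex_ball _ _
  rw [hsrc] at hφs
  have hφU : ∀ x ∈ O, φ x ∈ Metric.ball (0 : Fin m → ℝ) ρ := fun x hx =>
    htgt (φ.map_source (by rw [hsrc]; exact hx))
  have hφd : ∀ x ∈ O, HasFDerivAt φ (fderiv ℝ φ x) x := fun x hx =>
    ((hφs.differentiableOn (by simp)).differentiableAt (hOo.mem_nhds hx)).hasFDerivAt
  have hQs : ContDiffOn ℝ ∞ (fun x => (Q (φ x) : 𝔸)) O :=
    (contDiffOn_of_frame hV.isOpen hV.contDiffOn_connForm hQ).comp hφs hφU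
  -- the differential of `X ∘ φ`
  have hXφ : ∀ x ∈ O, ∀ h, fderiv ℝ X (φ x) (fderiv ℝ φ x h) =
      (↑(Q (φ x))⁻¹ : 𝔸) * linComb a h * Q (φ x) := fun x hx h => by
    rw [← hφA x hx h, gaugedForm_apply, conj_inv_conj]
  have hkU := hQU _ (Metric.mem_ball_self hρ)
  set k : 𝔸ˣ := (Q 0)⁻¹ with hk
  set v : (Fin n → ℝ) → 𝔸 := fun x => S.normalL a (conjL (Q (φ x)) (V (φ x))) with hv
  set g : (Fin n → ℝ) → 𝔸ˣ := fun x => k⁻¹ * (Q (φ x))⁻¹ with hg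
  have hvm : ∀ x ∈ O, conjL (Q (φ x)) (V (φ x)) ∈ S.𝔲₁ := fun x hx =>
    conj_mem_𝔲₁ (hQU _ (hφU x hx)) (hV.mem _ (hφU x hx))
  have hvs : ContDiffOn ℝ ∞ v O :=
    (S.normalL a).contDiff.comp_contDiffOn
      ((contDiffOn_conjL hQs).clm_apply (hV.contDiffOn.comp hφs hφU))
  have hgd : ∀ x ∈ O, HasFDerivAt (fun y => (g y : 𝔸))
      ((ContinuousLinearMap.mul ℝ 𝔸 (g x)).comp (laxForm a v 0 x)) x := by
    intro x hx
    have h1 := (hasFDerivAt_frame_inv (hQ _ (hφU x hx))).comp x (hφd x hx)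
    refine ((ContinuousLinearMap.mul ℝ 𝔸 (↑k⁻¹ : 𝔸)).hasFDerivAt.comp x h1).congr_fderiv ?_
    ext h
    have h2 : ⁅linComb a h, v x⁆ = (Q (φ x) : 𝔸) * ⁅fderiv ℝ X (φ x) (fderiv ℝ φ x h), V (φ x)⁆ *
        (↑(Q (φ x))⁻¹ : 𝔸) := by
      rw [hv, ha.lie_normalL h𝒜.1 _ (ha.linComb_mem h), conjL_apply, conj_lie, ← gaugedForm_apply,
        hφA x hx]
    simp [laxForm_apply, h2, connForm_apply, hg, mul_assoc, -lie_lie]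
    rw [← lie_skew, neg_mul, mul_neg, neg_neg]
  have hsol : S.IsSolution 𝒜 a O v := isSolution_of_frame hOo hvs
    (fun x hx => ha.normalL_mem h𝒜.1 (hvm x hx))
    (fun x hx b hb => ha.B_normalL h𝒜.1 (hvm x hx) hb) hgd
  obtain ⟨E, hE⟩ := hsol.exists_frame h𝒜.1 ha hOo (hOc.starConvex h0O)
  obtain ⟨hE1, hE2, hE3⟩ := hE.symMap h𝒜.1 ha hOo hOc h0O hvs
  have hEg : ∀ x ∈ O, E x 0 = g x := fun x hx => Units.ext
    (frame_unique (hOc.starConvex h0O) (contDiffOn_laxForm a hvs 0).continuousOn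
      (fun y hy => hE.hasFDerivAt hy 0) hgd (by simp [hE.init, hg, hφ0, hk]) x hx)
  refine ⟨r, v, E, φ, k, hr, hsol, hE, hE1, hsrc, htgt.trans hρW, hφ0, by rwa [hsrc], hφs',
    S.U₀.inv_mem hkU, fun x hx => ?_⟩
  -- both sides have the same differential and agree at `0`
  have hXd : ∀ x ∈ O, HasFDerivAt X (fderiv ℝ X (φ x)) (φ x) := fun x hx =>
    ((hV.contDiffOn_map.differentiableOn (by simp)).differentiableAt
      (Metric.isOpen_ball.mem_nhds (hφU x hx))).hasFDerivAt
  have hd : ∀ x ∈ O, HasFDerivAt (fun y => X (φ y) - conjL k (CurvedFlats.symMap E y) - X 0)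
      ((fderiv ℝ X (φ x)).comp (fderiv ℝ φ x) - (conjL k).comp (conjForm a (E x 0))) x :=
    fun x hx => (((hXd x hx).comp x (hφd x hx)).fun_sub
      ((conjL k).hasFDerivAt.comp x (hE3 x hx))).sub_const _
  have hmem := mem_of_fderiv_mem (hOc.starConvex h0O) (⊥ : Submodule ℝ 𝔸) hd
    (fun y hy h => ?_) (by simp [hφ0, hE2]) x hx
  · rw [Submodule.mem_bot, sub_sub, sub_eq_zero, add_comm] at hmem
    exact hmem
  · rw [Submodule.mem_bot, sub_apply, sub_eq_zero, ContinuousLinearMap.comp_apply, hXφ y hy,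
      ContinuousLinearMap.comp_apply, conjForm_apply, hEg y hy, conjL_apply, hg]
    simp [mul_assoc]

/-- The local form of submanifolds with maximal abelian tangent spaces, around any parameter. -/
theorem exists_local_form_at (h𝒜 : S.IsMaxAbelian 𝒜) (ha : S.IsOrthonormalBasis 𝒜 a)
    {W : Set (Fin m → ℝ)} {X : (Fin m → ℝ) → 𝔸} (hW : IsOpen W) (hX : S.IsImmersion W X)
    (hT : S.HasMaxAbelianTangent W X) {w₀ : Fin m → ℝ} (hw₀ : w₀ ∈ W) :
    ∃ (r : ℝ) (v : (Fin n → ℝ) → 𝔸) (E : (Fin n → ℝ) → ℂ → 𝔸ˣ)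
      (φ : OpenPartialHomeomorph (Fin n → ℝ) (Fin m → ℝ)) (k : 𝔸ˣ),
      0 < r ∧ S.IsSolution 𝒜 a (Metric.ball 0 r) v ∧ S.IsFrame a (Metric.ball 0 r) v E ∧
      (∀ x ∈ Metric.ball (0 : Fin n → ℝ) r,
        DifferentiableAt ℂ (fun lam : ℂ => (E x lam : 𝔸)) 0) ∧
      φ.source = Metric.ball 0 r ∧ φ.target ⊆ W ∧ φ 0 = w₀ ∧
      ContDiffOn ℝ ∞ φ φ.source ∧ ContDiffOn ℝ ∞ φ.symm φ.target ∧
      k ∈ S.U₀ ∧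
      ∀ x ∈ Metric.ball (0 : Fin n → ℝ) r,
        X (φ x) = X w₀ + (k : 𝔸) * CurvedFlats.symMap E x * (↑k⁻¹ : 𝔸) := by
  have hcont : Continuous fun x : Fin m → ℝ => w₀ + x := by fun_prop
  have hfd : ∀ x, fderiv ℝ (fun y => X (w₀ + y)) x = fderiv ℝ X (w₀ + x) := fun x =>
    fderiv_comp_add_left w₀
  obtain ⟨r, v, E, φ, k, hr, h1, h2, h3, h4, h5, h6, h7, h8, h9, h10⟩ :=
    exists_local_form (X := fun x => X (w₀ + x)) h𝒜 ha (hW.preimage hcont)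
    ⟨hX.contDiffOn.comp (by fun_prop) fun x hx => hx, fun x hx => hX.mem _ hx,
      fun x hx => by rw [hfd]; exact hX.injective _ hx⟩
    (fun x hx => by
      have e : tangentSpace (fun y => X (w₀ + y)) x = tangentSpace X (w₀ + x) := by
        rw [tangentSpace, hfd, tangentSpace]
      rw [e]; exact hT _ hx) (by simpa using hw₀)
  refine ⟨r, v, E, φ.transHomeomorph (Homeomorph.addLeft w₀), k, hr, h1, h2, h3, h4, ?_, ?_, ?_,
    ?_, h9, ?_⟩
  · intro y hy
    have h : w₀ + (-w₀ + y) ∈ W := h5 hy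
    rwa [add_neg_cancel_left] at h
  · simp [h6]
  · exact contDiffOn_const.add h7
  · refine h8.comp (g := φ.symm) (f := fun y => -w₀ + y) (by fun_prop) fun y hy => hy
  · intro x hx
    have := h10 x hx
    simpa using this

end SymmetricSpace

end Converse

end CurvedFlats

end

theorem theorem3p13 {𝔸 : Type*} [NormedRing 𝔸] [NormedAlgebra ℂ 𝔸] [FiniteDimensional ℂ 𝔸]
    (S : CurvedFlats.SymmetricSpace 𝔸) {n : ℕ} (𝒜 : Submodule ℝ 𝔸) (h𝒜 : S.IsMaxAbelian 𝒜)
    (a : Fin n → 𝔸) (ha : S.IsOrthonormalBasis 𝒜 a) :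
    (∀ v : (Fin n → ℝ) → 𝔸, S.IsSolution 𝒜 a Set.univ v →
      (∃ E : (Fin n → ℝ) → ℂ → 𝔸ˣ, S.IsFrame a Set.univ v E) ∧
      ∀ E : (Fin n → ℝ) → ℂ → 𝔸ˣ, S.IsFrame a Set.univ v E →
        (∀ x, DifferentiableAt ℂ (fun lam : ℂ => (E x lam : 𝔸)) 0) ∧
        S.IsImmersion Set.univ (CurvedFlats.symMap E) ∧
        S.IsFlat Set.univ (CurvedFlats.symMap E) ∧
        S.HasMaxAbelianTangent Set.univ (CurvedFlats.symMap E)) ∧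
    (∀ (m : ℕ) (W : Set (Fin m → ℝ)) (X : (Fin m → ℝ) → 𝔸), IsOpen W →
      S.IsImmersion W X → S.IsFlat W X → S.HasMaxAbelianTangent W X →
      (∀ w ∈ W, S.IsRegular (X w)) →
      ∀ w₀ ∈ W, ∃ (r : ℝ) (v : (Fin n → ℝ) → 𝔸) (E : (Fin n → ℝ) → ℂ → 𝔸ˣ)
        (φ : OpenPartialHomeomorph (Fin n → ℝ) (Fin m → ℝ)) (k : 𝔸ˣ),
        0 < r ∧ S.IsSolution 𝒜 a (Metric.ball 0 r) v ∧ S.IsFrame a (Metric.ball 0 r) v E ∧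
        (∀ x ∈ Metric.ball (0 : Fin n → ℝ) r,
          DifferentiableAt ℂ (fun lam : ℂ => (E x lam : 𝔸)) 0) ∧
        φ.source = Metric.ball 0 r ∧ φ.target ⊆ W ∧ φ 0 = w₀ ∧
        ContDiffOn ℝ ∞ φ φ.source ∧ ContDiffOn ℝ ∞ φ.symm φ.target ∧
        k ∈ S.U₀ ∧
        ∀ x ∈ Metric.ball (0 : Fin n → ℝ) r,
          X (φ x) = X w₀ + (k : 𝔸) * CurvedFlats.symMap E x * (↑k⁻¹ : 𝔸)) := by
  refine ⟨fun v hv => ⟨hv.exists_frame h𝒜.1 ha isOpen_univ (starConvex_univ 0),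
    fun E hE => hE.curvedFlat h𝒜 ha hv⟩, fun m W X hW hX _ hT _ w₀ hw₀ => ?_⟩
  exact CurvedFlats.SymmetricSpace.exists_local_form_at h𝒜 ha hW hX hT hw₀
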